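/- Let $k$ be an algebraically closed field of characteristic zero. A *Fibonacci category* over $k$ is a semisimple $k$-linear abelian category with finite-dimensional hom spaces and a $k$-linear monoidal structure which has, up to isomorphism, exactly two simple objects, the unit $I$ and an object $X$, with $X\otimes X\cong I\oplus X$ (rigidity is not assumed). A *braided balanced structure* on it is a braiding $c$ together with a natural automorphism $\theta$ of the identity functor such that $\theta_{Y\otimes Z}=c_{Z,Y}\,c_{Y,Z}\,(\theta_Y\otimes\theta_Z)$. A $k$-linear braided balanced category is *modular* if it is fusion (finitely semisimple with $k$-linear tensor product, simple unit, rigid), ribbon ($\theta_{Y^*}=(\theta_Y)^*$), and the matrix $\tilde S_{Y,Z}=\operatorname{tr}(c_{Y,Z}c_{Z,Y})$, with $Y,Z$ running over the simple objects up to isomorphism, is non-degenerate; here the trace of $f:Y\to Y$ is $I\xrightarrow{\mathrm{coev}}Y\otimes Y^*\xrightarrow{\theta_Yf\otimes 1}Y\otimes Y^*\xrightarrow{c}Y^*\otimes Y\xrightarrow{\mathrm{ev}}I$. For $u\in k^{*}$ put $a=u+u^{-1}$. We say that a braided balanced Fibonacci category *has parameter $u$* if there are non-zero $p:X\otimes X\to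 X$ and $q:X\otimes X\to I$ such that, suppressing unit constraints and writing $\alpha=\alpha_{X,X,X}:(X\otimes X)\otimes X\to X\otimes(X\otimes X)$, $$q(p\otimes 1)=q(1\otimes p)\alpha,\qquad \begin{pmatrix}p(p\otimes 1)\\ q\otimes 1\end{pmatrix}=\begin{pmatrix}a&1\\-a&-a\end{pmatrix}\begin{pmatrix}p(1\otimes p)\alpha\\ (1\otimes q)\alpha\end{pmatrix},$$ $$p\,c_{X,X}=u\,p,\qquad q\,c_{X,X}=u^2\,q,\qquad \theta_X=u^{-2}1_X .$$ **Theorem.** 1. Every braided balanced structure on a Fibonacci category is modular. 2. There are exactly four primitive 10th roots of unity in $k$, and there is a family of modular Fibonacci categories $\mathcal{F}ib_u$, indexed by the primitive 10th roots of unity $u$, such that $\mathcal{F}ib_u$ has parameter $u$; for $u\ne u'$ the categories $\mathcal{F}ib_u$ and $\mathcal{F}ib_{u'}$ are not equivalent, even as $k$-linear braided monoidal categories; and every braided balanced Fibonacci category is equivalent, as a $k$-linear braided balanced monoidal category, to $\mathcal{F}ib_u$ for exactly one $u$. Moreover a braided balanced Fibonacci category is so equivalent to $\mathcal{F}ib_u$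 if and only if it has parameter $u$. 3. Let $\mathcal C$ be a braided balanced Fibonacci category with parameter $u$, and $a=u+u^{-1}$. Then $\theta_I=1_I$, $\theta_X=u^{-2}1_X$, $\dim X=1-a$, $\operatorname{Dim}(\mathcal C)=\sum_Y(\dim Y)^2=3-a$ (sum over simple objects $Y\in\{I,X\}$), and, with rows and columns ordered as $I,X$, $$\tilde S=\begin{pmatrix}1&1-a\\1-a&-1\end{pmatrix}.$$ For every choice of square root $\sqrt{3-a}$ of $\operatorname{Dim}(\mathcal C)$, let $S=\frac1{\sqrt{3-a}}\tilde S$ and let $\xi=\frac{1}{\sqrt{3-a}}\sum_{Y}\theta(Y)(\dim Y)^2$ be the multiplicative central charge, where $\theta_Y=\theta(Y)1_Y$. Then $$S=\frac{1}{\sqrt{3-a}}\begin{pmatrix}1&1-a\\1-a&-1\end{pmatrix},\qquad \xi^2=u^{-1},$$ and for every choice of cube root $\xi^{-1/3}$ of $\xi^{-1}$ the matrix $T=\xi^{-1/3}\operatorname{diag}(\theta(I),\theta(X))$ is $$T=u^{1/6}\begin{pmatrix}1&0\\0&u^{-2}\end{pmatrix},$$ where $u^{1/6}=\xi^{-1/3}$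 is a sixth root of $u$. -/

import Mathlib

open CategoryTheory CategoryTheory.Limits CategoryTheory.MonoidalCategory

universe w v u v' u'

noncomputable section

namespace FibCat

/-- A twist (balanced structure) on a braided monoidal category: a natural automorphism `θ` of the
identity functor with `θ_{X ⊗ Y} = c_{Y,X} ∘ c_{X,Y} ∘ (θ_X ⊗ θ_Y)`. The normalisation `θ_𝟙 = id`
follows from this identity at the unit, `θ` being invertible. -/
class Balanced (C : Type u) [Category.{v} C] [MonoidalCategory C] [BraidedCategory C] where
  twist : ∀ X : C, X ≅ X
  twist_naturality : ∀ {X Y : C} (f : X ⟶ Y), f ≫ (twist Y).hom = (twist X).hom ≫ f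
  twist_tensor : ∀ X Y : C, (twist (X ⊗ Y)).hom =
    ((twist X).hom ⊗ₘ (twist Y).hom) ≫ (β_ X Y).hom ≫ (β_ Y X).hom

/-- The twist `θ_X : X ⟶ X`. -/
def θ {C : Type u} [Category.{v} C] [MonoidalCategory C] [BraidedCategory C] [Balanced C] (X : C) :
    X ⟶ X := (Balanced.twist X).hom

/-- A family of objects is a system of representatives of the isomorphism classes of simple
objects. -/
structure IsSimpleSystem {C : Type u} [Category.{v} C] [HasZeroMorphisms C] {ι : Type*}
    (R : ι → C) : Prop where
  simple : ∀ i, Simple (R i)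
  injective : ∀ i j, Nonempty (R i ≅ R j) → i = j
  exhaustive : ∀ S : C, Simple S → ∃ i, Nonempty (S ≅ R i)

section Linear

attribute [local instance] Abelian.hasFiniteBiproducts

variable (k : Type w) [Field k] (C : Type u) [Category.{v} C] [Abelian C] [Linear k C]

/-- A `k`-linear abelian category is (finitely) semisimple: hom spaces are finite-dimensional,
every object is a finite direct sum of simple objects, and there are finitely many simple objects
up to isomorphism. -/
structure IsFinitelySemisimple : Prop where
  finite_hom : ∀ X Y : C, FiniteDimensional k (X ⟶ Y)
  sum_of_simples : ∀ X : C, ∃ (n : ℕ) (S : Fin n → C), (∀ i, Simple (S i)) ∧ Nonempty (X ≅ ⨁ S)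
  finite_simples : ∃ (n : ℕ) (R : Fin n → C), IsSimpleSystem R

/-- A semisimple `k`-linear category with a monoidal structure (whose tensor product is required to
be `k`-linear wherever this is used) is a Fibonacci category if it has, up to isomorphism, exactly
two simple objects, the unit `𝟙` and some `X`, and `X ⊗ X ≅ 𝟙 ⊕ X`. -/
structure IsFibonacci [MonoidalCategory C] : Prop where
  semisimple : IsFinitelySemisimple k C
  fusion : ∃ X : C, IsSimpleSystem ![𝟙_ C, X] ∧ Nonempty (X ⊗ X ≅ 𝟙_ C ⊞ X)

variable {C}

/-- The scalar `s` with `f = s • id`, for an endomorphism `f` of a simple object. -/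
def scalar {X : C} (f : X ⟶ X) : k := Classical.epsilon fun s : k => f = s • 𝟙 X

end Linear

section Ribbon

variable {C : Type u} [Category.{v} C] [MonoidalCategory C] [BraidedCategory C] [Balanced C]

/-- The quantum trace of `f : X ⟶ X`, an endomorphism of the unit:
`𝟙 ⟶ X ⊗ X* ⟶ X ⊗ X* ⟶ X* ⊗ X ⟶ 𝟙`, where the maps are the coevaluation, `(θ_X ∘ f) ⊗ id`, the
braiding and the evaluation. -/
def qtrace [RigidCategory C] {X : C} (f : X ⟶ X) : 𝟙_ C ⟶ 𝟙_ C :=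
  η_ X Xᘁ ≫ ((f ≫ θ X) ▷ Xᘁ) ≫ (β_ X Xᘁ).hom ≫ ε_ X Xᘁ

variable (C) in
/-- The twist is compatible with duality, `θ_{X*} = (θ_X)*`. -/
def IsRibbon [RigidCategory C] : Prop :=
  ∀ X : C, η_ X Xᘁ ≫ (θ X ▷ Xᘁ) = η_ X Xᘁ ≫ (X ◁ θ Xᘁ)

end Ribbon

section ModularData

variable (k : Type w) [Field k] {C : Type u} [Category.{v} C] [Abelian C] [Linear k C]
  [MonoidalCategory C] [BraidedCategory C] [Balanced C] {ι : Type*}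

/-- The dimension of an object: the trace of its identity. -/
def qdim [RigidCategory C] (X : C) : k := scalar k (qtrace (𝟙 X))

/-- The unnormalised `S`-matrix, `tr (c_{X,Y} ∘ c_{Y,X})` for `X`, `Y` in the family. -/
def sTilde [RigidCategory C] (R : ι → C) : Matrix ι ι k :=
  Matrix.of fun i j => scalar k (qtrace ((β_ (R j) (R i)).hom ≫ (β_ (R i) (R j)).hom))

/-- The categorical dimension (the sum of the squared dimensions of the simple objects). -/
def globalDim [RigidCategory C] [Fintype ι] (R : ι → C) : k := ∑ i, qdim k (R i) ^ 2

/-- The multiplicative central charge, with respect to a square root `s` of the categorical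
dimension. -/
def centralCharge [RigidCategory C] [Fintype ι] (R : ι → C) (s : k) : k :=
  s⁻¹ * ∑ i, scalar k (θ (R i)) * qdim k (R i) ^ 2

/-- The normalised `S`-matrix, with respect to a square root `s` of the categorical dimension. -/
def sMatrix [RigidCategory C] (R : ι → C) (s : k) : Matrix ι ι k := s⁻¹ • sTilde k R

/-- The normalised `T`-matrix, with respect to a value `z` of `ξ ^ (-1/3)`, where `ξ` is the central
charge. -/
def tMatrix [DecidableEq ι] (R : ι → C) (z : k) : Matrix ι ι k :=
  z • Matrix.diagonal fun i => scalar k (θ (R i))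

variable (C) in
/-- A `k`-linear balanced braided category is modular if it is fusion (finitely semisimple, with
`k`-linear tensor product and simple unit, and rigid), ribbon, and has a non-degenerate matrix of
traces of double braidings of simple objects. -/
structure IsModular : Prop where
  semisimple : IsFinitelySemisimple k C
  tensor_additive : MonoidalPreadditive C
  tensor_linear : MonoidalLinear k C
  simple_unit : Simple (𝟙_ C)
  rigid : Nonempty (RigidCategory C)
  ribbon : ∀ [RigidCategory C], IsRibbon C
  nondegenerate : ∀ [RigidCategory C] (n : ℕ) (R : Fin n → C), IsSimpleSystem R →
    (sTilde k R).det ≠ 0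

variable (C) in
/-- The structure constants of the Fibonacci category with parameter `u`, where `a = u + u⁻¹`: for a
simple non-unit object `X` and basis vectors `p` of `Hom(X ⊗ X, X)` and `q` of `Hom(X ⊗ X, 𝟙)`,
* the associativity constraint is `1` on `Hom(X ⊗ X ⊗ X, 𝟙)` and the matrix `(a, 1; -a, -a)` on
  `Hom(X ⊗ X ⊗ X, X)`, in the bases of trees built from `p` and `q`;
* the braiding `c_{X,X}` acts by `u` on `Hom(X ⊗ X, X)` and by `u²` on `Hom(X ⊗ X, 𝟙)`;
* the twist of `X` is `u⁻²`. -/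
def HasFibonacciConstants (u : k) : Prop :=
  ∃ (X : C) (p : X ⊗ X ⟶ X) (q : X ⊗ X ⟶ 𝟙_ C),
    IsSimpleSystem ![𝟙_ C, X] ∧ p ≠ 0 ∧ q ≠ 0 ∧
    (p ▷ X) ≫ q = (α_ X X X).hom ≫ (X ◁ p) ≫ q ∧
    (p ▷ X) ≫ p = (u + u⁻¹) • ((α_ X X X).hom ≫ (X ◁ p) ≫ p)
      + (α_ X X X).hom ≫ (X ◁ q) ≫ (ρ_ X).hom ∧
    (q ▷ X) ≫ (λ_ X).hom = (-(u + u⁻¹)) • ((α_ X X X).hom ≫ (X ◁ p) ≫ p)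
      + (-(u + u⁻¹)) • ((α_ X X X).hom ≫ (X ◁ q) ≫ (ρ_ X).hom) ∧
    (β_ X X).hom ≫ p = u • p ∧
    (β_ X X).hom ≫ q = u ^ 2 • q ∧
    θ X = (u ^ 2)⁻¹ • 𝟙 X

end ModularData

/-- A Fibonacci category over `k` with a braided balanced structure. -/
structure BalancedFibonacci (k : Type w) [Field k] where
  carrier : Type u
  [category : Category.{v} carrier]
  [abelian : Abelian carrier]
  [linear : Linear k carrier]
  [monoidal : MonoidalCategory carrier]
  [monoidalPreadditive : MonoidalPreadditive carrier]
  [monoidalLinear : MonoidalLinear k carrier]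
  [braided : BraidedCategory carrier]
  [balanced : Balanced carrier]
  isFibonacci : IsFibonacci k carrier

attribute [instance] BalancedFibonacci.category BalancedFibonacci.abelian BalancedFibonacci.linear
  BalancedFibonacci.monoidal BalancedFibonacci.monoidalPreadditive BalancedFibonacci.monoidalLinear
  BalancedFibonacci.braided BalancedFibonacci.balanced

section Equivalence

variable (k : Type w) [Field k]
  (C : Type u) [Category.{v} C] [Preadditive C] [Linear k C] [MonoidalCategory C]
  [BraidedCategory C]
  (D : Type u') [Category.{v'} D] [Preadditive D] [Linear k D] [MonoidalCategory D]
  [BraidedCategory D]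

/-- `C` and `D` are equivalent as `k`-linear braided monoidal categories. -/
def BraidedEquivalent : Prop :=
  ∃ (F : C ⥤ D) (_ : F.Additive), F.Linear k ∧ F.IsEquivalence ∧ Nonempty F.Braided

/-- `C` and `D` are equivalent as `k`-linear balanced braided monoidal categories. -/
def BalancedEquivalent [Balanced C] [Balanced D] : Prop :=
  ∃ (F : C ⥤ D) (_ : F.Additive), F.Linear k ∧ F.IsEquivalence ∧ Nonempty F.Braided ∧
    ∀ X : C, F.map (θ X) = θ (F.obj X)

end Equivalence

end FibCat

end

/-!
A balanced braided Fibonacci category is determined by one scalar, the eigenvalue `u` of the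
braiding on the line `Hom(X ⊗ X, X)`, and this scalar may be any root of the tenth cyclotomic
polynomial `Φ₁₀ = t⁴ - t³ + t² - t + 1`. The roots of `Φ₁₀` are the four primitive tenth roots of
unity, and `u` is visibly an invariant of braided equivalence. The proof has three parts.

*Every category has a parameter.* Choose morphisms `p : X ⊗ X ⟶ X`, `q : X ⊗ X ⟶ 𝟙` that exhibit
`X ⊗ X` as a biproduct (`FusionBasis`). The associator of `X` is then a matrix that relates the left
trees `p (p ⊗ 1)`, `q ⊗ 1`, `q (p ⊗ 1)` to the right trees (`TreeRelations`). The pentagon identity,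
evaluated on the trees on four copies of `X`, leaves free, up to rescaling of `q`, only a scalar `a`
with `a² = a + 1` (`TreeRelations.coefficients`). The hexagon identity gives `a = u + u⁻¹` and the
eigenvalue `u²` on `Hom(X ⊗ X, 𝟙)` (`TreeRelations.hexagon`), so that `Φ₁₀(u) = 0`, and naturality
of the twist at `p` gives `θ_X = u⁻²` (`FusionBasis.exists_fibonacciBasis`).

*Every root of `Φ₁₀` occurs, exactly once up to equivalence.* The category with parameter `u` is
built by hand: an object of `FibObj k u` is a finite family of labels, a morphism is a matrix that
respects the labels, and the associator, the braiding and the twist are the scalar matrices found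
above. The coherence equations become finitely many identities between these scalars
(`pentagon_scalar`, `hexagon_scalar`), and explicit duality morphisms make this category rigid.
Given any Fibonacci category with parameter `u`, sending a family of labels to the direct sum of the
objects they name is a `k`-linear equivalence from `FibObj k u` by Schur's lemma, and the trees in
`p` and `q` give it a braided monoidal structure that is compatible with the twists
(`IsFibonacci.balancedEquivalent_model`). In particular every balanced braided Fibonacci category is
rigid.

*Modular data.* Traces do not depend on the choice of duals (`dualTrace_eq`), and `X` is dual to
itself through `q`, so that traces can be computed in the basis `p`, `q`: this gives `dim X = 1 - a`
and `tr (c²) = -1` for the double braiding of `X` with itself. The twist is a scalar on `X` and on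
its dual, which is isomorphic to `X`, and the ribbon identity follows by decomposing objects into
simple ones. The determinant of the resulting `S`-matrix is `a - 3`, which is non-zero because
`a² = a + 1`, and the central charge is computed modulo `Φ₁₀(u)`.
-/

noncomputable section

set_option linter.unusedSectionVars false

namespace FibCat

/-! ### Families of labels and matrices -/

/-- The fusion rule. A label is `some false` for the unit object, `some true` for the object `X`
with `X ⊗ X = 𝟙 ⊕ X`, and `none` for a zero object. As no multiplicity exceeds one, the summands of
the product of the labels `a` and `b` are indexed by the labels `c` that occur in it: the value of
`fuse a b c` is `some c` if `c` occurs and `none` otherwise. -/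
def fuse : Option Bool → Option Bool → Bool → Option Bool
  | some a, some b, c => if (a && b) || (c == (a || b)) then some c else none
  | _, _, _ => none

/-- An object of the matrix model: a finite set of indices, each with a label, standing for the
direct sum of the objects named by the labels. Indices labelled `none` are allowed, so that the
index set of a tensor product is a plain product of types. The scalar `u` is carried along because
it enters the associator and the braiding. -/
structure FibObj (k : Type w) [Field k] (u : k) : Type (w + 1) where
  ι : Type w
  [fintype : Fintype ι]
  [decEq : DecidableEq ι]
  color : ι → Option Bool

namespace FibObj

attribute [instance] FibObj.fintype FibObj.decEq

variable {k : Type w} [Field k] {u : k}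

/-- A matrix entry between an index labelled `x` and an index labelled `y` may be non-zero. -/
def Live (x y : Option Bool) : Prop := x = y ∧ x ≠ none

instance (x y : Option Bool) : Decidable (Live x y) := by unfold Live; infer_instance

/-- The matrices whose entries vanish off the pairs of equal labels other than `none`. -/
def homs (S T : FibObj k u) : Submodule k (S.ι → T.ι → k) where
  carrier := {f | ∀ s t, ¬ Live (S.color s) (T.color t) → f s t = 0}
  add_mem' hf hg s t h := by simp [hf s t h, hg s t h]
  zero_mem' s t h := rfl
  smul_mem' c f hf s t h := by simp [hf s t h]

/-- The matrix `f`, with the entries that are not allowed replaced by `0`. -/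
def mat {S T : FibObj k u} (f : S.ι → T.ι → k) : homs S T :=
  ⟨fun s t => if Live (S.color s) (T.color t) then f s t else 0, fun s t h => by simp [h]⟩

instance : Category (FibObj k u) where
  Hom S T := homs S T
  id S := mat fun s t => if s = t then 1 else 0
  comp {S T R} f g := ⟨fun s r => ∑ t, f.1 s t * g.1 t r, fun s r h => by
    refine Finset.sum_eq_zero fun t _ => ?_
    by_cases h1 : Live (S.color s) (T.color t)
    · have h2 : ¬ Live (T.color t) (R.color r) := fun h2 => h ⟨h1.1.trans h2.1, h1.2⟩
      rw [g.2 t r h2, mul_zero]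
    · rw [f.2 s t h1, zero_mul]⟩
  id_comp {S T} f := by
    refine Subtype.ext (funext fun s => funext fun t => ?_)
    by_cases h : Live (S.color s) (S.color s)
    · simp only [mat]
      rw [Finset.sum_eq_single s] <;> aesop
    · have : ∀ t, f.1 s t = 0 := fun t => f.2 s t fun h' => h ⟨rfl, h'.2⟩
      rw [this]
      refine Finset.sum_eq_zero fun s' _ => ?_
      simp only [mat]
      by_cases hs : s = s'
      · subst hs; simp [h]
      · simp [hs]
  comp_id {S T} f := by
    refine Subtype.ext (funext fun s => funext fun t => ?_)
    by_cases h : Live (T.color t) (T.color t)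
    · simp only [mat]
      rw [Finset.sum_eq_single t] <;> aesop
    · have : ∀ s, f.1 s t = 0 := fun s => f.2 s t fun h' => h ⟨rfl, h'.1 ▸ h'.2⟩
      rw [this]
      refine Finset.sum_eq_zero fun s' _ => ?_
      by_cases hs : s' = t
      · subst hs; rw [this, zero_mul]
      · simp [mat, hs]
  assoc f g h := by
    refine Subtype.ext (funext fun s => funext fun t => ?_)
    simp only [Finset.sum_mul, Finset.mul_sum, mul_assoc]
    exact Finset.sum_comm

/-- The morphism with matrix `f`; entries that are not allowed are replaced by `0`. -/
def hom {S T : FibObj k u} (f : S.ι → T.ι → k) : S ⟶ T := mat f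

/-- The matrix entries of a morphism. -/
def ent {S T : FibObj k u} (f : S ⟶ T) : S.ι → T.ι → k := f.1

theorem ent_eq_zero {S T : FibObj k u} (f : S ⟶ T) {s : S.ι} {t : T.ι}
    (h : ¬ Live (S.color s) (T.color t)) : ent f s t = 0 := f.2 s t h

@[ext]
theorem hom_ext {S T : FibObj k u} {f g : S ⟶ T} (h : ∀ s t, ent f s t = ent g s t) : f = g :=
  Subtype.ext (funext fun s => funext fun t => h s t)

theorem hom_ext_live {S T : FibObj k u} {f g : S ⟶ T}
    (h : ∀ s t, Live (S.color s) (T.color t) → ent f s t = ent g s t) : f = g :=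
  hom_ext fun s t => by
    by_cases hl : Live (S.color s) (T.color t)
    · exact h s t hl
    · rw [ent_eq_zero f hl, ent_eq_zero g hl]

@[simp] theorem ent_hom {S T : FibObj k u} (f : S.ι → T.ι → k) (s : S.ι) (t : T.ι) :
    ent (hom f) s t = if Live (S.color s) (T.color t) then f s t else 0 := rfl

@[simp] theorem ent_id (S : FibObj k u) (s t : S.ι) :
    ent (𝟙 S) s t = if Live (S.color s) (S.color t) then if s = t then 1 else 0 else 0 := rfl

@[simp] theorem ent_comp {S T R : FibObj k u} (f : S ⟶ T) (g : T ⟶ R) (s : S.ι) (r : R.ι) :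
    ent (f ≫ g) s r = ∑ t, ent f s t * ent g t r := rfl

instance : Preadditive (FibObj k u) where
  homGroup S T := inferInstanceAs (AddCommGroup (homs S T))
  add_comp S T R f f' g := hom_ext fun s r => by
    change ∑ t, (f.1 s t + f'.1 s t) * g.1 t r = ∑ t, f.1 s t * g.1 t r + ∑ t, f'.1 s t * g.1 t r
    simp [add_mul, Finset.sum_add_distrib]
  comp_add S T R f g g' := hom_ext fun s r => by
    change ∑ t, f.1 s t * (g.1 t r + g'.1 t r) = ∑ t, f.1 s t * g.1 t r + ∑ t, f.1 s t * g'.1 t r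
    simp [mul_add, Finset.sum_add_distrib]

instance : Linear k (FibObj k u) where
  homModule S T := inferInstanceAs (Module k (homs S T))
  smul_comp S T R c f g := hom_ext fun s r => by
    change ∑ t, (c * f.1 s t) * g.1 t r = c * ∑ t, f.1 s t * g.1 t r
    simp [mul_assoc, Finset.mul_sum]
  comp_smul S T R f c g := hom_ext fun s r => by
    change ∑ t, f.1 s t * (c * g.1 t r) = c * ∑ t, f.1 s t * g.1 t r
    simp [mul_left_comm, Finset.mul_sum]

@[simp] theorem ent_add {S T : FibObj k u} (f g : S ⟶ T) (s : S.ι) (t : T.ι) :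
    ent (f + g) s t = ent f s t + ent g s t := rfl

@[simp] theorem ent_smul {S T : FibObj k u} (c : k) (f : S ⟶ T) (s : S.ι) (t : T.ι) :
    ent (c • f) s t = c * ent f s t := rfl

@[simp] theorem ent_zero {S T : FibObj k u} (s : S.ι) (t : T.ι) :
    ent (0 : S ⟶ T) s t = 0 := rfl

@[simp] theorem ent_sum {S T : FibObj k u} {J : Type*} (A : Finset J) (f : J → (S ⟶ T)) (s : S.ι)
    (t : T.ι) : ent (∑ j ∈ A, f j) s t = ∑ j ∈ A, ent (f j) s t := by
  classical
  induction A using Finset.induction_on with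
  | empty => simp
  | insert a A ha ih => simp [Finset.sum_insert ha, ih]

end FibObj

/-! ### The matrices of the tensor product and of its constraints -/

namespace FibObj

variable {k : Type w} [Field k] {u : k}

/-- The action of a matrix on column vectors. It reverses the direction of the morphism, and it
turns identities between composites of sparse matrices into identities between short sums. -/
def act {S T : FibObj k u} (f : S ⟶ T) (v : T.ι → k) (s : S.ι) : k := ∑ t, ent f s t * v t

theorem act_comp {S T R : FibObj k u} (f : S ⟶ T) (g : T ⟶ R) (v : R.ι → k) (s : S.ι) :
    act (f ≫ g) v s = act f (act g v) s := by
  simp only [act, ent_comp, Finset.sum_mul, Finset.mul_sum, mul_assoc]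
  exact Finset.sum_comm

theorem act_id (S : FibObj k u) (v : S.ι → k) (s : S.ι) :
    act (𝟙 S) v s = if S.color s = none then 0 else v s := by
  rw [act, Finset.sum_eq_single s]
  · simp [Live]
  all_goals first | simp; done | (intro b _ hb; simp [hb.symm])

theorem ent_eq_act {S T : FibObj k u} (f : S ⟶ T) (s : S.ι) (t : T.ι) :
    ent f s t = act f (Pi.single t 1) s := by
  simp [act, Pi.single_apply]

theorem act_of_dead {S T : FibObj k u} (f : S ⟶ T) (v : T.ι → k) {s : S.ι}
    (h : S.color s = none) : act f v s = 0 :=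
  Finset.sum_eq_zero fun t _ => by rw [ent_eq_zero f fun h' => h'.2 h, zero_mul]

theorem hom_ext_act {S T : FibObj k u} {f g : S ⟶ T}
    (h : ∀ (v : T.ι → k) (s : S.ι), S.color s ≠ none → act f v s = act g v s) : f = g := by
  refine hom_ext_live fun s t hl => ?_
  rw [ent_eq_act, ent_eq_act, h _ _ hl.2]

theorem act_congr {S T : FibObj k u} (f : S ⟶ T) {v v' : T.ι → k} {s : S.ι}
    (h : ∀ t, T.color t = S.color s → S.color s ≠ none → v t = v' t) : act f v s = act f v' s := by
  refine Finset.sum_congr rfl fun t _ => ?_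
  by_cases hl : Live (S.color s) (T.color t)
  · rw [h t hl.1.symm hl.2]
  · rw [ent_eq_zero f hl, zero_mul, zero_mul]

theorem act_add {S T : FibObj k u} (f : S ⟶ T) (v v' : T.ι → k) (s : S.ι) :
    act f (fun t => v t + v' t) s = act f v s + act f v' s := by
  simp [act, mul_add, Finset.sum_add_distrib]

theorem act_mul {S T : FibObj k u} (f : S ⟶ T) (c : k) (v : T.ι → k) (s : S.ι) :
    act f (fun t => c * v t) s = c * act f v s := by
  simp [act, mul_left_comm, Finset.mul_sum]

theorem act_zero {S T : FibObj k u} (f : S ⟶ T) (s : S.ι) :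
    act f (fun _ => 0) s = 0 := by
  simp [act]

theorem act_ite {S T : FibObj k u} (f : S ⟶ T) (p : Prop) [Decidable p] (v : T.ι → k) (s : S.ι) :
    act f (fun t => if p then 0 else v t) s = if p then 0 else act f v s := by
  split_ifs
  · exact act_zero f s
  · rfl

/-- Actions of matrices on different indices commute. -/
theorem act_act_comm {S T S' T' : FibObj k u} (f : S ⟶ T) (g : S' ⟶ T') (v : T.ι → T'.ι → k)
    (s : S.ι) (s' : S'.ι) :
    act f (fun t => act g (v t) s') s = act g (fun t' => act f (fun t => v t t') s) s' := by
  simp only [act, Finset.mul_sum]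
  rw [Finset.sum_comm]
  simp only [mul_left_comm]

/-- The associativity matrix on `Hom(X ⊗ X ⊗ X, X)`: the coefficient of the left tree with inner
label `e` in the right tree with inner label `f`. -/
def sixjCore (a : k) : Bool → Bool → k
  | true, true => a
  | false, true => 1
  | _, false => -a

/-- The coefficient of the left tree `(x ⊗ y → e) ⊗ z → d` in the right tree `x ⊗ (y ⊗ z → f) → d`.
Unless all four outer labels are `X`, the two trees are unique and the coefficient is `1`. -/
def sixj (a : k) (x y z : Option Bool) (d e f : Bool) : k :=
  if x = some true ∧ y = some true ∧ z = some true ∧ d = true then sixjCore a e f else 1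

/-- The scalar by which the braiding acts on the summand `c` of `x ⊗ y`. -/
def braid (u : k) (x y : Option Bool) (c : Bool) : k :=
  if x = some true ∧ y = some true then if c = true then u else u ^ 2 else 1

/-- The tensor product of objects: one index for each pair of indices and each label `c`, with
colour `none` if `c` does not occur in the product of the two labels. -/
def tensorObj (S T : FibObj k u) : FibObj k u where
  ι := S.ι × T.ι × Bool
  color x := fuse (S.color x.1) (T.color x.2.1) x.2.2

/-- The unit object, a single index with the label of the unit. -/
def unitObj : FibObj k u where
  ι := PUnit
  color _ := some false

/-- The index of the summand labelled `c` in the tensor product of the summands `s` and `t`. -/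
def pt {S T : FibObj k u} (s : S.ι) (t : T.ι) (c : Bool) : (tensorObj S T).ι := (s, t, c)

/-- The only index of the unit object. -/
def star : (unitObj : FibObj k u).ι := PUnit.unit

@[simp] theorem color_pt {S T : FibObj k u} (s : S.ι) (t : T.ι) (c : Bool) :
    (tensorObj S T).color (pt s t c) = fuse (S.color s) (T.color t) c := rfl

@[simp] theorem color_star : (unitObj : FibObj k u).color star = some false := rfl

theorem exists_pt {S T : FibObj k u} (x : (tensorObj S T).ι) : ∃ s t c, x = pt s t c :=
  ⟨x.1, x.2.1, x.2.2, rfl⟩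

theorem sum_tensorObj {S T : FibObj k u} (g : (tensorObj S T).ι → k) :
    ∑ x, g x = ∑ s, ∑ t, ∑ c, g (pt s t c) := by
  have h : ∀ g' : S.ι × T.ι × Bool → k, ∑ x, g' x = ∑ s, ∑ t, ∑ c, g' (s, t, c) := fun g' => by
    simp only [Fintype.sum_prod_type]
  exact h g

theorem sum_unitObj (g : (unitObj : FibObj k u).ι → k) : ∑ x, g x = g star := by
  exact Fintype.sum_unique (ι := PUnit) g

/-- The tensor product of matrices. -/
def tensorMap {S S' T T' : FibObj k u} (f : S ⟶ S') (g : T ⟶ T') :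
    tensorObj S T ⟶ tensorObj S' T' :=
  hom fun x y => ent f x.1 y.1 * ent g x.2.1 y.2.1

/-- The associator, with matrix `sixj`; the parameter `a = u + u⁻¹` is written as `u - u ^ 4`, which
is the same modulo the tenth cyclotomic polynomial and needs no inverse. -/
def assocHom (S T R : FibObj k u) :
    tensorObj (tensorObj S T) R ⟶ tensorObj S (tensorObj T R) :=
  hom fun x y => if x.1.1 = y.1 ∧ x.1.2.1 = y.2.1.1 ∧ x.2.1 = y.2.1.2.1 then
    sixj (u - u ^ 4) (S.color x.1.1) (T.color x.1.2.1) (R.color x.2.1) x.2.2 x.1.2.2 y.2.1.2.2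
    else 0

/-- The inverse of the associator: the matrix `sixj` is an involution. -/
def assocInv (S T R : FibObj k u) :
    tensorObj S (tensorObj T R) ⟶ tensorObj (tensorObj S T) R :=
  hom fun y x => if x.1.1 = y.1 ∧ x.1.2.1 = y.2.1.1 ∧ x.2.1 = y.2.1.2.1 then
    sixj (u - u ^ 4) (S.color y.1) (T.color y.2.1.1) (R.color y.2.1.2.1) y.2.2 y.2.1.2.2 x.1.2.2
    else 0

/-- The braiding, with matrix `braid`. -/
def braidHom (S T : FibObj k u) : tensorObj S T ⟶ tensorObj T S :=
  hom fun x y => if x.1 = y.2.1 ∧ x.2.1 = y.1 then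
    braid u (S.color x.1) (T.color x.2.1) x.2.2 else 0

/-- The inverse of the braiding. -/
def braidInv (S T : FibObj k u) : tensorObj T S ⟶ tensorObj S T :=
  hom fun x y => if x.1 = y.2.1 ∧ x.2.1 = y.1 then
    (braid u (T.color x.1) (S.color x.2.1) x.2.2)⁻¹ else 0

/-- The left unit constraint. -/
def leftUnitorHom (S : FibObj k u) : tensorObj unitObj S ⟶ S :=
  hom fun x y => if x.2.1 = y then 1 else 0

/-- The inverse of the left unit constraint. -/
def leftUnitorInv (S : FibObj k u) : S ⟶ tensorObj unitObj S :=
  hom fun y x => if x.2.1 = y then 1 else 0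

/-- The right unit constraint. -/
def rightUnitorHom (S : FibObj k u) : tensorObj S unitObj ⟶ S :=
  hom fun x y => if x.1 = y then 1 else 0

/-- The inverse of the right unit constraint. -/
def rightUnitorInv (S : FibObj k u) : S ⟶ tensorObj S unitObj :=
  hom fun y x => if x.1 = y then 1 else 0

theorem ent_tensorMap {S S' T T' : FibObj k u} (f : S ⟶ S') (g : T ⟶ T') (s : S.ι) (t : T.ι)
    (c : Bool) (s' : S'.ι) (t' : T'.ι) (c' : Bool) :
    ent (tensorMap f g) (pt s t c) (pt s' t' c') =
      if Live (fuse (S.color s) (T.color t) c) (fuse (S'.color s') (T'.color t') c') then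
        ent f s s' * ent g t t' else 0 := rfl

theorem ent_assocHom (S T R : FibObj k u) (s s' : S.ι) (t t' : T.ι) (r r' : R.ι)
    (e d f d' : Bool) :
    ent (assocHom S T R) (pt (pt s t e) r d) (pt s' (pt t' r' f) d') =
      if Live (fuse (fuse (S.color s) (T.color t) e) (R.color r) d)
        (fuse (S.color s') (fuse (T.color t') (R.color r') f) d') then
        if s = s' ∧ t = t' ∧ r = r' then
          sixj (u - u ^ 4) (S.color s) (T.color t) (R.color r) d e f else 0 else 0 := rfl

theorem ent_assocInv (S T R : FibObj k u) (s s' : S.ι) (t t' : T.ι) (r r' : R.ι)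
    (e d f d' : Bool) :
    ent (assocInv S T R) (pt s' (pt t' r' f) d') (pt (pt s t e) r d) =
      if Live (fuse (S.color s') (fuse (T.color t') (R.color r') f) d')
        (fuse (fuse (S.color s) (T.color t) e) (R.color r) d) then
        if s = s' ∧ t = t' ∧ r = r' then
          sixj (u - u ^ 4) (S.color s') (T.color t') (R.color r') d' f e else 0 else 0 := rfl

theorem ent_braidHom (S T : FibObj k u) (s s' : S.ι) (t t' : T.ι) (c c' : Bool) :
    ent (braidHom S T) (pt s t c) (pt t' s' c') =
      if Live (fuse (S.color s) (T.color t) c) (fuse (T.color t') (S.color s') c') then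
        if s = s' ∧ t = t' then braid u (S.color s) (T.color t) c else 0 else 0 := rfl

theorem ent_braidInv (S T : FibObj k u) (s s' : S.ι) (t t' : T.ι) (c c' : Bool) :
    ent (braidInv S T) (pt t s c) (pt s' t' c') =
      if Live (fuse (T.color t) (S.color s) c) (fuse (S.color s') (T.color t') c') then
        if t = t' ∧ s = s' then (braid u (T.color t) (S.color s) c)⁻¹ else 0 else 0 := rfl

theorem fuse_live {x y : Option Bool} {c : Bool} (h : fuse x y c ≠ none) : fuse x y c = some c := by
  revert x y c; decide

theorem live_fuse_iff {x y x' y' : Option Bool} {c c' : Bool} :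
    Live (fuse x y c) (fuse x' y' c') ↔
      c = c' ∧ fuse x y c ≠ none ∧ fuse x' y' c' ≠ none := by
  revert x y x' y' c c'; unfold Live; decide

theorem act_tensorMap {S S' T T' : FibObj k u} (f : S ⟶ S') (g : T ⟶ T')
    (v : (tensorObj S' T').ι → k) (s : S.ι) (t : T.ι) (c : Bool) :
    act (tensorMap f g) v (pt s t c) = if fuse (S.color s) (T.color t) c = none then 0 else
      act f (fun s' => act g (fun t' => v (pt s' t' c)) t) s := by
  split_ifs with h
  · exact act_of_dead _ _ h
  · simp only [act, ent_tensorMap, sum_tensorObj,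
      live_fuse_iff, Finset.mul_sum]
    refine Finset.sum_congr rfl fun s' _ => Finset.sum_congr rfl fun t' _ => ?_
    by_cases h1 : Live (S.color s) (S'.color s')
    · by_cases h2 : Live (T.color t) (T'.color t')
      · rw [← h1.1, ← h2.1]
        rw [Finset.sum_eq_single c]
        · simp [h, mul_assoc]
        · intro b _ hb
          simp [hb.symm]
        · simp
      · simp [ent_eq_zero g h2]
    · simp [ent_eq_zero f h1]

theorem act_assocHom (S T R : FibObj k u) (v : (tensorObj S (tensorObj T R)).ι → k) (s : S.ι)
    (t : T.ι) (r : R.ι) (e d : Bool) :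
    act (assocHom S T R) v (pt (pt s t e) r d) =
      if fuse (fuse (S.color s) (T.color t) e) (R.color r) d = none then 0 else
      ∑ f, if fuse (S.color s) (fuse (T.color t) (R.color r) f) d = none then 0 else
        sixj (u - u ^ 4) (S.color s) (T.color t) (R.color r) d e f * v (pt s (pt t r f) d) := by
  split_ifs with h
  · exact act_of_dead _ _ h
  · simp only [act, ent_assocHom, sum_tensorObj,
      live_fuse_iff]
    rw [Finset.sum_eq_single s, Finset.sum_eq_single t, Finset.sum_eq_single r]
    · refine Finset.sum_congr rfl fun f _ => ?_
      rw [Finset.sum_eq_single d]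
      · simp [h]
      · intro b _ hb
        simp [hb.symm]
      · simp
    all_goals first | simp; done | (intro b _ hb; simp [hb.symm])

theorem act_assocInv (S T R : FibObj k u) (v : (tensorObj (tensorObj S T) R).ι → k) (s : S.ι)
    (t : T.ι) (r : R.ι) (f d : Bool) :
    act (assocInv S T R) v (pt s (pt t r f) d) =
      if fuse (S.color s) (fuse (T.color t) (R.color r) f) d = none then 0 else
      ∑ e, if fuse (fuse (S.color s) (T.color t) e) (R.color r) d = none then 0 else
        sixj (u - u ^ 4) (S.color s) (T.color t) (R.color r) d f e * v (pt (pt s t e) r d) := by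
  split_ifs with h
  · exact act_of_dead _ _ h
  · simp only [act, ent_assocInv, sum_tensorObj,
      live_fuse_iff]
    rw [Finset.sum_eq_single s, Finset.sum_eq_single t]
    · refine Finset.sum_congr rfl fun f _ => ?_
      rw [Finset.sum_eq_single r, Finset.sum_eq_single d]
      · simp [h]
      all_goals first | simp; done | (intro b _ hb; simp [hb, hb.symm])
    all_goals first | simp; done | (intro b _ hb; simp [hb])

theorem act_braidHom (S T : FibObj k u) (v : (tensorObj T S).ι → k) (s : S.ι) (t : T.ι)
    (c : Bool) : act (braidHom S T) v (pt s t c) =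
      if fuse (S.color s) (T.color t) c = none then 0 else
        braid u (S.color s) (T.color t) c * v (pt t s c) := by
  have hc : fuse (T.color t) (S.color s) c = fuse (S.color s) (T.color t) c := by
    generalize T.color t = x, S.color s = y; revert x y c; decide
  split_ifs with h
  · exact act_of_dead _ _ h
  · simp only [act, ent_braidHom, sum_tensorObj,
      live_fuse_iff]
    rw [Finset.sum_eq_single t, Finset.sum_eq_single s, Finset.sum_eq_single c]
    · simp [h, hc]
    all_goals first | simp; done | (intro b _ hb; simp [hb.symm])

theorem act_braidInv (S T : FibObj k u) (v : (tensorObj S T).ι → k) (s : S.ι) (t : T.ι)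
    (c : Bool) : act (braidInv S T) v (pt t s c) =
      if fuse (T.color t) (S.color s) c = none then 0 else
        (braid u (T.color t) (S.color s) c)⁻¹ * v (pt s t c) := by
  have hc : fuse (T.color t) (S.color s) c = fuse (S.color s) (T.color t) c := by
    generalize T.color t = x, S.color s = y; revert x y c; decide
  split_ifs with h
  · exact act_of_dead _ _ h
  · simp only [act, ent_braidInv, sum_tensorObj,
      live_fuse_iff]
    rw [Finset.sum_eq_single s, Finset.sum_eq_single t, Finset.sum_eq_single c]
    · rw [hc] at h ⊢
      simp [h]
    all_goals first | simp; done | (intro b _ hb; simp [hb.symm])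

theorem act_leftUnitorHom (S : FibObj k u) (v : S.ι → k) (s : S.ι) (c : Bool) :
    act (leftUnitorHom S) v (pt star s c) = if S.color s = some c then v s else 0 := by
  have key : ∀ t, ent (leftUnitorHom S) (pt star s c) t =
      if Live (fuse (some false) (S.color s) c) (S.color t) then if s = t then 1 else 0 else 0 :=
    fun _ => rfl
  simp only [act, key]
  rw [Finset.sum_eq_single s]
  · have : Live (fuse (some false) (S.color s) c) (S.color s) ↔ S.color s = some c := by
      clear key; generalize S.color s = x; revert x c; unfold Live; decide
    simp [this]
  all_goals first | simp; done | (intro b _ hb; simp [hb.symm])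

theorem act_rightUnitorHom (S : FibObj k u) (v : S.ι → k) (s : S.ι) (c : Bool) :
    act (rightUnitorHom S) v (pt s star c) = if S.color s = some c then v s else 0 := by
  have key : ∀ t, ent (rightUnitorHom S) (pt s star c) t =
      if Live (fuse (S.color s) (some false) c) (S.color t) then if s = t then 1 else 0 else 0 :=
    fun _ => rfl
  simp only [act, key]
  rw [Finset.sum_eq_single s]
  · have : Live (fuse (S.color s) (some false) c) (S.color s) ↔ S.color s = some c := by
      clear key; generalize S.color s = x; revert x c; unfold Live; decide
    simp [this]
  all_goals first | simp; done | (intro b _ hb; simp [hb.symm])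

theorem act_leftUnitorInv (S : FibObj k u) (v : (tensorObj unitObj S).ι → k) (s : S.ι) :
    act (leftUnitorInv S) v s = ∑ c, if S.color s = some c then v (pt star s c) else 0 := by
  have key : ∀ t c, ent (leftUnitorInv S) s (pt star t c) =
      if Live (S.color s) (fuse (some false) (S.color t) c) then if t = s then 1 else 0 else 0 :=
    fun _ _ => rfl
  simp only [act, sum_tensorObj, sum_unitObj, key]
  rw [Finset.sum_eq_single s]
  · refine Finset.sum_congr rfl fun c _ => ?_
    have : Live (S.color s) (fuse (some false) (S.color s) c) ↔ S.color s = some c := by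
      clear key; generalize S.color s = x; revert x c; unfold Live; decide
    simp [this]
  all_goals first | simp; done | (intro b _ hb; simp [hb])

theorem act_rightUnitorInv (S : FibObj k u) (v : (tensorObj S unitObj).ι → k) (s : S.ι) :
    act (rightUnitorInv S) v s = ∑ c, if S.color s = some c then v (pt s star c) else 0 := by
  have key : ∀ t c, ent (rightUnitorInv S) s (pt t star c) =
      if Live (S.color s) (fuse (S.color t) (some false) c) then if t = s then 1 else 0 else 0 :=
    fun _ _ => rfl
  simp only [act, sum_tensorObj, sum_unitObj, key]
  rw [Finset.sum_eq_single s]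
  · refine Finset.sum_congr rfl fun c _ => ?_
    have : Live (S.color s) (fuse (S.color s) (some false) c) ↔ S.color s = some c := by
      clear key; generalize S.color s = x; revert x c; unfold Live; decide
    simp [this]
  all_goals first | simp; done | (intro b _ hb; simp [hb])

end FibObj

/-! ### The coherence equations for the scalars -/

namespace FibObj

variable {k : Type w} [Field k] {u : k}

theorem tensorMap_id (S T : FibObj k u) : tensorMap (𝟙 S) (𝟙 T) = 𝟙 (tensorObj S T) := by
  refine hom_ext_act ?_
  intro v x h
  obtain ⟨s, t, c, rfl⟩ := exists_pt x
  simp only [act_tensorMap, act_id]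
  simp only [color_pt] at h ⊢
  have h1 : S.color s ≠ none := fun h' => h (by rw [h']; rfl)
  have h2 : T.color t ≠ none := fun h' => h (by rw [h']; cases S.color s <;> rfl)
  simp [h, h1, h2]

theorem tensorMap_comp {S S' S'' T T' T'' : FibObj k u} (f : S ⟶ S') (g : T ⟶ T') (f' : S' ⟶ S'')
    (g' : T' ⟶ T'') : tensorMap f g ≫ tensorMap f' g' = tensorMap (f ≫ f') (g ≫ g') := by
  refine hom_ext_act ?_
  intro v x h
  obtain ⟨s, t, c, rfl⟩ := exists_pt x
  simp only [color_pt] at h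
  simp only [act_tensorMap, act_comp, if_neg h]
  refine act_congr _ fun s' hs' _ => ?_
  rw [act_act_comm]
  refine act_congr _ fun t' ht' _ => ?_
  rw [hs', ht', if_neg h]

theorem assoc_naturality {S S' T T' R R' : FibObj k u} (f : S ⟶ S') (g : T ⟶ T') (h : R ⟶ R') :
    tensorMap (tensorMap f g) h ≫ assocHom S' T' R' =
      assocHom S T R ≫ tensorMap f (tensorMap g h) := by
  refine hom_ext_act ?_
  intro v x hl
  obtain ⟨y, r, d, rfl⟩ := exists_pt x
  obtain ⟨s, t, e, rfl⟩ := exists_pt y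
  simp only [color_pt] at hl
  have hl' : fuse (S.color s) (T.color t) e ≠ none := fun h' => hl (by rw [h']; rfl)
  simp only [act_tensorMap, act_assocHom, act_comp, color_pt, if_neg hl, if_neg hl']
  trans act f (fun s' => act g (fun t' => act h (fun r' =>
    ∑ x : Bool, if fuse (S.color s) (fuse (T.color t) (R.color r) x) d = none then 0 else
        sixj (u - u ^ 4) (S.color s) (T.color t) (R.color r) d e x * v (pt s' (pt t' r' x) d)) r) t) s
  · refine act_congr f fun s' hs' _ => act_congr g fun t' ht' _ => act_congr h fun r' hr' _ => ?_
    rw [hs', ht', hr', if_neg hl]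
  · have key : ∀ x, ¬ fuse (S.color s) (fuse (T.color t) (R.color r) x) d = none →
        ¬ fuse (T.color t) (R.color r) x = none := fun x h h' => h (by
      rw [h']; cases S.color s <;> rfl)
    simp only [Fintype.sum_bool, act_add, act_ite, act_mul]
    congr 1 <;> split_ifs with h1 h2 <;> first | rfl | exact absurd h2 (key _ h1)

theorem fuse_none_left (x : Option Bool) (c : Bool) : fuse none x c = none := rfl
theorem fuse_none_right (x : Option Bool) (c : Bool) : fuse x none c = none := by cases x <;> rfl
theorem fuse_fff : fuse (some false) (some false) false = some false := rfl
theorem fuse_fft : fuse (some false) (some false) true = none := rfl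
theorem fuse_ftf : fuse (some false) (some true) false = none := rfl
theorem fuse_ftt : fuse (some false) (some true) true = some true := rfl
theorem fuse_tff : fuse (some true) (some false) false = none := rfl
theorem fuse_tft : fuse (some true) (some false) true = some true := rfl
theorem fuse_tt (c : Bool) : fuse (some true) (some true) c = some c := by cases c <;> rfl

theorem sixj_unit_left (a : k) (y z : Option Bool) (d e f : Bool) :
    sixj a (some false) y z d e f = 1 := by simp [sixj]
theorem sixj_unit_middle (a : k) (x z : Option Bool) (d e f : Bool) :
    sixj a x (some false) z d e f = 1 := by simp [sixj]
theorem sixj_unit_right (a : k) (x y : Option Bool) (d e f : Bool) :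
    sixj a x y (some false) d e f = 1 := by simp [sixj]
theorem sixj_unit_total (a : k) (x y z : Option Bool) (e f : Bool) :
    sixj a x y z false e f = 1 := by simp [sixj]
theorem sixj_true (a : k) (e f : Bool) :
    sixj a (some true) (some true) (some true) true e f = sixjCore a e f := by simp [sixj]

/-- The associativity matrix is an involution. -/
theorem sixj_orthogonality {a : k} (ha : a ^ 2 = a + 1) (x y z : Option Bool)
    (d e : Bool) (w : Bool → k) (h : fuse (fuse x y e) z d ≠ none) :
    (∑ f, if fuse x (fuse y z f) d = none then 0 else sixj a x y z d e f *
      ∑ e', if fuse (fuse x y e') z d = none then 0 else sixj a x y z d f e' * w e') = w e := by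
  revert h
  rcases x with _ | _ | _ <;> rcases y with _ | _ | _ <;> rcases z with _ | _ | _ <;>
    rcases d with _ | _ <;> rcases e with _ | _ <;> simp [fuse, sixj, sixjCore]
  · linear_combination w false * ha
  · linear_combination w true * ha

theorem sixj_orthogonality' {a : k} (ha : a ^ 2 = a + 1) (x y z : Option Bool)
    (d f : Bool) (w : Bool → k) (h : fuse x (fuse y z f) d ≠ none) :
    (∑ e, if fuse (fuse x y e) z d = none then 0 else sixj a x y z d f e *
      ∑ f', if fuse x (fuse y z f') d = none then 0 else sixj a x y z d e f' * w f') = w f := by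
  revert h
  rcases x with _ | _ | _ <;> rcases y with _ | _ | _ <;> rcases z with _ | _ | _ <;>
    rcases d with _ | _ <;> rcases f with _ | _ <;> simp [fuse, sixj, sixjCore]
  · linear_combination w false * ha
  · linear_combination w true * ha

theorem assocHom_assocInv (ha : (u - u ^ 4) ^ 2 = (u - u ^ 4) + 1) (S T R : FibObj k u) :
    assocHom S T R ≫ assocInv S T R = 𝟙 _ := by
  refine hom_ext_act ?_
  intro v x hl
  obtain ⟨y, r, d, rfl⟩ := exists_pt x
  obtain ⟨s, t, e, rfl⟩ := exists_pt y
  simp only [color_pt] at hl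
  rw [act_comp, act_assocHom, act_id, if_neg hl, color_pt, color_pt, if_neg hl,
    ← sixj_orthogonality ha _ _ _ _ _ (fun e => v (pt (pt s t e) r d)) hl]
  refine Finset.sum_congr rfl fun f _ => ?_
  rw [act_assocInv]
  split_ifs <;> rfl

theorem assocInv_assocHom (ha : (u - u ^ 4) ^ 2 = (u - u ^ 4) + 1) (S T R : FibObj k u) :
    assocInv S T R ≫ assocHom S T R = 𝟙 _ := by
  refine hom_ext_act ?_
  intro v x hl
  obtain ⟨s, y, d, rfl⟩ := exists_pt x
  obtain ⟨t, r, f, rfl⟩ := exists_pt y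
  simp only [color_pt] at hl
  rw [act_comp, act_assocInv, act_id, if_neg hl, color_pt, color_pt, if_neg hl,
    ← sixj_orthogonality' ha _ _ _ _ _ (fun f => v (pt s (pt t r f) d)) hl]
  refine Finset.sum_congr rfl fun f _ => ?_
  rw [act_assocHom]
  split_ifs <;> rfl

/-- The pentagon equation on the left tree with outer labels `x`, `y`, `z`, `q`, `b` and inner
labels `e`, `d`, paired with arbitrary coefficients `w` of the right trees. -/
theorem pentagon_scalar {a : k} (ha : a ^ 2 = a + 1) (x y z q : Option Bool)
    (e d b : Bool) (w : Bool → Bool → k) (h : fuse (fuse (fuse x y e) z d) q b ≠ none) :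
    (∑ f, if fuse x (fuse y z f) d = none then 0 else sixj a x y z d e f *
      if fuse (fuse x (fuse y z f) d) q b = none then 0 else
      ∑ g, if fuse x (fuse (fuse y z f) q g) b = none then 0 else
        sixj a x (fuse y z f) q b d g * if fuse x (fuse (fuse y z f) q g) b = none then 0 else
          if fuse (fuse y z f) q g = none then 0 else
          ∑ g', if fuse y (fuse z q g') g = none then 0 else sixj a y z q g f g' * w g' g) =
      ∑ g', if fuse (fuse x y e) (fuse z q g') b = none then 0 else
        sixj a (fuse x y e) z q b d g' * if fuse (fuse x y e) (fuse z q g') b = none then 0 else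
          ∑ g, if fuse x (fuse y (fuse z q g') g) b = none then 0 else
            sixj a x y (fuse z q g') b e g * w g' g := by
  revert h
  rcases x with _ | _ | _ <;> rcases y with _ | _ | _ <;> rcases z with _ | _ | _ <;>
    rcases q with _ | _ | _ <;>
    rcases d with _ | _ <;> rcases e with _ | _ <;> rcases b with _ | _ <;>
    simp only [fuse_none_left, fuse_none_right, fuse_fff, fuse_fft, fuse_ftf, fuse_ftt, fuse_tff,
      fuse_tft, fuse_tt, sixj_unit_left, sixj_unit_middle, sixj_unit_right, sixj_unit_total,
      sixj_true, sixjCore, Fintype.sum_bool, reduceIte, reduceCtorEq, mul_zero, one_mul,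
      add_zero, zero_add, ne_eq, not_true_eq_false, not_false_eq_true, forall_true_left,
      false_imp_iff]
  · ring
  · linear_combination w false true * ha
  · linear_combination w true true * ha
  · linear_combination w true true * ha
  · linear_combination a * (w true true - w false true) * ha

/-- The scalar `u - u ^ 4`, which is `u + u⁻¹`, satisfies the equation of the golden ratio. -/
theorem golden (hu : u ^ 4 - u ^ 3 + u ^ 2 - u + 1 = 0) :
    (u - u ^ 4) ^ 2 = (u - u ^ 4) + 1 := by
  linear_combination (u ^ 4 + u ^ 3 - 2 * u - 1) * hu

theorem braid_unit_left (u : k) (y : Option Bool) (c : Bool) : braid u (some false) y c = 1 := by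
  simp [braid]
theorem braid_unit_right (u : k) (y : Option Bool) (c : Bool) : braid u y (some false) c = 1 := by
  simp [braid]
theorem braid_tt (u : k) : braid u (some true) (some true) true = u := by simp [braid]
theorem braid_tf (u : k) : braid u (some true) (some true) false = u ^ 2 := by simp [braid]

/-- The hexagon equation on the left tree with outer labels `x`, `y`, `z`, `d` and inner label `e`,
paired with arbitrary coefficients `w` of the right trees. -/
theorem hexagon_scalar (hu : u ^ 4 - u ^ 3 + u ^ 2 - u + 1 = 0) (x y z : Option Bool)
    (e d : Bool) (w : Bool → k) (h : fuse (fuse x y e) z d ≠ none) :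
    (∑ f, if fuse x (fuse y z f) d = none then 0 else sixj (u - u ^ 4) x y z d e f *
      if fuse x (fuse y z f) d = none then 0 else
      braid u x (fuse y z f) d * if fuse (fuse y z f) x d = none then 0 else
        ∑ g, if fuse y (fuse z x g) d = none then 0 else sixj (u - u ^ 4) y z x d f g * w g) =
      if fuse x y e = none then 0 else braid u x y e *
        if fuse (fuse y x e) z d = none then 0 else
        ∑ g, if fuse y (fuse x z g) d = none then 0 else sixj (u - u ^ 4) y x z d e g *
          if fuse y (fuse x z g) d = none then 0 else
          if fuse x z g = none then 0 else braid u x z g * w g := by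
  revert h
  rcases x with _ | _ | _ <;> rcases y with _ | _ | _ <;> rcases z with _ | _ | _ <;>
    rcases d with _ | _ <;> rcases e with _ | _ <;>
    simp only [fuse_none_left, fuse_none_right, fuse_fff, fuse_fft, fuse_ftf, fuse_ftt, fuse_tff,
      fuse_tft, fuse_tt, sixj_unit_left, sixj_unit_middle, sixj_unit_right, sixj_unit_total,
      sixj_true, sixjCore, Fintype.sum_bool, reduceIte, reduceCtorEq, mul_zero, one_mul,
      add_zero, zero_add, ne_eq, not_true_eq_false, not_false_eq_true, forall_true_left,
      false_imp_iff,
      braid_unit_left, braid_unit_right, braid_tt, braid_tf]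
  · ring
  · linear_combination (-u * w true) * hu
  · linear_combination (u - u ^ 4) * (-(u + 1) * w true + u * w false) * hu

/-- The second hexagon equation, for the inverse associator. -/
theorem hexagon_scalar' (hu : u ^ 4 - u ^ 3 + u ^ 2 - u + 1 = 0) (x y z : Option Bool)
    (f d : Bool) (w : Bool → k) (h : fuse x (fuse y z f) d ≠ none) :
    (∑ e, if fuse (fuse x y e) z d = none then 0 else sixj (u - u ^ 4) x y z d f e *
      if fuse (fuse x y e) z d = none then 0 else
      braid u (fuse x y e) z d * if fuse z (fuse x y e) d = none then 0 else
        ∑ g, if fuse (fuse z x g) y d = none then 0 else sixj (u - u ^ 4) z x y d e g * w g) =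
      if fuse y z f = none then 0 else braid u y z f *
        if fuse x (fuse z y f) d = none then 0 else
        ∑ g, if fuse (fuse x z g) y d = none then 0 else sixj (u - u ^ 4) x z y d f g *
          if fuse (fuse x z g) y d = none then 0 else
          if fuse x z g = none then 0 else braid u x z g * w g := by
  revert h
  rcases x with _ | _ | _ <;> rcases y with _ | _ | _ <;> rcases z with _ | _ | _ <;>
    rcases d with _ | _ <;> rcases f with _ | _ <;>
    simp only [fuse_none_left, fuse_none_right, fuse_fff, fuse_fft, fuse_ftf, fuse_ftt, fuse_tff,
      fuse_tft, fuse_tt, sixj_unit_left, sixj_unit_middle, sixj_unit_right, sixj_unit_total,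
      sixj_true, sixjCore, Fintype.sum_bool, reduceIte, reduceCtorEq, mul_zero, one_mul,
      add_zero, zero_add, ne_eq, not_true_eq_false, not_false_eq_true, forall_true_left,
      false_imp_iff,
      braid_unit_left, braid_unit_right, braid_tt, braid_tf]
  · ring
  · linear_combination (-u * w true) * hu
  · linear_combination (u - u ^ 4) * (-(u + 1) * w true + u * w false) * hu

end FibObj

/-! ### The coherence equations for the matrices -/

namespace FibObj

variable {k : Type w} [Field k] {u : k}

theorem fuse_left_ne_none {x y : Option Bool} {c : Bool} (h : fuse x y c ≠ none) : x ≠ none :=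
  fun h' => h (by rw [h', fuse_none_left])

theorem fuse_right_ne_none {x y : Option Bool} {c : Bool} (h : fuse x y c ≠ none) : y ≠ none :=
  fun h' => h (by rw [h', fuse_none_right])

theorem pentagon_matrix (hu : u ^ 4 - u ^ 3 + u ^ 2 - u + 1 = 0) (S T R Q : FibObj k u) :
    tensorMap (assocHom S T R) (𝟙 Q) ≫ assocHom S (tensorObj T R) Q ≫
      tensorMap (𝟙 S) (assocHom T R Q) =
    assocHom (tensorObj S T) R Q ≫ assocHom S T (tensorObj R Q) := by
  refine hom_ext_act ?_
  intro v x hl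
  obtain ⟨x, q, b, rfl⟩ := exists_pt x
  obtain ⟨x, r, d, rfl⟩ := exists_pt x
  obtain ⟨s, t, e, rfl⟩ := exists_pt x
  simp only [color_pt] at hl
  have h1 := fuse_left_ne_none hl
  have hq := fuse_right_ne_none hl
  have hs := fuse_left_ne_none (fuse_left_ne_none h1)
  have key := pentagon_scalar (golden hu) _ _ _ _ _ _ _
    (fun g' g => v (pt s (pt t (pt r q g') g) b)) hl
  simp only [act_comp, act_tensorMap, act_assocHom, act_id, color_pt, if_neg hl, if_neg h1,
    if_neg hq, if_neg hs]
  exact key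

theorem triangle_matrix (S T : FibObj k u) :
    assocHom S unitObj T ≫ tensorMap (𝟙 S) (leftUnitorHom T) =
      tensorMap (rightUnitorHom S) (𝟙 T) := by
  refine hom_ext_act ?_
  intro v x hl
  obtain ⟨x, t, d, rfl⟩ := exists_pt x
  obtain ⟨s, i, e, rfl⟩ := exists_pt x
  obtain rfl : i = star := rfl
  simp only [color_pt, color_star] at hl
  have ht := fuse_right_ne_none hl
  have hs := fuse_left_ne_none (fuse_left_ne_none hl)
  simp only [act_comp, act_tensorMap, act_assocHom, act_id, act_leftUnitorHom, act_rightUnitorHom,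
    color_pt, color_star, if_neg hl, if_neg ht, if_neg hs]
  generalize v (pt s t d) = w
  clear v
  revert hl
  rcases S.color s with _ | _ | _ <;> rcases T.color t with _ | _ | _ <;> rcases d with _ | _ <;>
    rcases e with _ | _ <;> simp [fuse, sixj]

theorem hexagon_matrix (hu : u ^ 4 - u ^ 3 + u ^ 2 - u + 1 = 0) (S T R : FibObj k u) :
    assocHom S T R ≫ braidHom S (tensorObj T R) ≫ assocHom T R S =
      tensorMap (braidHom S T) (𝟙 R) ≫ assocHom T S R ≫ tensorMap (𝟙 T) (braidHom S R) := by
  refine hom_ext_act ?_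
  intro v x hl
  obtain ⟨x, r, d, rfl⟩ := exists_pt x
  obtain ⟨s, t, e, rfl⟩ := exists_pt x
  simp only [color_pt] at hl
  have hr := fuse_right_ne_none hl
  have ht := fuse_right_ne_none (fuse_left_ne_none hl)
  have key := hexagon_scalar hu _ _ _ _ _ (fun g => v (pt t (pt r s g) d)) hl
  simp only [act_comp, act_tensorMap, act_assocHom, act_braidHom, act_id, color_pt, if_neg hl,
    if_neg hr, if_neg ht]
  exact key

theorem hexagon_matrix' (hu : u ^ 4 - u ^ 3 + u ^ 2 - u + 1 = 0) (S T R : FibObj k u) :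
    assocInv S T R ≫ braidHom (tensorObj S T) R ≫ assocInv R S T =
      tensorMap (𝟙 S) (braidHom T R) ≫ assocInv S R T ≫ tensorMap (braidHom S R) (𝟙 T) := by
  refine hom_ext_act ?_
  intro v x hl
  obtain ⟨s, x, d, rfl⟩ := exists_pt x
  obtain ⟨t, r, f, rfl⟩ := exists_pt x
  simp only [color_pt] at hl
  have hs := fuse_left_ne_none hl
  have ht := fuse_left_ne_none (fuse_right_ne_none hl)
  have key := hexagon_scalar' hu _ _ _ _ _ (fun g => v (pt (pt r s g) t d)) hl
  simp only [act_comp, act_tensorMap, act_assocInv, act_braidHom, act_id, color_pt, if_neg hl,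
    if_neg hs, if_neg ht]
  exact key

end FibObj

/-! ### The balanced braided structure -/

namespace FibObj

variable {k : Type w} [Field k] {u : k}

theorem ne_zero_of_cyclotomic (hu : u ^ 4 - u ^ 3 + u ^ 2 - u + 1 = 0) : u ≠ 0 := by
  rintro rfl
  simp at hu

theorem leftUnitorHom_inv (S : FibObj k u) : leftUnitorHom S ≫ leftUnitorInv S = 𝟙 _ := by
  refine hom_ext_act ?_
  intro v x hl
  obtain ⟨i, s, c, rfl⟩ := exists_pt x
  obtain rfl : i = star := rfl
  rw [act_id, if_neg hl]
  simp only [color_pt, color_star] at hl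
  simp only [act_comp, act_leftUnitorHom, act_leftUnitorInv, Fintype.sum_bool]
  generalize hv : v (pt star s c) = w
  revert hl
  rcases c <;> rcases h : S.color s with _ | _ | _ <;> simp_all [fuse]

theorem leftUnitorInv_hom (S : FibObj k u) : leftUnitorInv S ≫ leftUnitorHom S = 𝟙 _ := by
  refine hom_ext_act ?_
  intro v s hl
  simp only [act_id, if_neg hl, act_comp, act_leftUnitorHom, act_leftUnitorInv, Fintype.sum_bool]
  revert hl
  rcases S.color s with _ | _ | _ <;> simp

theorem rightUnitorHom_inv (S : FibObj k u) : rightUnitorHom S ≫ rightUnitorInv S = 𝟙 _ := by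
  refine hom_ext_act ?_
  intro v x hl
  obtain ⟨s, i, c, rfl⟩ := exists_pt x
  obtain rfl : i = star := rfl
  rw [act_id, if_neg hl]
  simp only [color_pt, color_star] at hl
  simp only [act_comp, act_rightUnitorHom, act_rightUnitorInv, Fintype.sum_bool]
  generalize hv : v (pt s star c) = w
  revert hl
  rcases c <;> rcases h : S.color s with _ | _ | _ <;> simp_all [fuse]

theorem rightUnitorInv_hom (S : FibObj k u) : rightUnitorInv S ≫ rightUnitorHom S = 𝟙 _ := by
  refine hom_ext_act ?_
  intro v s hl
  simp only [act_id, if_neg hl, act_comp, act_rightUnitorHom, act_rightUnitorInv, Fintype.sum_bool]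
  revert hl
  rcases S.color s with _ | _ | _ <;> simp

theorem leftUnitor_naturality {S T : FibObj k u} (f : S ⟶ T) :
    tensorMap (𝟙 unitObj) f ≫ leftUnitorHom T = leftUnitorHom S ≫ f := by
  refine hom_ext_act ?_
  intro v x hl
  obtain ⟨i, s, c, rfl⟩ := exists_pt x
  obtain rfl : i = star := rfl
  simp only [color_pt, color_star] at hl
  have hc : S.color s = some c := by
    revert hl; generalize S.color s = x; revert x c; decide
  simp only [act_comp, act_tensorMap, act_id, act_leftUnitorHom, color_star, if_neg hl,
    reduceCtorEq, if_false, if_pos hc]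
  refine act_congr f fun t ht _ => ?_
  rw [ht, if_pos hc]

theorem rightUnitor_naturality {S T : FibObj k u} (f : S ⟶ T) :
    tensorMap f (𝟙 unitObj) ≫ rightUnitorHom T = rightUnitorHom S ≫ f := by
  refine hom_ext_act ?_
  intro v x hl
  obtain ⟨s, i, c, rfl⟩ := exists_pt x
  obtain rfl : i = star := rfl
  simp only [color_pt, color_star] at hl
  have hc : S.color s = some c := by
    revert hl; generalize S.color s = x; revert x c; decide
  simp only [act_comp, act_tensorMap, act_id, act_rightUnitorHom, color_star, if_neg hl,
    reduceCtorEq, if_false, if_pos hc]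
  refine act_congr f fun t ht _ => ?_
  rw [ht, if_pos hc]

theorem fuse_comm (x y : Option Bool) (c : Bool) : fuse x y c = fuse y x c := by
  revert x y c; decide

theorem braid_comm (u : k) (x y : Option Bool) (c : Bool) : braid u x y c = braid u y x c := by
  simp only [braid, and_comm]

theorem braid_ne_zero (hu : u ≠ 0) (x y : Option Bool) (c : Bool) : braid u x y c ≠ 0 := by
  unfold braid
  split_ifs <;> simp [hu]

theorem braidHom_inv (hu : u ≠ 0) (S T : FibObj k u) : braidHom S T ≫ braidInv S T = 𝟙 _ := by
  refine hom_ext_act ?_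
  intro v x hl
  obtain ⟨s, t, c, rfl⟩ := exists_pt x
  rw [act_id, if_neg hl]
  simp only [color_pt] at hl
  have hl' : ¬ fuse (T.color t) (S.color s) c = none := by rwa [fuse_comm]
  rw [act_comp, act_braidHom, if_neg hl, act_braidInv, if_neg hl', braid_comm u (T.color t),
    mul_inv_cancel_left₀ (braid_ne_zero hu _ _ _)]

theorem braidInv_hom (hu : u ≠ 0) (S T : FibObj k u) : braidInv S T ≫ braidHom S T = 𝟙 _ := by
  refine hom_ext_act ?_
  intro v x hl
  obtain ⟨t, s, c, rfl⟩ := exists_pt x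
  rw [act_id, if_neg hl]
  simp only [color_pt] at hl
  have hl' : ¬ fuse (S.color s) (T.color t) c = none := by rwa [fuse_comm]
  rw [act_comp, act_braidInv, if_neg hl, act_braidHom, if_neg hl', braid_comm u (T.color t),
    inv_mul_cancel_left₀ (braid_ne_zero hu _ _ _)]

theorem braid_naturality {S S' T T' : FibObj k u} (f : S ⟶ S') (g : T ⟶ T') :
    tensorMap f g ≫ braidHom S' T' = braidHom S T ≫ tensorMap g f := by
  refine hom_ext_act ?_
  intro v x hl
  obtain ⟨s, t, c, rfl⟩ := exists_pt x
  simp only [color_pt] at hl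
  have hl' : ¬ fuse (T.color t) (S.color s) c = none := by rwa [fuse_comm]
  simp only [act_comp, act_braidHom, act_tensorMap, if_neg hl, if_neg hl']
  rw [act_act_comm g f, ← act_mul]
  refine act_congr f fun s' hs' _ => ?_
  rw [← act_mul]
  refine act_congr g fun t' ht' _ => ?_
  rw [hs', ht', if_neg hl]

theorem tensorMap_add_right {S S' T T' : FibObj k u} (f : S ⟶ S') (g h : T ⟶ T') :
    tensorMap f (g + h) = tensorMap f g + tensorMap f h := by
  ext x y
  obtain ⟨s, t, c, rfl⟩ := exists_pt x
  obtain ⟨s', t', c', rfl⟩ := exists_pt y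
  simp only [ent_tensorMap, ent_add]
  split_ifs <;> ring

theorem tensorMap_add_left {S S' T T' : FibObj k u} (f g : S ⟶ S') (h : T ⟶ T') :
    tensorMap (f + g) h = tensorMap f h + tensorMap g h := by
  ext x y
  obtain ⟨s, t, c, rfl⟩ := exists_pt x
  obtain ⟨s', t', c', rfl⟩ := exists_pt y
  simp only [ent_tensorMap, ent_add]
  split_ifs <;> ring

theorem tensorMap_smul_right {S S' T T' : FibObj k u} (a : k) (f : S ⟶ S') (g : T ⟶ T') :
    tensorMap f (a • g) = a • tensorMap f g := by
  ext x y
  obtain ⟨s, t, c, rfl⟩ := exists_pt x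
  obtain ⟨s', t', c', rfl⟩ := exists_pt y
  simp only [ent_tensorMap, ent_smul]
  split_ifs <;> ring

theorem tensorMap_smul_left {S S' T T' : FibObj k u} (a : k) (f : S ⟶ S') (g : T ⟶ T') :
    tensorMap (a • f) g = a • tensorMap f g := by
  ext x y
  obtain ⟨s, t, c, rfl⟩ := exists_pt x
  obtain ⟨s', t', c', rfl⟩ := exists_pt y
  simp only [ent_tensorMap, ent_smul]
  split_ifs <;> ring

/-- The scalar by which the twist acts on a label. -/
def twist (u : k) (x : Option Bool) : k := if x = some true then (u ^ 2)⁻¹ else 1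

theorem twist_ne_zero (hu : u ≠ 0) (x : Option Bool) : twist u x ≠ 0 := by
  unfold twist
  split_ifs <;> simp [hu]

/-- The balancing identity on the summand `c` of `x ⊗ y`. -/
theorem twist_fuse (hu : u ≠ 0) (x y : Option Bool) (c : Bool) (h : fuse x y c ≠ none) :
    twist u (fuse x y c) = twist u x * (twist u y * (braid u x y c * braid u y x c)) := by
  revert h
  rcases x with _ | _ | _ <;> rcases y with _ | _ | _ <;> rcases c with _ | _ <;>
    simp [fuse, twist, braid]
  all_goals field_simp

/-- The endomorphism that is multiplication by `φ x` on the part labelled `x`. -/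
def scalarHom (S : FibObj k u) (φ : Option Bool → k) : S ⟶ S :=
  hom fun s t => if s = t then φ (S.color s) else 0

theorem act_scalarHom (S : FibObj k u) (φ : Option Bool → k) (v : S.ι → k) (s : S.ι) :
    act (scalarHom S φ) v s = if S.color s = none then 0 else φ (S.color s) * v s := by
  rw [act, Finset.sum_eq_single s]
  · simp [Live, scalarHom]
  all_goals first | simp; done | (intro b _ hb; simp [scalarHom, hb.symm])

variable [hu : Fact (u ^ 4 - u ^ 3 + u ^ 2 - u + 1 = 0)]

/-- The associator as an isomorphism. -/
@[simps] def assocIso (S T R : FibObj k u) :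
    tensorObj (tensorObj S T) R ≅ tensorObj S (tensorObj T R) where
  hom := assocHom S T R
  inv := assocInv S T R
  hom_inv_id := assocHom_assocInv (golden hu.out) S T R
  inv_hom_id := assocInv_assocHom (golden hu.out) S T R

/-- The left unit constraint as an isomorphism. -/
@[simps] def leftUnitorIso (S : FibObj k u) : tensorObj unitObj S ≅ S where
  hom := leftUnitorHom S
  inv := leftUnitorInv S
  hom_inv_id := leftUnitorHom_inv S
  inv_hom_id := leftUnitorInv_hom S

/-- The right unit constraint as an isomorphism. -/
@[simps] def rightUnitorIso (S : FibObj k u) : tensorObj S unitObj ≅ S where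
  hom := rightUnitorHom S
  inv := rightUnitorInv S
  hom_inv_id := rightUnitorHom_inv S
  inv_hom_id := rightUnitorInv_hom S

instance : MonoidalCategoryStruct (FibObj k u) where
  tensorObj := tensorObj
  tensorUnit := unitObj
  tensorHom := tensorMap
  whiskerLeft S _ _ f := tensorMap (𝟙 S) f
  whiskerRight f T := tensorMap f (𝟙 T)
  associator := assocIso
  leftUnitor := leftUnitorIso
  rightUnitor := rightUnitorIso

instance : MonoidalCategory (FibObj k u) := MonoidalCategory.ofTensorHom
  (id_tensorHom_id := tensorMap_id)
  (id_tensorHom := fun _ _ _ _ => rfl)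
  (tensorHom_id := fun _ _ => rfl)
  (tensorHom_comp_tensorHom := tensorMap_comp)
  (associator_naturality := assoc_naturality)
  (leftUnitor_naturality := leftUnitor_naturality)
  (rightUnitor_naturality := rightUnitor_naturality)
  (pentagon := pentagon_matrix hu.out)
  (triangle := triangle_matrix)

theorem whiskerLeft_eq (S : FibObj k u) {T T' : FibObj k u} (f : T ⟶ T') :
    S ◁ f = tensorMap (𝟙 S) f := rfl
theorem whiskerRight_eq {S S' : FibObj k u} (f : S ⟶ S') (T : FibObj k u) :
    f ▷ T = tensorMap f (𝟙 T) := rfl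

instance : MonoidalPreadditive (FibObj k u) where
  whiskerLeft_zero := by
    intro S T T'
    simpa [whiskerLeft_eq] using tensorMap_smul_right (0 : k) (𝟙 S) (0 : T ⟶ T')
  zero_whiskerRight := by
    intro S T T'
    simpa [whiskerRight_eq] using tensorMap_smul_left (0 : k) (0 : T ⟶ T') (𝟙 S)
  whiskerLeft_add f g := tensorMap_add_right _ f g
  add_whiskerRight f g := tensorMap_add_left f g _

instance : MonoidalLinear k (FibObj k u) where
  whiskerLeft_smul S _ _ a f := tensorMap_smul_right a (𝟙 S) f
  smul_whiskerRight a _ _ f S := tensorMap_smul_left a f (𝟙 S)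

/-- The braiding as an isomorphism. -/
@[simps] def braidIso (S T : FibObj k u) : tensorObj S T ≅ tensorObj T S where
  hom := braidHom S T
  inv := braidInv S T
  hom_inv_id := braidHom_inv (ne_zero_of_cyclotomic hu.out) S T
  inv_hom_id := braidInv_hom (ne_zero_of_cyclotomic hu.out) S T

instance : BraidedCategory (FibObj k u) where
  braiding := braidIso
  braiding_naturality_right S _ _ f := braid_naturality (𝟙 S) f
  braiding_naturality_left f S := braid_naturality f (𝟙 S)
  hexagon_forward := hexagon_matrix hu.out
  hexagon_reverse := hexagon_matrix' hu.out

/-- The twist, `u⁻²` on the part labelled `X` and `1` on the part labelled `𝟙`. -/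
@[simps] def twistIso (S : FibObj k u) : S ≅ S where
  hom := scalarHom S (twist u)
  inv := scalarHom S fun x => (twist u x)⁻¹
  hom_inv_id := by
    refine hom_ext_act fun v s hs => ?_
    simp [act_comp, act_scalarHom, act_id, hs, twist_ne_zero (ne_zero_of_cyclotomic hu.out)]
  inv_hom_id := by
    refine hom_ext_act fun v s hs => ?_
    simp [act_comp, act_scalarHom, act_id, hs, twist_ne_zero (ne_zero_of_cyclotomic hu.out)]

instance : Balanced (FibObj k u) where
  twist := twistIso
  twist_naturality {S T} f := by
    refine hom_ext_act fun v s hs => ?_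
    simp only [act_comp, twistIso_hom, act_scalarHom, if_neg hs, ← act_mul]
    refine act_congr f fun t ht h => ?_
    rw [act_scalarHom, ht, if_neg h]
  twist_tensor S T := by
    refine hom_ext_act ?_
    intro v x hl
    obtain ⟨s, t, c, rfl⟩ := exists_pt x
    change act (scalarHom (tensorObj S T) (twist u)) v _ = act (tensorMap (scalarHom S (twist u))
      (scalarHom T (twist u)) ≫ braidHom S T ≫ braidHom T S) v _
    have e : act (scalarHom (tensorObj S T) (twist u)) v (pt s t c) =
        twist u (fuse (S.color s) (T.color t) c) * v (pt s t c) := by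
      rw [act_scalarHom]
      exact if_neg hl
    have hl : ¬ fuse (S.color s) (T.color t) c = none := hl
    have hl' : ¬ fuse (T.color t) (S.color s) c = none := by rwa [fuse_comm]
    simp only [e, act_comp, act_scalarHom, act_tensorMap, act_braidHom, if_neg hl, if_neg hl',
      if_neg (fuse_left_ne_none hl), if_neg (fuse_right_ne_none hl)]
    rw [twist_fuse (ne_zero_of_cyclotomic hu.out) _ _ _ hl]
    ring

end FibObj

/-! ### Direct sums and the abelian structure -/

namespace FibObj

variable {k : Type w} [Field k] {u : k}

/-- The direct sum of a finite family. -/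
def sumObj {n : ℕ} (F : Fin n → FibObj k u) : FibObj k u where
  ι := Σ j, (F j).ι
  color x := (F x.1).color x.2

/-- The index of the direct sum that belongs to the index `s` of the `j`-th summand. -/
def sumPt {n : ℕ} {F : Fin n → FibObj k u} (j : Fin n) (s : (F j).ι) : (sumObj F).ι := ⟨j, s⟩

theorem exists_sumPt {n : ℕ} {F : Fin n → FibObj k u} (x : (sumObj F).ι) : ∃ j s, x = sumPt j s :=
  ⟨x.1, x.2, rfl⟩

@[simp] theorem color_sumPt {n : ℕ} {F : Fin n → FibObj k u} (j : Fin n) (s : (F j).ι) :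
    (sumObj F).color (sumPt j s) = (F j).color s := rfl

theorem sumPt_ne {n : ℕ} {F : Fin n → FibObj k u} {i j : Fin n} (h : i ≠ j) (s : (F i).ι)
    (t : (F j).ι) : (sumPt i s : (sumObj F).ι) ≠ sumPt j t :=
  fun h' => h (congrArg Sigma.fst h')

theorem sumPt_inj {n : ℕ} {F : Fin n → FibObj k u} {i : Fin n} {s t : (F i).ι} :
    (sumPt i s : (sumObj F).ι) = sumPt i t ↔ s = t :=
  ⟨fun h => eq_of_heq (Sigma.mk.inj h).2, fun h => h ▸ rfl⟩

/-- The inclusion of a summand. -/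
def sumObjι {n : ℕ} (F : Fin n → FibObj k u) (j : Fin n) : F j ⟶ sumObj F :=
  hom fun s x => if sumPt j s = x then 1 else 0

/-- The projection onto a summand. -/
def sumObjπ {n : ℕ} (F : Fin n → FibObj k u) (j : Fin n) : sumObj F ⟶ F j :=
  hom fun x s => if x = sumPt j s then 1 else 0

theorem act_sumObjι {n : ℕ} (F : Fin n → FibObj k u) (j : Fin n) (v : (sumObj F).ι → k)
    (s : (F j).ι) : act (sumObjι F j) v s = if (F j).color s = none then 0 else v (sumPt j s) := by
  rw [act, Finset.sum_eq_single (sumPt j s)]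
  · simp [Live, sumObjι]
  all_goals first | simp; done | (intro b _ hb; simp [sumObjι, hb.symm])

theorem act_sumObjπ {n : ℕ} (F : Fin n → FibObj k u) (i : Fin n) (v : (F i).ι → k)
    (s : (F i).ι) : act (sumObjπ F i) v (sumPt i s) =
      if (F i).color s = none then 0 else v s := by
  rw [act, Finset.sum_eq_single s]
  · simp [Live, sumObjπ]
  all_goals first | simp; done | (intro b _ hb; simp [sumObjπ, sumPt_inj, hb.symm])

theorem act_sumObjπ_of_ne {n : ℕ} (F : Fin n → FibObj k u) {i j : Fin n} (h : i ≠ j)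
    (v : (F j).ι → k) (s : (F i).ι) : act (sumObjπ F j) v (sumPt i s) = 0 := by
  rw [act, Finset.sum_eq_zero fun t _ => ?_]
  simp [sumObjπ, sumPt_ne h]

/-- The direct sum as a bicone. -/
def sumObjBicone {n : ℕ} (F : Fin n → FibObj k u) : Bicone F where
  pt := sumObj F
  ι := sumObjι F
  π := sumObjπ F
  ι_π i j := by
    refine hom_ext_act fun v s hs => ?_
    rw [act_comp, act_sumObjι, if_neg hs]
    split_ifs with h
    · subst h
      rw [act_sumObjπ, eqToHom_refl, act_id]
    · rw [act_sumObjπ_of_ne _ h]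
      simp [act]

theorem act_sum {S T : FibObj k u} {J : Type*} (A : Finset J) (f : J → (S ⟶ T)) (v : T.ι → k)
    (s : S.ι) : act (∑ j ∈ A, f j) v s = ∑ j ∈ A, act (f j) v s := by
  simp only [act, ent_sum, Finset.sum_mul]
  exact Finset.sum_comm

theorem sumObj_total {n : ℕ} (F : Fin n → FibObj k u) :
    ∑ j, sumObjπ F j ≫ sumObjι F j = 𝟙 (sumObj F) := by
  refine hom_ext_act ?_
  intro v x hs
  obtain ⟨i, s, rfl⟩ := exists_sumPt x
  rw [color_sumPt] at hs
  rw [act_sum, Finset.sum_eq_single i]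
  · rw [act_comp, act_sumObjπ, if_neg hs, act_id, act_sumObjι, if_neg hs, color_sumPt, if_neg hs]
  · intro j _ hj
    rw [act_comp, act_sumObjπ_of_ne _ hj.symm]
  · simp

instance : HasFiniteBiproducts (FibObj k u) where
  out _ := ⟨fun F => hasBiproduct_of_total (sumObjBicone F) (sumObj_total F)⟩

/-- The row vectors supported on the indices labelled `c`. -/
abbrev Fibre (S : FibObj k u) (c : Bool) : Type w := {s // S.color s = some c} → k

/-- The block of the matrix of `f` at the label `c`, acting on row vectors. -/
def fibreMap {S T : FibObj k u} (f : S ⟶ T) (c : Bool) : S.Fibre c →ₗ[k] T.Fibre c :=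
  Matrix.vecMulLinear (Matrix.of fun s t => ent f s.1 t.1)

theorem fibreMap_apply {S T : FibObj k u} (f : S ⟶ T) (c : Bool) (v : S.Fibre c)
    (t : {t // T.color t = some c}) : fibreMap f c v t = ∑ s, v s * ent f s.1 t.1 := rfl

theorem fibreMap_id (S : FibObj k u) (c : Bool) : fibreMap (𝟙 S) c = LinearMap.id := by
  refine LinearMap.ext fun v => funext fun t => ?_
  rw [fibreMap_apply, Finset.sum_eq_single t]
  · simp [Live, t.2]
  · intro b _ hb
    simp [Subtype.coe_injective.ne hb]
  · simp

theorem sum_fibre {S : FibObj k u} (c : Bool) (g : S.ι → k)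
    (h : ∀ s, S.color s ≠ some c → g s = 0) :
    ∑ s : {s // S.color s = some c}, g s = ∑ s, g s := by
  rw [← Finset.sum_filter_of_ne (s := Finset.univ) (p := fun s => S.color s = some c)
    (fun s _ hs => by_contra fun hc => hs (h s hc))]
  exact (Finset.sum_subtype _ (by simp) g).symm

theorem fibreMap_comp {S T R : FibObj k u} (f : S ⟶ T) (g : T ⟶ R) (c : Bool) :
    fibreMap (f ≫ g) c = fibreMap g c ∘ₗ fibreMap f c := by
  refine LinearMap.ext fun v => funext fun r => ?_
  simp only [fibreMap_apply, LinearMap.comp_apply, ent_comp, Finset.mul_sum, Finset.sum_mul]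
  rw [Finset.sum_comm, ← sum_fibre c]
  · simp only [mul_assoc]
  · intro t ht
    refine Finset.sum_eq_zero fun s _ => ?_
    rw [ent_eq_zero f fun h => ht (h.1.symm.trans s.2), zero_mul, mul_zero]

/-- The functor to pairs of finite-dimensional vector spaces, indexed by the labels. It is an
equivalence, and the abelian structure of the matrix model comes from it. -/
def fibreFunctor : FibObj k u ⥤ (Discrete Bool ⥤ FGModuleCat.{w} k) where
  obj S := Discrete.functor fun c => FGModuleCat.of k (S.Fibre c)
  map f := Discrete.natTrans fun c => FGModuleCat.ofHom (fibreMap f c.as)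
  map_id S := by
    ext c : 2
    exact FGModuleCat.hom_ext (fibreMap_id S c.as)
  map_comp f g := by
    ext c : 2
    exact FGModuleCat.hom_ext (fibreMap_comp f g c.as)

theorem fibreMap_single {S T : FibObj k u} (f : S ⟶ T) (c : Bool) (s : {s // S.color s = some c})
    (t : {t // T.color t = some c}) : fibreMap f c (Pi.single s 1) t = ent f s.1 t.1 := by
  rw [fibreMap_apply, Finset.sum_eq_single s]
  · simp
  · intro b _ hb
    simp [hb]
  · simp

instance : (fibreFunctor : FibObj k u ⥤ _).Faithful where
  map_injective {S T} f g h := by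
    refine hom_ext_live fun s t hl => ?_
    obtain ⟨c, hc⟩ := Option.ne_none_iff_exists'.1 hl.2
    have h1 : fibreMap f c = fibreMap g c :=
      congrArg (fun η : (fibreFunctor.obj S ⟶ fibreFunctor.obj T) => (η.app ⟨c⟩).hom.hom) h
    rw [← fibreMap_single f c ⟨s, hc⟩ ⟨t, hl.1 ▸ hc⟩, h1, fibreMap_single]

instance : (fibreFunctor : FibObj k u ⥤ _).Full where
  map_surjective {S T} η := by
    let φ : ∀ c, S.Fibre c →ₗ[k] T.Fibre c := fun c => (η.app ⟨c⟩).hom.hom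
    refine ⟨hom fun s t => ∑ c, if h : S.color s = some c ∧ T.color t = some c then
      φ c (Pi.single ⟨s, h.1⟩ 1) ⟨t, h.2⟩ else 0, ?_⟩
    ext ⟨c⟩ : 2
    refine FGModuleCat.hom_ext ?_
    change fibreMap _ c = φ c
    refine LinearMap.pi_ext' fun s => LinearMap.ext_ring (funext fun t => ?_)
    change fibreMap _ c (Pi.single s 1) t = φ c (Pi.single s 1) t
    rw [fibreMap_single, ent_hom, if_pos ⟨s.2.trans t.2.symm, by simp [s.2]⟩,
      Finset.sum_eq_single c]
    · rw [dif_pos ⟨s.2, t.2⟩]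
    · intro b _ hb
      rw [dif_neg]
      rintro ⟨h, -⟩
      exact hb (Option.some_injective _ (h.symm.trans s.2))
    · simp

instance : (fibreFunctor : FibObj k u ⥤ _).EssSurj where
  mem_essImage F := by
    let n : Bool → ℕ := fun c => Module.finrank k (F.obj ⟨c⟩)
    let S : FibObj k u := { ι := Σ c, ULift.{w} (Fin (n c)), color := fun x => some x.1 }
    have e : ∀ c, {s // S.color s = some c} ≃ Fin (n c) := fun c =>
      { toFun := fun s => (Option.some_injective _ s.2) ▸ s.1.2.down
        invFun := fun i => ⟨⟨c, ⟨i⟩⟩, rfl⟩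
        left_inv := by
          rintro ⟨⟨c', i⟩, h⟩
          obtain rfl := Option.some_injective _ h
          rfl
        right_inv := fun i => rfl }
    exact ⟨S, ⟨Discrete.natIso fun c => LinearEquiv.toFGModuleCatIso
      ((LinearEquiv.funCongrLeft k k (e c.as).symm).trans
        (Module.finBasis k (F.obj c)).equivFun.symm)⟩⟩

instance : (fibreFunctor : FibObj k u ⥤ _).IsEquivalence where

instance : Abelian (FibObj k u) := abelianOfEquivalence fibreFunctor

end FibObj

/-! ### Simple objects of the matrix model -/

namespace FibObj

variable {k : Type w} [Field k] {u : k}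

/-- The simple object with label `c`. -/
def single (c : Bool) : FibObj k u where
  ι := PUnit
  color _ := some c

/-- The only index of a simple object. -/
def dot {c : Bool} : (single c : FibObj k u).ι := PUnit.unit

@[simp] theorem color_dot {c : Bool} : (single c : FibObj k u).color dot = some c := rfl

theorem eq_dot {c : Bool} (x : (single c : FibObj k u).ι) : x = dot := rfl

theorem sum_single {c : Bool} (g : (single c : FibObj k u).ι → k) : ∑ x, g x = g dot := by
  exact Fintype.sum_unique (ι := PUnit) g

/-- The inclusion of the index `s`, when this index is labelled `c`. -/
def incl {S : FibObj k u} (s : S.ι) (c : Bool) : single c ⟶ S :=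
  hom fun _ t => if s = t then 1 else 0

/-- The projection onto the index `s`, when this index is labelled `c`. -/
def proj {S : FibObj k u} (s : S.ι) (c : Bool) : S ⟶ single c :=
  hom fun t _ => if t = s then 1 else 0

theorem act_incl {S : FibObj k u} {s : S.ι} {c : Bool} (h : S.color s = some c) (v : S.ι → k) :
    act (incl s c) v dot = v s := by
  rw [act, Finset.sum_eq_single s]
  · simp [Live, incl, h]
  all_goals first | simp; done | (intro b _ hb; simp [incl, hb.symm])

theorem act_proj {S : FibObj k u} {s : S.ι} {c : Bool} (h : S.color s = some c)
    (v : (single c : FibObj k u).ι → k) (t : S.ι) :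
    act (proj s c) v t = if t = s then v dot else 0 := by
  rw [act, sum_single]
  by_cases hs : t = s
  · subst hs
    simp [Live, proj, h]
  · simp [proj, hs]

theorem incl_proj {S : FibObj k u} {s : S.ι} {c : Bool} (h : S.color s = some c) :
    incl s c ≫ proj s c = 𝟙 (single c) := by
  refine hom_ext_act fun v x hx => ?_
  obtain rfl := eq_dot x
  rw [act_comp, act_incl h, act_proj h, act_id, if_neg hx, if_pos rfl]

theorem hom_eq_zero_of_ne {c d : Bool} (h : c ≠ d) (f : (single c : FibObj k u) ⟶ single d) :
    f = 0 := by
  refine hom_ext fun s t => ?_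
  rw [ent_eq_zero f fun hl => h (Option.some_injective _ hl.1), ent_zero]

theorem id_single_ne_zero (c : Bool) : 𝟙 (single c : FibObj k u) ≠ 0 := fun h => by
  have := congrArg (fun f => ent f dot dot) h
  simp [Live] at this

instance (c : Bool) : Simple (single c : FibObj k u) where
  mono_isIso_iff_nonzero {S} f _ := by
    constructor
    · intro hf h0
      subst h0
      apply id_single_ne_zero (k := k) (u := u) c
      rw [← IsIso.inv_hom_id (0 : S ⟶ single c), comp_zero]
    · intro hf
      obtain ⟨s, hs⟩ : ∃ s, ent f s dot ≠ 0 := by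
        by_contra! h
        exact hf (hom_ext fun s t => h s)
      have hc : S.color s = some c := by
        by_contra hc
        exact hs (ent_eq_zero f fun hl => hc hl.1)
      have : IsSplitEpi f := IsSplitEpi.mk' ⟨(ent f s dot)⁻¹ • incl s c, by
        refine hom_ext_act fun v x hx => ?_
        obtain rfl := eq_dot x
        have hf : act f v s = ent f s dot * v dot := by rw [act, sum_single]
        have h1 : act ((ent f s dot)⁻¹ • (incl s c ≫ f)) v dot =
            (ent f s dot)⁻¹ * act (incl s c ≫ f) v dot := by
          simp only [act, ent_smul, Finset.mul_sum, mul_assoc]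
        rw [Linear.smul_comp, h1, act_comp, act_incl hc, hf, inv_mul_cancel_left₀ hs, act_id,
          if_neg hx]⟩
      exact isIso_of_mono_of_isSplitEpi f

theorem exists_iso_single (S : FibObj k u) [Simple S] : ∃ c, Nonempty (S ≅ single c) := by
  obtain ⟨s, hs⟩ : ∃ s, S.color s ≠ none := by
    by_contra! h
    exact id_nonzero S (hom_ext_live fun s t hl => absurd (h s) hl.2)
  obtain ⟨c, hc⟩ := Option.ne_none_iff_exists'.1 hs
  have : IsSplitMono (incl s c) := IsSplitMono.mk' ⟨proj s c, incl_proj hc⟩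
  have : IsIso (incl s c) := isIso_of_mono_of_nonzero fun h =>
    id_single_ne_zero (k := k) (u := u) c (by rw [← incl_proj hc, h, zero_comp])
  exact ⟨c, ⟨(asIso (incl s c)).symm⟩⟩

theorem exists_iso_biproduct (S : FibObj k u) :
    ∃ (n : ℕ) (κ : Fin n → Bool), Nonempty (S ≅ ⨁ fun i => (single (κ i) : FibObj k u)) := by
  let e := (Fintype.equivFin {s // S.color s ≠ none}).symm
  choose κ hκ using fun i => Option.ne_none_iff_exists'.1 (e i).2
  let b : Bicone fun i => (single (κ i) : FibObj k u) :=
    { pt := S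
      π := fun i => proj (e i).1 (κ i)
      ι := fun i => incl (e i).1 (κ i)
      ι_π := fun i j => by
        split_ifs with h
        · subst h
          exact incl_proj (hκ i)
        · refine hom_ext_act fun v x hx => ?_
          obtain rfl := eq_dot x
          rw [act_comp, act_incl (hκ i), act_proj (hκ j), if_neg]
          · simp [act]
          · exact fun h' => h (e.injective (Subtype.ext h')) }
  refine ⟨_, κ, ⟨biproduct.uniqueUpToIso _ (isBilimitOfTotal b ?_)⟩⟩
  refine hom_ext_act fun v s hs => ?_
  rw [act_sum, Finset.sum_eq_single (e.symm ⟨s, hs⟩)]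
  · rw [act_comp, act_proj (hκ _), act_incl (hκ _), act_id, if_neg hs]
    simp
  · intro i _ hi
    rw [act_comp, act_proj (hκ _), if_neg]
    rintro h
    exact hi (by rw [Equiv.eq_symm_apply]; exact Subtype.ext h.symm)
  · simp

variable [hu : Fact (u ^ 4 - u ^ 3 + u ^ 2 - u + 1 = 0)]

theorem isSimpleSystem : IsSimpleSystem ![𝟙_ (FibObj k u), single true] where
  simple i := by
    fin_cases i
    · exact inferInstanceAs (Simple (single false : FibObj k u))
    · exact inferInstanceAs (Simple (single true : FibObj k u))
  injective i j := by
    have key : ∀ c d : Bool, c ≠ d → ¬ Nonempty ((single c : FibObj k u) ≅ single d) :=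
      fun c d h ⟨f⟩ => id_single_ne_zero (k := k) (u := u) c (by
        rw [← f.hom_inv_id, hom_eq_zero_of_ne h f.hom, zero_comp])
    fin_cases i <;> fin_cases j <;> simp
    · exact ⟨fun f => key false true (by simp) ⟨f⟩⟩
    · exact ⟨fun f => key true false (by simp) ⟨f⟩⟩
  exhaustive S hS := by
    obtain ⟨c, hc⟩ := exists_iso_single S
    cases c
    · exact ⟨0, hc⟩
    · exact ⟨1, hc⟩

instance (S T : FibObj k u) : FiniteDimensional k (S ⟶ T) :=
  inferInstanceAs (FiniteDimensional k (homs S T))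

theorem semisimple : IsFinitelySemisimple k (FibObj k u) where
  finite_hom S T := inferInstance
  sum_of_simples S := by
    obtain ⟨n, κ, h⟩ := exists_iso_biproduct S
    exact ⟨n, _, fun i => inferInstance, h⟩
  finite_simples := ⟨2, _, isSimpleSystem⟩

/-- The morphism all of whose entries that may be non-zero are equal to one. -/
def ones (S T : FibObj k u) : S ⟶ T := hom fun _ _ => 1

/-- The simple object `X` of the matrix model. -/
abbrev tau : FibObj k u := single true

theorem act_ones_left (c : Bool) (v : (single c : FibObj k u).ι → k) (d : Bool) :
    act (ones (tau ⊗ tau) (single c)) v (pt dot dot d) = if d = c then v dot else 0 := by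
  change ∑ x, ent (ones (tensorObj tau tau) (single c)) (pt dot dot d) x * v x = _
  rw [sum_single]
  cases c <;> cases d <;> simp [ones, Live, fuse]

theorem act_ones_right (c : Bool) (v : (tau ⊗ tau : FibObj k u).ι → k) :
    act (ones (single c) (tau ⊗ tau)) v dot = v (pt dot dot c) := by
  change ∑ x, ent (ones (single c) (tensorObj tau tau)) dot x * v x = _
  rw [sum_tensorObj, sum_single, sum_single]
  cases c <;> simp [ones, Live, fuse]

end FibObj

/-! ### Structure constants and duals in the matrix model -/

namespace FibObj

variable {k : Type w} [Field k] {u : k}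

theorem ones_single (c : Bool) : ones (single c : FibObj k u) (single c) = 𝟙 _ := by
  refine hom_ext fun s t => ?_
  obtain rfl := eq_dot s
  obtain rfl := eq_dot t
  rw [ent_id, if_pos rfl]
  rfl

theorem act_add_hom {S T : FibObj k u} (f g : S ⟶ T) (v : T.ι → k) (s : S.ι) :
    act (f + g) v s = act f v s + act g v s := by
  simp [act, add_mul, Finset.sum_add_distrib]

theorem act_smul_hom (c : k) {S T : FibObj k u} (f : S ⟶ T) (v : T.ι → k) (s : S.ι) :
    act (c • f) v s = c * act f v s := by
  simp only [act, ent_smul, Finset.mul_sum, mul_assoc]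

theorem add_inv_eq (hu : u ^ 4 - u ^ 3 + u ^ 2 - u + 1 = 0) : u + u⁻¹ = u - u ^ 4 := by
  have := ne_zero_of_cyclotomic hu
  field_simp
  linear_combination (u + 1) * hu

/-- The coefficient of the coevaluation, which for the label `X` is the inverse `1 - a` of the entry
`-a` of the associativity matrix. -/
def coevCoeff (u : k) (x : Option Bool) : k := if x = some true then 1 - (u - u ^ 4) else 1

/-- The coefficient of the coevaluation cancels the entry of the associator in the zigzag
identities. -/
theorem coev_scalar (hu : u ^ 4 - u ^ 3 + u ^ 2 - u + 1 = 0) (x : Option Bool) (c : Bool)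
    (h : x = some c) : coevCoeff u x * sixj (u - u ^ 4) x x x c false false = 1 := by
  subst h
  cases c
  · simp [coevCoeff, sixj]
  · simp only [coevCoeff, sixj_true, sixjCore, if_true]
    linear_combination golden hu

variable [hu : Fact (u ^ 4 - u ^ 3 + u ^ 2 - u + 1 = 0)]

theorem ones_comp_ones (c d : Bool) :
    ones (single c) (tau ⊗ tau : FibObj k u) ≫ ones (tau ⊗ tau) (single d) =
      ones (single c) (single d) := by
  refine hom_ext_act fun v x hx => ?_
  obtain rfl := eq_dot x
  rw [act_comp, act_ones_right, act_ones_left, act, sum_single]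
  cases c <;> cases d <;> simp [ones, Live]

theorem ones_total :
    ones (tau ⊗ tau : FibObj k u) (single false) ≫ ones (single false) (tau ⊗ tau) +
    ones (tau ⊗ tau) tau ≫ ones tau (tau ⊗ tau) = 𝟙 _ := by
  refine hom_ext_act ?_
  intro v x hx
  obtain ⟨s, t, c, rfl⟩ := exists_pt x
  obtain rfl := eq_dot s
  obtain rfl := eq_dot t
  rw [act_add_hom, act_comp, act_comp, act_ones_left, act_ones_left, act_ones_right, act_ones_right,
    act_id, if_neg hx]
  cases c <;> simp

/-- The basis vector of `Hom(X ⊗ X, 𝟙)`. -/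
def cap : (tau ⊗ tau : FibObj k u) ⟶ 𝟙_ (FibObj k u) := ones _ (single false)

/-- The basis vector of `Hom(X ⊗ X, X)`. -/
def merge : (tau ⊗ tau : FibObj k u) ⟶ tau := ones _ tau

/-- The vector of `Hom(𝟙, X ⊗ X)` dual to `cap`. -/
def cup : 𝟙_ (FibObj k u) ⟶ tau ⊗ tau := ones (single false) _

/-- The vector of `Hom(X, X ⊗ X)` dual to `merge`. -/
def split : tau ⟶ (tau ⊗ tau : FibObj k u) := ones tau _

theorem isFibonacci : IsFibonacci k (FibObj k u) where
  semisimple := semisimple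
  fusion := by
    refine ⟨tau, isSimpleSystem, ⟨?_⟩⟩
    have h1 : cup ≫ cap = 𝟙 (𝟙_ (FibObj k u)) := (ones_comp_ones _ _).trans (ones_single _)
    have h2 : cup ≫ merge = (0 : 𝟙_ (FibObj k u) ⟶ tau) :=
      (ones_comp_ones _ _).trans (hom_eq_zero_of_ne Bool.false_ne_true _)
    have h3 : split ≫ cap = (0 : tau ⟶ 𝟙_ (FibObj k u)) :=
      (ones_comp_ones _ _).trans (hom_eq_zero_of_ne Bool.false_ne_true.symm _)
    have h4 : split ≫ merge = 𝟙 (tau : FibObj k u) := (ones_comp_ones _ _).trans (ones_single _)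
    have h5 : cap ≫ cup + merge ≫ split = 𝟙 (tau ⊗ tau : FibObj k u) := ones_total
    exact
      { hom := biprod.lift cap merge
        inv := biprod.desc cup split
        hom_inv_id := by rw [biprod.lift_desc, h5]
        inv_hom_id := by
          apply biprod.hom_ext' <;> apply biprod.hom_ext <;> simp [h1, h2, h3, h4] }

theorem act_merge (v : (tau : FibObj k u).ι → k) (d : Bool) :
    act merge v (pt dot dot d) = if d = true then v dot else 0 := act_ones_left true v d

theorem act_cap (v : (unitObj : FibObj k u).ι → k) (d : Bool) :
    act cap v (pt dot dot d) = if d = false then v star else 0 := act_ones_left false v d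

theorem merge_ne_zero : (merge : (tau ⊗ tau : FibObj k u) ⟶ tau) ≠ 0 := fun h =>
  id_single_ne_zero (k := k) (u := u) true (by
    have h' : ones (tau ⊗ tau : FibObj k u) tau = 0 := h
    rw [← ones_single, ← ones_comp_ones, h', comp_zero])

theorem cap_ne_zero : (cap : (tau ⊗ tau : FibObj k u) ⟶ 𝟙_ (FibObj k u)) ≠ 0 := fun h =>
  id_single_ne_zero (k := k) (u := u) false (by
    have h' : ones (tau ⊗ tau : FibObj k u) (single false) = 0 := h
    rw [← ones_single, ← ones_comp_ones, h', comp_zero])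

theorem color_tau₂ (d : Bool) : (tau ⊗ tau : FibObj k u).color (pt dot dot d) = some d := by
  cases d <;> rfl

theorem hom_ext_tau₂ {T : FibObj k u} {f g : tau ⊗ tau ⟶ T}
    (h : ∀ v d, act f v (pt dot dot d) = act g v (pt dot dot d)) : f = g := by
  refine hom_ext_act ?_
  intro v x _
  obtain ⟨s, t, d, rfl⟩ := exists_pt x
  exact h v d

theorem hom_ext_tau₃ {T : FibObj k u} {f g : (tau ⊗ tau) ⊗ tau ⟶ T} (h : ∀ v e d,
    act f v (pt (pt dot dot e) dot d) = act g v (pt (pt dot dot e) dot d)) : f = g := by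
  refine hom_ext_act ?_
  intro v x _
  obtain ⟨y, t, d, rfl⟩ := exists_pt x
  obtain ⟨s, s', e, rfl⟩ := exists_pt y
  exact h v e d

theorem hasFibonacciConstants : HasFibonacciConstants k (FibObj k u) u := by
  have key := golden hu.out
  have hα : (α_ (tau : FibObj k u) tau tau).hom = assocHom tau tau tau := rfl
  have hr : (ρ_ (tau : FibObj k u)).hom = rightUnitorHom tau := rfl
  have hl : (λ_ (tau : FibObj k u)).hom = leftUnitorHom tau := rfl
  have hβ : (β_ (tau : FibObj k u) tau).hom = braidHom tau tau := rfl
  refine ⟨tau, merge, cap, isSimpleSystem, merge_ne_zero, cap_ne_zero, ?_, ?_, ?_, ?_, ?_, ?_⟩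
  · refine hom_ext_tau₃ fun v e d => ?_
    rw [hα, whiskerRight_eq, whiskerLeft_eq]
    simp only [act_comp, act_tensorMap, act_assocHom, act_merge, act_cap, act_id, color_dot,
      color_tau₂]
    cases e <;> cases d <;> simp [fuse, sixj]
  · rw [hα, hr, add_inv_eq hu.out, whiskerRight_eq, whiskerLeft_eq, whiskerLeft_eq]
    refine hom_ext_tau₃ fun v e d => ?_
    rw [act_add_hom, act_smul_hom]
    simp only [act_comp, act_tensorMap, act_assocHom, act_merge, act_cap, act_id, color_dot,
      color_tau₂, act_rightUnitorHom]
    cases e <;> cases d <;> simp [fuse, sixj, sixjCore]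
    · ring
    · linear_combination (- v dot) * key
  · rw [hα, hr, hl, add_inv_eq hu.out, whiskerRight_eq, whiskerLeft_eq, whiskerLeft_eq]
    refine hom_ext_tau₃ fun v e d => ?_
    rw [act_add_hom, act_smul_hom, act_smul_hom]
    simp only [act_comp, act_tensorMap, act_assocHom, act_merge, act_cap, act_id, color_dot,
      color_tau₂, act_rightUnitorHom, act_leftUnitorHom]
    cases e <;> cases d <;> simp [fuse, sixj, sixjCore]
    · linear_combination (- v dot) * key
    · ring
  · rw [hβ]
    refine hom_ext_tau₂ fun v d => ?_
    simp only [act_smul_hom, act_comp, act_merge, act_braidHom]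
    cases d <;> simp [fuse, braid]
  · rw [hβ]
    refine hom_ext_tau₂ fun v d => ?_
    simp only [act_smul_hom, act_comp, act_cap, act_braidHom]
    cases d <;> simp [fuse, braid]
  · refine hom_ext_act fun v s hs => ?_
    change act (scalarHom tau (twist u)) v s = _
    obtain rfl := eq_dot s
    simp [act_scalarHom, act_smul_hom, act_id, twist]

/-- The evaluation that makes every object its own dual: `1` on each summand `𝟙` of the product of a
simple summand with itself. -/
def selfEval (S : FibObj k u) : S ⊗ S ⟶ 𝟙_ (FibObj k u) :=
  hom (S := tensorObj S S) (T := unitObj) fun x _ => if x.1 = x.2.1 then 1 else 0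

/-- The coevaluation that makes every object its own dual. -/
def selfCoeval (S : FibObj k u) : 𝟙_ (FibObj k u) ⟶ S ⊗ S :=
  hom (S := unitObj) (T := tensorObj S S) fun _ x =>
    if x.1 = x.2.1 then coevCoeff u (S.color x.1) else 0

theorem act_selfEval (S : FibObj k u) (v : (unitObj : FibObj k u).ι → k) (s t : S.ι) (c : Bool) :
    act (selfEval S) v (pt s t c) =
      if s = t ∧ c = false ∧ S.color s ≠ none then v star else 0 := by
  have key : ∀ i, ent (selfEval S) (pt s t c) i =
      if Live (fuse (S.color s) (S.color t) c) (some false) then if s = t then 1 else 0 else 0 :=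
    fun _ => rfl
  have : act (selfEval S) v (pt s t c) = ent (selfEval S) (pt s t c) star * v star :=
    sum_unitObj fun i => ent (selfEval S) (pt s t c) i * v i
  rw [this, key]
  by_cases hs : s = t
  · subst hs
    have : Live (fuse (S.color s) (S.color s) c) (some false) ↔ c = false ∧ S.color s ≠ none := by
      clear key this
      generalize S.color s = x; revert x c; unfold Live; decide
    simp [this]
  · simp [hs]

theorem act_selfCoeval (S : FibObj k u) (v : (S ⊗ S).ι → k) :
    act (selfCoeval S) v star =
      ∑ s, if S.color s = none then 0 else coevCoeff u (S.color s) * v (pt s s false) := by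
  have key : ∀ s t c, ent (selfCoeval S) star (pt s t c) =
      if Live (some false) (fuse (S.color s) (S.color t) c) then
        if s = t then coevCoeff u (S.color s) else 0 else 0 :=
    fun _ _ _ => rfl
  have h : act (selfCoeval S) v star = ∑ s, ∑ t, ∑ c, ent (selfCoeval S) star (pt s t c) *
      v (pt s t c) := sum_tensorObj fun x => ent (selfCoeval S) star x * v x
  rw [h]
  refine Finset.sum_congr rfl fun s _ => ?_
  rw [Finset.sum_eq_single s, Finset.sum_eq_single false]
  · have : Live (some false) (fuse (S.color s) (S.color s) false) ↔ S.color s ≠ none := by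
      clear key h
      generalize S.color s = x; revert x; unfold Live; decide
    simp only [key, this]
    by_cases hs : S.color s = none <;> simp [hs]
  · intro c _ hc
    have : ¬ Live (some false) (fuse (S.color s) (S.color s) c) := by
      clear key h
      generalize S.color s = x; revert x c; unfold Live; decide
    rw [key, if_neg this, zero_mul]
  · simp
  · intro t _ ht
    simp [key, ht.symm]
  · simp

theorem act_whisker_left (S : FibObj k u) {T T' : FibObj k u} (f : T ⟶ T') (v : (S ⊗ T').ι → k)
    (s : S.ι) (t : T.ι) (c : Bool) (h : fuse (S.color s) (T.color t) c ≠ none) :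
    act (S ◁ f) v (pt s t c) = act f (fun t' => v (pt s t' c)) t := by
  rw [whiskerLeft_eq]
  refine (act_tensorMap _ _ v s t c).trans ?_
  rw [if_neg h, act_id, if_neg (fuse_left_ne_none h)]

theorem act_whisker_right {S S' : FibObj k u} (f : S ⟶ S') (T : FibObj k u) (v : (S' ⊗ T).ι → k)
    (s : S.ι) (t : T.ι) (c : Bool) (h : fuse (S.color s) (T.color t) c ≠ none) :
    act (f ▷ T) v (pt s t c) = act f (fun s' => v (pt s' t c)) s := by
  rw [whiskerRight_eq]
  refine (act_tensorMap _ _ v s t c).trans ?_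
  rw [if_neg h]
  refine act_congr f fun s' _ _ => ?_
  rw [act_id, if_neg (fuse_right_ne_none h)]

theorem fuse_self_false {x : Option Bool} (h : x ≠ none) : fuse x x false = some false := by
  revert x; decide

theorem fuse_unit_right {x : Option Bool} {c : Bool} (h : fuse x (some false) c ≠ none) :
    x = some c := by
  revert x c; decide

theorem fuse_unit_left {x : Option Bool} {c : Bool} (h : fuse (some false) x c ≠ none) :
    x = some c := by
  revert x c; decide

/-- Only one of the indices that the coevaluation creates survives the evaluation. -/
theorem act_zigzag_left (S : FibObj k u) (v : (𝟙_ (FibObj k u) ⊗ S).ι → k) {s s' : S.ι} {c : Bool}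
    (hc : S.color s = some c) (hs' : S.color s' ≠ none) :
    act ((α_ S S S).inv ≫ selfEval S ▷ S) v (pt s (pt s' s' false) c) =
      if s' = s then sixj (u - u ^ 4) (S.color s) (S.color s) (S.color s) c false false *
        v (pt star s c) else 0 := by
  have hl : fuse (some c) (some false) c ≠ none := by cases c <;> decide
  have hl' : fuse (some false) (some c) c ≠ none := by cases c <;> decide
  rw [act_comp]
  refine (act_assocInv S S S _ s s' s' false c).trans ?_
  have h (e) (he : fuse (fuse (S.color s) (S.color s') e) (S.color s') c ≠ none) :
      act (selfEval S ▷ S) v (pt (pt s s' e) s' c) =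
        if s = s' ∧ e = false ∧ S.color s ≠ none then v (pt star s' c) else 0 := by
    rw [act_whisker_right _ _ _ _ _ _ he, act_selfEval]
  rw [fuse_self_false hs', hc, if_neg hl, Finset.sum_eq_single false]
  · by_cases hs : s' = s
    · subst hs
      rw [← hc, h false, fuse_self_false hs', hc, if_neg hl', if_pos rfl, if_pos (by simp)]
      rw [fuse_self_false hs', hc]
      exact hl'
    · rw [if_neg hs, ite_eq_left_iff, ← hc]
      intro he
      rw [h _ he, if_neg fun h => hs h.1.symm, mul_zero]
  · intro e _ he
    rw [ite_eq_left_iff, ← hc]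
    intro hf
    rw [h _ hf, if_neg fun h => he h.2.1, mul_zero]
  · simp

/-- The mirror image of `act_zigzag_left`. -/
theorem act_zigzag_right (S : FibObj k u) (v : (S ⊗ 𝟙_ (FibObj k u)).ι → k) {s s' : S.ι} {c : Bool}
    (hc : S.color s = some c) (hs' : S.color s' ≠ none) :
    act ((α_ S S S).hom ≫ S ◁ selfEval S) v (pt (pt s' s' false) s c) =
      if s' = s then sixj (u - u ^ 4) (S.color s) (S.color s) (S.color s) c false false *
        v (pt s star c) else 0 := by
  have hl : fuse (some c) (some false) c ≠ none := by cases c <;> decide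
  have hl' : fuse (some false) (some c) c ≠ none := by cases c <;> decide
  rw [act_comp]
  refine (act_assocHom S S S _ s' s' s false c).trans ?_
  have h (e) (he : fuse (S.color s') (fuse (S.color s') (S.color s) e) c ≠ none) :
      act (S ◁ selfEval S) v (pt s' (pt s' s e) c) =
        if s' = s ∧ e = false ∧ S.color s' ≠ none then v (pt s' star c) else 0 := by
    rw [act_whisker_left _ _ _ _ _ _ he, act_selfEval]
  rw [fuse_self_false hs', hc, if_neg hl', Finset.sum_eq_single false]
  · by_cases hs : s' = s
    · subst hs
      rw [← hc, h false, fuse_self_false hs', hc, if_neg hl, if_pos rfl, if_pos (by simp)]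
      rw [fuse_self_false hs', hc]
      exact hl
    · rw [if_neg hs, ite_eq_left_iff, ← hc]
      intro he
      rw [h _ he, if_neg fun h => hs h.1, mul_zero]
  · intro e _ he
    rw [ite_eq_left_iff, ← hc]
    intro hf
    rw [h _ hf, if_neg fun h => he h.2.1, mul_zero]
  · simp

instance (S : FibObj k u) : ExactPairing S S where
  evaluation' := selfEval S
  coevaluation' := selfCoeval S
  coevaluation_evaluation' := by
    refine hom_ext_act ?_
    intro v x hl
    obtain ⟨s, i, c, rfl⟩ := exists_pt x
    obtain rfl : i = star := rfl
    have hl : fuse (S.color s) (some false) c ≠ none := hl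
    have hc : S.color s = some c := fuse_unit_right hl
    have hr : (ρ_ S).hom = rightUnitorHom S := rfl
    have hi : (λ_ S).inv = leftUnitorInv S := rfl
    rw [act_comp, act_whisker_left _ _ _ _ _ _ hl, act_selfCoeval, hr, hi, act_comp]
    refine Eq.trans ?_ (Eq.symm (act_rightUnitorHom S _ s c))
    rw [if_pos hc, act_leftUnitorInv, Finset.sum_eq_single c, if_pos hc, Finset.sum_eq_single s]
    · rw [act_zigzag_left S v hc (by simp [hc]), if_pos rfl, if_neg (by simp [hc]), ← mul_assoc,
        coev_scalar hu.out _ _ hc, one_mul]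
    · intro s' _ hs'
      by_cases h : S.color s' = none
      · rw [if_pos h]
      · rw [if_neg h, act_zigzag_left S v hc h, if_neg hs', mul_zero]
    · simp
    · intro b _ hb
      rw [if_neg]
      rw [hc]
      exact fun h => hb (Option.some_injective _ h.symm)
    · simp
  evaluation_coevaluation' := by
    refine hom_ext_act ?_
    intro v x hl
    obtain ⟨i, s, c, rfl⟩ := exists_pt x
    obtain rfl : i = star := rfl
    have hl : fuse (some false) (S.color s) c ≠ none := hl
    have hc : S.color s = some c := fuse_unit_left hl
    have hr : (λ_ S).hom = leftUnitorHom S := rfl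
    have hi : (ρ_ S).inv = rightUnitorInv S := rfl
    rw [act_comp, act_whisker_right _ _ _ _ _ _ hl, act_selfCoeval, hr, hi, act_comp]
    refine Eq.trans ?_ (Eq.symm (act_leftUnitorHom S _ s c))
    rw [if_pos hc, act_rightUnitorInv, Finset.sum_eq_single c, if_pos hc, Finset.sum_eq_single s]
    · rw [act_zigzag_right S v hc (by simp [hc]), if_pos rfl, if_neg (by simp [hc]), ← mul_assoc,
        coev_scalar hu.out _ _ hc, one_mul]
    · intro s' _ hs'
      by_cases h : S.color s' = none
      · rw [if_pos h]
      · rw [if_neg h, act_zigzag_right S v hc h, if_neg hs', mul_zero]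
    · simp
    · intro b _ hb
      rw [if_neg]
      rw [hc]
      exact fun h => hb (Option.some_injective _ h.symm)
    · simp

instance : RigidCategory (FibObj k u) where
  leftDual S := ⟨S⟩
  rightDual S := ⟨S⟩

end FibObj

/-- The Fibonacci category with parameter `u`, for a root `u` of the tenth cyclotomic polynomial. -/
def fibCategory (k : Type w) [Field k] (u : k) [Fact (u ^ 4 - u ^ 3 + u ^ 2 - u + 1 = 0)] :
    BalancedFibonacci.{w, w, w + 1} k where
  carrier := FibObj k u
  isFibonacci := FibObj.isFibonacci

/-! ### The twist -/

section Twist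

variable {C : Type u} [Category.{v} C] [MonoidalCategory C] [BraidedCategory C] [Balanced C]

theorem θ_naturality {Y Z : C} (f : Y ⟶ Z) : f ≫ θ Z = θ Y ≫ f := Balanced.twist_naturality f

theorem twist_unit : θ (𝟙_ C) = 𝟙 (𝟙_ C) := by
  have nat : (λ_ (𝟙_ C)).hom ≫ θ (𝟙_ C) = θ (𝟙_ C ⊗ 𝟙_ C) ≫ (λ_ (𝟙_ C)).hom :=
    Balanced.twist_naturality _
  have tens : θ (𝟙_ C ⊗ 𝟙_ C) =
      (θ (𝟙_ C) ⊗ₘ θ (𝟙_ C)) ≫ (β_ (𝟙_ C) (𝟙_ C)).hom ≫ (β_ (𝟙_ C) (𝟙_ C)).hom :=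
    Balanced.twist_tensor _ _
  have e : (β_ (𝟙_ C) (𝟙_ C)).hom = 𝟙 _ := by
    rw [braiding_tensorUnit_left, unitors_equal, Iso.hom_inv_id]
  rw [tens, e, MonoidalCategory.tensorHom_def, Category.comp_id, Category.comp_id, Category.assoc,
    leftUnitor_naturality, unitors_equal, rightUnitor_naturality_assoc, cancel_epi] at nat
  have : IsIso (θ (𝟙_ C)) := inferInstanceAs (IsIso (Balanced.twist (𝟙_ C)).hom)
  rw [← cancel_epi (θ (𝟙_ C)), ← nat, Category.comp_id]

end Twist

/-! ### The pentagon identity on trees -/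

section Pentagon

variable {C : Type u} [Category.{v} C] [MonoidalCategory C] {X : C}

theorem tensor_left_exchange (f : X ⊗ X ⟶ X) (g : X ⊗ X ⟶ X) {Z : C} (h : X ⊗ X ⟶ Z) :
    f ▷ X ▷ X ≫ (α_ X X X).hom ≫ X ◁ g ≫ h =
      (α_ (X ⊗ X) X X).hom ≫ (X ⊗ X) ◁ g ≫ f ▷ X ≫ h := by
  rw [associator_naturality_left_assoc, ← whisker_exchange_assoc]

theorem tensor_left_exchange_unit (f : X ⊗ X ⟶ X) (g : X ⊗ X ⟶ 𝟙_ C) :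
    f ▷ X ▷ X ≫ (α_ X X X).hom ≫ X ◁ g ≫ (ρ_ X).hom =
      (α_ (X ⊗ X) X X).hom ≫ (α_ X X (X ⊗ X)).hom ≫ X ◁ X ◁ g ≫ X ◁ (ρ_ X).hom ≫ f := by
  rw [associator_naturality_left_assoc, ← whisker_exchange_assoc]
  simp

theorem tensor_right_assoc {Y Z W : C} (f : X ⊗ X ⟶ Y) (g : X ⊗ Y ⟶ Z) (h : X ⊗ Z ⟶ W) :
    (X ⊗ X) ◁ f ≫ (α_ X X Y).hom ≫ X ◁ g ≫ h =
      (α_ X X (X ⊗ X)).hom ≫ X ◁ X ◁ f ≫ X ◁ g ≫ h := by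
  simp

theorem middle_assoc {Y Z W : C} (f : X ⊗ X ⟶ Y) (g : Y ⊗ X ⟶ Z) (h : X ⊗ Z ⟶ W) :
    (X ◁ f) ▷ X ≫ (α_ X Y X).hom ≫ X ◁ g ≫ h =
      (α_ X (X ⊗ X) X).hom ≫ X ◁ (f ▷ X ≫ g) ≫ h := by
  simp

theorem middle_unit_assoc {W : C} (f : X ⊗ X ⟶ 𝟙_ C) (h : X ⊗ X ⟶ W) :
    (X ◁ f) ▷ X ≫ (ρ_ X).hom ▷ X ≫ h =
      (α_ X (X ⊗ X) X).hom ≫ X ◁ (f ▷ X ≫ (λ_ X).hom) ≫ h := by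
  rw [← MonoidalCategory.triangle, Category.assoc, middle_assoc]

variable {k : Type w} [Field k] [Preadditive C] [Linear k C] [MonoidalPreadditive C]
  [MonoidalLinear k C]

/-- The associator of `X` in the bases of trees: it is `b` on `Hom(X ⊗ X ⊗ X, 𝟙)` and the matrix
`(x, y; z, w)` on `Hom(X ⊗ X ⊗ X, X)`. -/
structure TreeRelations (p : X ⊗ X ⟶ X) (q : X ⊗ X ⟶ 𝟙_ C) (b x y z w : k) : Prop where
  unit : p ▷ X ≫ q = b • ((α_ X X X).hom ≫ X ◁ p ≫ q)
  left : p ▷ X ≫ p = x • ((α_ X X X).hom ≫ X ◁ p ≫ p) +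
    y • ((α_ X X X).hom ≫ X ◁ q ≫ (ρ_ X).hom)
  right : q ▷ X ≫ (λ_ X).hom = z • ((α_ X X X).hom ≫ X ◁ p ≫ p) +
    w • ((α_ X X X).hom ≫ X ◁ q ≫ (ρ_ X).hom)

variable {p : X ⊗ X ⟶ X} {q : X ⊗ X ⟶ 𝟙_ C} {b x y z w : k}

namespace TreeRelations

/-- The trees on four factors that begin with `(X ⊗ p) ⊗ X`, expanded in right trees: one side of
the pentagon passes through them. -/
theorem middle_left (H : TreeRelations p q b x y z w) :
    (X ◁ p) ▷ X ≫ p ▷ X ≫ p = (α_ X (X ⊗ X) X).hom ≫ X ◁ (α_ X X X).hom ≫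
      ((x * x) • (X ◁ X ◁ p ≫ X ◁ p ≫ p) + (x * y) • (X ◁ X ◁ q ≫ X ◁ (ρ_ X).hom ≫ p) +
        (y * b) • (X ◁ X ◁ p ≫ X ◁ q ≫ (ρ_ X).hom)) := by
  rw [H.left, Preadditive.comp_add, Linear.comp_smul, Linear.comp_smul, middle_assoc, middle_assoc,
    H.left, H.unit]
  simp only [MonoidalPreadditive.whiskerLeft_add, MonoidalLinear.whiskerLeft_smul,
    Preadditive.add_comp, Linear.smul_comp, whiskerLeft_comp, Category.assoc,
    Preadditive.comp_add, Linear.comp_smul]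
  module

theorem middle_unit (H : TreeRelations p q b x y z w) :
    (X ◁ p) ▷ X ≫ p ▷ X ≫ q = (α_ X (X ⊗ X) X).hom ≫ X ◁ (α_ X X X).hom ≫
      ((b * x) • (X ◁ X ◁ p ≫ X ◁ p ≫ q) + (b * y) • (X ◁ X ◁ q ≫ X ◁ (ρ_ X).hom ≫ q)) := by
  rw [H.unit, Linear.comp_smul, middle_assoc, H.left]
  simp only [MonoidalPreadditive.whiskerLeft_add, MonoidalLinear.whiskerLeft_smul,
    Preadditive.add_comp, Linear.smul_comp, whiskerLeft_comp, Category.assoc,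
    Preadditive.comp_add, Linear.comp_smul]
  module

theorem middle_right (H : TreeRelations p q b x y z w) :
    (X ◁ p) ▷ X ≫ q ▷ X ≫ (λ_ X).hom = (α_ X (X ⊗ X) X).hom ≫ X ◁ (α_ X X X).hom ≫
      ((z * x) • (X ◁ X ◁ p ≫ X ◁ p ≫ p) + (z * y) • (X ◁ X ◁ q ≫ X ◁ (ρ_ X).hom ≫ p) +
        (w * b) • (X ◁ X ◁ p ≫ X ◁ q ≫ (ρ_ X).hom)) := by
  rw [H.right, Preadditive.comp_add, Linear.comp_smul, Linear.comp_smul, middle_assoc, middle_assoc,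
    H.left, H.unit]
  simp only [MonoidalPreadditive.whiskerLeft_add, MonoidalLinear.whiskerLeft_smul,
    Preadditive.add_comp, Linear.smul_comp, whiskerLeft_comp, Category.assoc,
    Preadditive.comp_add, Linear.comp_smul]
  module

theorem middle_cap (H : TreeRelations p q b x y z w) {Z : C} (h : X ⊗ X ⟶ Z) :
    (X ◁ q) ▷ X ≫ (ρ_ X).hom ▷ X ≫ h = (α_ X (X ⊗ X) X).hom ≫ X ◁ (α_ X X X).hom ≫
      (z • (X ◁ X ◁ p ≫ X ◁ p ≫ h) + w • (X ◁ X ◁ q ≫ X ◁ (ρ_ X).hom ≫ h)) := by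
  rw [middle_unit_assoc, H.right]
  simp only [MonoidalPreadditive.whiskerLeft_add, MonoidalLinear.whiskerLeft_smul,
    Preadditive.add_comp, Linear.smul_comp, whiskerLeft_comp, Category.assoc,
    Preadditive.comp_add, Linear.comp_smul]

/-- The pentagon identity on the tree `((p ⊗ X) ⊗ X) (p ⊗ X) p`. -/
theorem pentagon_left (H : TreeRelations p q b x y z w) :
    (x * x) • (X ◁ X ◁ p ≫ X ◁ p ≫ p) + (x * y) • (X ◁ X ◁ p ≫ X ◁ q ≫ (ρ_ X).hom) +
      y • (X ◁ X ◁ q ≫ X ◁ (ρ_ X).hom ≫ p) =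
    (x * x * x + y * z) • (X ◁ X ◁ p ≫ X ◁ p ≫ p) +
      (x * y * b) • (X ◁ X ◁ p ≫ X ◁ q ≫ (ρ_ X).hom) +
      (x * x * y + y * w) • (X ◁ X ◁ q ≫ X ◁ (ρ_ X).hom ≫ p) := by
  have upper : p ▷ X ▷ X ≫ p ▷ X ≫ p = (α_ (X ⊗ X) X X).hom ≫ (α_ X X (X ⊗ X)).hom ≫
      ((x * x) • (X ◁ X ◁ p ≫ X ◁ p ≫ p) + (x * y) • (X ◁ X ◁ p ≫ X ◁ q ≫ (ρ_ X).hom) +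
      y • (X ◁ X ◁ q ≫ X ◁ (ρ_ X).hom ≫ p)) := by
    rw [H.left, Preadditive.comp_add, Linear.comp_smul, Linear.comp_smul, tensor_left_exchange,
      H.left, tensor_left_exchange_unit]
    simp only [Preadditive.comp_add, Linear.comp_smul, tensor_right_assoc]
    module
  have lower : p ▷ X ▷ X ≫ p ▷ X ≫ p = ((α_ X X X).hom ▷ X ≫ (α_ X (X ⊗ X) X).hom ≫
      X ◁ (α_ X X X).hom) ≫ ((x * x * x + y * z) • (X ◁ X ◁ p ≫ X ◁ p ≫ p) +
      (x * y * b) • (X ◁ X ◁ p ≫ X ◁ q ≫ (ρ_ X).hom) +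
      (x * x * y + y * w) • (X ◁ X ◁ q ≫ X ◁ (ρ_ X).hom ≫ p)) := by
    rw [← comp_whiskerRight_assoc, H.left]
    simp only [MonoidalPreadditive.add_whiskerRight, MonoidalLinear.smul_whiskerRight,
      Preadditive.add_comp, Linear.smul_comp, comp_whiskerRight, Category.assoc, H.middle_left,
      H.middle_cap, Preadditive.comp_add, Linear.comp_smul]
    module
  rw [MonoidalCategory.pentagon, Category.assoc, upper] at lower
  exact (cancel_epi _).1 ((cancel_epi _).1 lower)

/-- The pentagon identity on the tree `((p ⊗ X) ⊗ X) (q ⊗ X)`. -/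
theorem pentagon_right (H : TreeRelations p q b x y z w) :
    (z * x) • (X ◁ X ◁ p ≫ X ◁ p ≫ p) + (z * y) • (X ◁ X ◁ p ≫ X ◁ q ≫ (ρ_ X).hom) +
      w • (X ◁ X ◁ q ≫ X ◁ (ρ_ X).hom ≫ p) =
    (b * z * x) • (X ◁ X ◁ p ≫ X ◁ p ≫ p) +
      (b * w * b) • (X ◁ X ◁ p ≫ X ◁ q ≫ (ρ_ X).hom) +
      (b * z * y) • (X ◁ X ◁ q ≫ X ◁ (ρ_ X).hom ≫ p) := by
  have upper : p ▷ X ▷ X ≫ q ▷ X ≫ (λ_ X).hom = (α_ (X ⊗ X) X X).hom ≫ (α_ X X (X ⊗ X)).hom ≫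
      ((z * x) • (X ◁ X ◁ p ≫ X ◁ p ≫ p) + (z * y) • (X ◁ X ◁ p ≫ X ◁ q ≫ (ρ_ X).hom) +
      w • (X ◁ X ◁ q ≫ X ◁ (ρ_ X).hom ≫ p)) := by
    rw [H.right, Preadditive.comp_add, Linear.comp_smul, Linear.comp_smul, tensor_left_exchange,
      H.left, tensor_left_exchange_unit]
    simp only [Preadditive.comp_add, Linear.comp_smul, tensor_right_assoc]
    module
  have lower : p ▷ X ▷ X ≫ q ▷ X ≫ (λ_ X).hom = ((α_ X X X).hom ▷ X ≫ (α_ X (X ⊗ X) X).hom ≫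
      X ◁ (α_ X X X).hom) ≫ ((b * z * x) • (X ◁ X ◁ p ≫ X ◁ p ≫ p) +
      (b * w * b) • (X ◁ X ◁ p ≫ X ◁ q ≫ (ρ_ X).hom) +
      (b * z * y) • (X ◁ X ◁ q ≫ X ◁ (ρ_ X).hom ≫ p)) := by
    rw [← comp_whiskerRight_assoc, H.unit]
    simp only [MonoidalLinear.smul_whiskerRight,
      Linear.smul_comp, comp_whiskerRight, Category.assoc, H.middle_right,
      Preadditive.comp_add, Linear.comp_smul]
    module
  rw [MonoidalCategory.pentagon, Category.assoc, upper] at lower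
  exact (cancel_epi _).1 ((cancel_epi _).1 lower)

/-- The pentagon identity on the tree `((p ⊗ X) ⊗ X) (p ⊗ X) q`. -/
theorem pentagon_unit (H : TreeRelations p q b x y z w) :
    (b * b) • (X ◁ X ◁ p ≫ X ◁ p ≫ q) =
      (x * b * x + y * z) • (X ◁ X ◁ p ≫ X ◁ p ≫ q) +
        (x * b * y + y * w) • (X ◁ X ◁ q ≫ X ◁ (ρ_ X).hom ≫ q) := by
  have upper : p ▷ X ▷ X ≫ p ▷ X ≫ q = (α_ (X ⊗ X) X X).hom ≫ (α_ X X (X ⊗ X)).hom ≫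
      ((b * b) • (X ◁ X ◁ p ≫ X ◁ p ≫ q)) := by
    rw [H.unit, Linear.comp_smul, tensor_left_exchange, H.unit]
    simp only [Linear.comp_smul, tensor_right_assoc]
    module
  have lower : p ▷ X ▷ X ≫ p ▷ X ≫ q = ((α_ X X X).hom ▷ X ≫ (α_ X (X ⊗ X) X).hom ≫
      X ◁ (α_ X X X).hom) ≫ ((x * b * x + y * z) • (X ◁ X ◁ p ≫ X ◁ p ≫ q) +
        (x * b * y + y * w) • (X ◁ X ◁ q ≫ X ◁ (ρ_ X).hom ≫ q)) := by
    rw [← comp_whiskerRight_assoc, H.left]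
    simp only [MonoidalPreadditive.add_whiskerRight, MonoidalLinear.smul_whiskerRight,
      Preadditive.add_comp, Linear.smul_comp, comp_whiskerRight, Category.assoc, H.middle_unit,
      H.middle_cap, Preadditive.comp_add, Linear.comp_smul]
    module
  rw [MonoidalCategory.pentagon, Category.assoc, upper] at lower
  exact (cancel_epi _).1 ((cancel_epi _).1 lower)

end TreeRelations

end Pentagon

/-! ### The solutions of the pentagon and hexagon equations -/

section FusionBasis

variable {C : Type u} [Category.{v} C] [MonoidalCategory C] [Preadditive C] {X : C}

/-- Morphisms `p`, `q`, `i`, `j` that exhibit `X ⊗ X` as a biproduct of `X` and `𝟙`. -/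
structure FusionBasis (p : X ⊗ X ⟶ X) (q : X ⊗ X ⟶ 𝟙_ C) (i : X ⟶ X ⊗ X) (j : 𝟙_ C ⟶ X ⊗ X) :
    Prop where
  i_p : i ≫ p = 𝟙 X
  j_q : j ≫ q = 𝟙 (𝟙_ C)
  i_q : i ≫ q = 0
  j_p : j ≫ p = 0
  total : p ≫ i + q ≫ j = 𝟙 (X ⊗ X)

/-- The consequences of Schur's lemma for the unit object and a second simple object `X`. -/
structure SimplePair (k : Type w) [Field k] [Linear k C] (X : C) : Prop where
  end_unit : ∀ f : 𝟙_ C ⟶ 𝟙_ C, ∃ c : k, f = c • 𝟙 (𝟙_ C)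
  end_obj : ∀ f : X ⟶ X, ∃ c : k, f = c • 𝟙 X
  to_unit : ∀ f : X ⟶ 𝟙_ C, f = 0
  of_unit : ∀ f : 𝟙_ C ⟶ X, f = 0
  unit_ne : 𝟙 (𝟙_ C) ≠ 0
  obj_ne : 𝟙 X ≠ 0

variable {k : Type w} [Field k] [Linear k C]
  {p : X ⊗ X ⟶ X} {q : X ⊗ X ⟶ 𝟙_ C} {i : X ⟶ X ⊗ X} {j : 𝟙_ C ⟶ X ⊗ X}

namespace FusionBasis

theorem scale_unit (B : FusionBasis p q i j) {c : k} (hc : c ≠ 0) :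
    FusionBasis p (c • q) i (c⁻¹ • j) where
  i_p := B.i_p
  j_q := by simp [B.j_q, hc]
  i_q := by simp [B.i_q]
  j_p := by simp [B.j_p]
  total := by simpa [hc] using B.total

/-- Morphisms out of `X ⊗ X` are equal if they agree on both summands. -/
theorem eq_of (B : FusionBasis p q i j) {Y : C} {f g : X ⊗ X ⟶ Y} (h : i ≫ f = i ≫ g)
    (h' : j ≫ f = j ≫ g) : f = g := by
  rw [← Category.id_comp f, ← Category.id_comp g, ← B.total, Preadditive.add_comp,
    Preadditive.add_comp, Category.assoc, Category.assoc, Category.assoc, Category.assoc, h, h']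

theorem exists_smul_p (B : FusionBasis p q i j) (S : SimplePair k X) (f : X ⊗ X ⟶ X) :
    ∃ c : k, f = c • p := by
  obtain ⟨c, hc⟩ := S.end_obj (i ≫ f)
  refine ⟨c, B.eq_of ?_ ?_⟩
  · rw [hc, Linear.comp_smul, B.i_p]
  · rw [S.of_unit (j ≫ f), Linear.comp_smul, B.j_p, smul_zero]

theorem exists_smul_q (B : FusionBasis p q i j) (S : SimplePair k X) (f : X ⊗ X ⟶ 𝟙_ C) :
    ∃ c : k, f = c • q := by
  obtain ⟨c, hc⟩ := S.end_unit (j ≫ f)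
  refine ⟨c, B.eq_of ?_ ?_⟩
  · rw [S.to_unit (i ≫ f), Linear.comp_smul, B.i_q, smul_zero]
  · rw [hc, Linear.comp_smul, B.j_q]

theorem smul_p (B : FusionBasis p q i j) (S : SimplePair k X) {c d : k} (h : c • p = d • p) :
    c = d := by
  have := congrArg (i ≫ ·) h
  simp only [Linear.comp_smul, B.i_p] at this
  exact smul_left_injective k S.obj_ne this

theorem smul_q (B : FusionBasis p q i j) (S : SimplePair k X) {c d : k} (h : c • q = d • q) :
    c = d := by
  have := congrArg (j ≫ ·) h
  simp only [Linear.comp_smul, B.j_q] at this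
  exact smul_left_injective k S.unit_ne this

variable [MonoidalPreadditive C] [MonoidalLinear k C]

theorem whiskerLeft_total (B : FusionBasis p q i j) (Y : C) :
    Y ◁ p ≫ Y ◁ i + Y ◁ q ≫ Y ◁ j = 𝟙 (Y ⊗ X ⊗ X) := by
  rw [← whiskerLeft_comp, ← whiskerLeft_comp, ← MonoidalPreadditive.whiskerLeft_add, B.total,
    whiskerLeft_id]

theorem whiskerLeft_i_p (B : FusionBasis p q i j) (Y : C) {Z : C} (h : Y ⊗ X ⟶ Z) :
    Y ◁ i ≫ Y ◁ p ≫ h = h := by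
  rw [← whiskerLeft_comp_assoc, B.i_p, whiskerLeft_id, Category.id_comp]

theorem whiskerLeft_j_q (B : FusionBasis p q i j) (Y : C) {Z : C} (h : Y ⊗ 𝟙_ C ⟶ Z) :
    Y ◁ j ≫ Y ◁ q ≫ h = h := by
  rw [← whiskerLeft_comp_assoc, B.j_q, whiskerLeft_id, Category.id_comp]

theorem whiskerLeft_i_q (B : FusionBasis p q i j) (Y : C) {Z : C} (h : Y ⊗ 𝟙_ C ⟶ Z) :
    Y ◁ i ≫ Y ◁ q ≫ h = 0 := by
  rw [← whiskerLeft_comp_assoc, B.i_q, MonoidalPreadditive.whiskerLeft_zero, zero_comp]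

theorem whiskerLeft_j_p (B : FusionBasis p q i j) (Y : C) {Z : C} (h : Y ⊗ X ⟶ Z) :
    Y ◁ j ≫ Y ◁ p ≫ h = 0 := by
  rw [← whiskerLeft_comp_assoc, B.j_p, MonoidalPreadditive.whiskerLeft_zero, zero_comp]

/-- The right trees span `Hom(X ⊗ X ⊗ X, X)`. -/
theorem exists_right_trees (B : FusionBasis p q i j) (S : SimplePair k X) (f : X ⊗ X ⊗ X ⟶ X) :
    ∃ c d : k, f = c • (X ◁ p ≫ p) + d • (X ◁ q ≫ (ρ_ X).hom) := by
  obtain ⟨c, hc⟩ := B.exists_smul_p S (X ◁ i ≫ f)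
  obtain ⟨d, hd⟩ := S.end_obj ((ρ_ X).inv ≫ X ◁ j ≫ f)
  refine ⟨c, d, ?_⟩
  rw [Iso.inv_comp_eq, Linear.comp_smul, Category.comp_id] at hd
  rw [← Category.id_comp f, ← B.whiskerLeft_total X, Preadditive.add_comp, Category.assoc,
    Category.assoc, hc, hd, Linear.comp_smul, Linear.comp_smul]

/-- The right tree spans `Hom(X ⊗ X ⊗ X, 𝟙)`. -/
theorem exists_right_tree_unit (B : FusionBasis p q i j) (S : SimplePair k X)
    (f : X ⊗ X ⊗ X ⟶ 𝟙_ C) : ∃ c : k, f = c • (X ◁ p ≫ q) := by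
  obtain ⟨c, hc⟩ := B.exists_smul_q S (X ◁ i ≫ f)
  have hd := S.to_unit ((ρ_ X).inv ≫ X ◁ j ≫ f)
  refine ⟨c, ?_⟩
  rw [Iso.inv_comp_eq, comp_zero] at hd
  rw [← Category.id_comp f, ← B.whiskerLeft_total X, Preadditive.add_comp, Category.assoc,
    Category.assoc, hc, hd, Linear.comp_smul, comp_zero, add_zero]

theorem exists_treeRelations (B : FusionBasis p q i j) (S : SimplePair k X) :
    ∃ b x y z w : k, TreeRelations p q b x y z w := by
  obtain ⟨b, hb⟩ := B.exists_right_tree_unit S ((α_ X X X).inv ≫ p ▷ X ≫ q)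
  obtain ⟨x, y, hx⟩ := B.exists_right_trees S ((α_ X X X).inv ≫ p ▷ X ≫ p)
  obtain ⟨z, w, hz⟩ := B.exists_right_trees S ((α_ X X X).inv ≫ q ▷ X ≫ (λ_ X).hom)
  rw [Iso.inv_comp_eq] at hb hx hz
  refine ⟨b, x, y, z, w, ?_, ?_, ?_⟩
  · rw [hb, Linear.comp_smul]
  · rw [hx, Preadditive.comp_add, Linear.comp_smul, Linear.comp_smul]
  · rw [hz, Preadditive.comp_add, Linear.comp_smul, Linear.comp_smul]

theorem right_trees_independent (B : FusionBasis p q i j) (S : SimplePair k X) {c d c' d' : k}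
    (h : c • (X ◁ p ≫ p) + d • (X ◁ q ≫ (ρ_ X).hom) =
      c' • (X ◁ p ≫ p) + d' • (X ◁ q ≫ (ρ_ X).hom)) : c = c' ∧ d = d' := by
  constructor
  · have := congrArg (X ◁ i ≫ ·) h
    simp only [Preadditive.comp_add, Linear.comp_smul, B.whiskerLeft_i_p, B.whiskerLeft_i_q,
      smul_zero, add_zero] at this
    exact B.smul_p S this
  · have := congrArg (X ◁ j ≫ ·) h
    simp only [Preadditive.comp_add, Linear.comp_smul, B.whiskerLeft_j_p, B.whiskerLeft_j_q,
      smul_zero, zero_add] at this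
    have := congrArg ((ρ_ X).inv ≫ ·) this
    simp only [Linear.comp_smul, Iso.inv_hom_id] at this
    exact smul_left_injective k S.obj_ne this

theorem right_tree_unit_independent (B : FusionBasis p q i j) (S : SimplePair k X) {c d : k}
    (h : c • (X ◁ p ≫ q) = d • (X ◁ p ≫ q)) : c = d := by
  have := congrArg (X ◁ i ≫ ·) h
  simp only [Linear.comp_smul, B.whiskerLeft_i_p] at this
  exact B.smul_q S this

/-- The right trees are linearly independent in `Hom(X ⊗ X ⊗ X ⊗ X, X)`. -/
theorem four_trees_independent (B : FusionBasis p q i j) (S : SimplePair k X)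
    {c d e c' d' e' : k}
    (h : c • (X ◁ X ◁ p ≫ X ◁ p ≫ p) + d • (X ◁ X ◁ p ≫ X ◁ q ≫ (ρ_ X).hom) +
      e • (X ◁ X ◁ q ≫ X ◁ (ρ_ X).hom ≫ p) =
      c' • (X ◁ X ◁ p ≫ X ◁ p ≫ p) + d' • (X ◁ X ◁ p ≫ X ◁ q ≫ (ρ_ X).hom) +
      e' • (X ◁ X ◁ q ≫ X ◁ (ρ_ X).hom ≫ p)) : c = c' ∧ d = d' ∧ e = e' := by
  simp only [← MonoidalCategory.whiskerLeft_comp_assoc] at h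
  have h1 := congrArg (X ◁ X ◁ i ≫ ·) h
  have h2 := congrArg (X ◁ X ◁ j ≫ ·) h
  simp only [Preadditive.comp_add, Linear.comp_smul, ← whiskerLeft_comp_assoc,
    B.whiskerLeft_i_p, B.whiskerLeft_i_q, B.whiskerLeft_j_p, B.whiskerLeft_j_q,
    MonoidalPreadditive.whiskerLeft_zero, zero_comp, smul_zero, add_zero, zero_add] at h1 h2
  obtain ⟨hc, hd⟩ := B.right_trees_independent S h1
  refine ⟨hc, hd, ?_⟩
  have := congrArg (X ◁ (ρ_ X).inv ≫ ·) h2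
  simp only [Linear.comp_smul, ← whiskerLeft_comp_assoc, Iso.inv_hom_id, whiskerLeft_id,
    Category.id_comp] at this
  exact B.smul_p S this

/-- The right trees are linearly independent in `Hom(X ⊗ X ⊗ X ⊗ X, 𝟙)`. -/
theorem four_trees_unit_independent (B : FusionBasis p q i j) (S : SimplePair k X)
    {c d c' d' : k}
    (h : c • (X ◁ X ◁ p ≫ X ◁ p ≫ q) + d • (X ◁ X ◁ q ≫ X ◁ (ρ_ X).hom ≫ q) =
      c' • (X ◁ X ◁ p ≫ X ◁ p ≫ q) + d' • (X ◁ X ◁ q ≫ X ◁ (ρ_ X).hom ≫ q)) :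
    c = c' ∧ d = d' := by
  simp only [← MonoidalCategory.whiskerLeft_comp_assoc] at h
  have h1 := congrArg (X ◁ X ◁ i ≫ ·) h
  have h2 := congrArg (X ◁ X ◁ j ≫ ·) h
  simp only [Preadditive.comp_add, Linear.comp_smul, ← whiskerLeft_comp_assoc,
    B.whiskerLeft_i_p, B.whiskerLeft_i_q, B.whiskerLeft_j_p, B.whiskerLeft_j_q,
    MonoidalPreadditive.whiskerLeft_zero, zero_comp, smul_zero, add_zero, zero_add] at h1 h2
  refine ⟨B.right_tree_unit_independent S h1, ?_⟩
  have := congrArg (X ◁ (ρ_ X).inv ≫ ·) h2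
  simp only [Linear.comp_smul, ← whiskerLeft_comp_assoc, Iso.inv_hom_id, whiskerLeft_id,
    Category.id_comp] at this
  exact B.smul_q S this

end FusionBasis

variable [MonoidalPreadditive C] [MonoidalLinear k C] {b x y z w : k}

/-- The pentagon equation leaves two parameters free: `x`, which satisfies `x ^ 2 = x + 1`, and `y`,
which is removed by rescaling `q`. -/
theorem TreeRelations.coefficients (H : TreeRelations p q b x y z w) (B : FusionBasis p q i j)
    (S : SimplePair k X) :
    b = 1 ∧ y ≠ 0 ∧ w = -x ∧ y * z = -x ∧ x ^ 2 = x + 1 := by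
  obtain ⟨l1, l2, l3⟩ := B.four_trees_independent S H.pentagon_left
  obtain ⟨r1, r2, r3⟩ := B.four_trees_independent S H.pentagon_right
  obtain ⟨u1, u2⟩ := B.four_trees_unit_independent S (c := b * b) (d := 0)
    (c' := x * b * x + y * z) (d' := x * b * y + y * w)
    (by rw [zero_smul, add_zero]; exact H.pentagon_unit)
  -- otherwise `q = 0`
  have hb : b ≠ 0 := by
    rintro rfl
    have h := congrArg (i ▷ X ≫ ·) H.unit
    simp only [← comp_whiskerRight_assoc, B.i_p, id_whiskerRight, Category.id_comp, zero_smul,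
      comp_zero] at h
    exact S.unit_ne (by rw [← B.j_q, h, comp_zero])
  -- otherwise `X = 0`
  have hz : z ≠ 0 ∨ w ≠ 0 := by
    by_contra! h0
    have h := congrArg (j ▷ X ≫ ·) H.right
    simp only [← comp_whiskerRight_assoc, B.j_q, id_whiskerRight, Category.id_comp, h0.1, h0.2,
      zero_smul, comp_zero, add_zero] at h
    exact S.obj_ne (by rw [← cancel_epi (λ_ X).hom, h, zero_comp, zero_comp])
  -- otherwise `y = 0` and the left trees `p (p ⊗ 1)` and `q ⊗ 1` are proportional
  have hw : w ≠ 0 := by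
    rintro rfl
    have hz : z ≠ 0 := by simpa using hz
    have hy : y = 0 := by
      have : b * z * y = 0 := r3.symm
      simpa [hb, hz] using this
    have h := H.left
    rw [hy, zero_smul, add_zero] at h
    have h' := H.right
    rw [zero_smul, add_zero] at h'
    have h2 : z • (p ▷ X ≫ p) = x • (q ▷ X ≫ (λ_ X).hom) := by
      rw [h, h', smul_smul, smul_smul, mul_comm]
    have h3 := congrArg (i ▷ X ≫ ·) h2
    simp only [Linear.comp_smul, ← comp_whiskerRight_assoc, B.i_p, B.i_q, id_whiskerRight,
      Category.id_comp, MonoidalPreadditive.zero_whiskerRight, zero_comp, smul_zero] at h3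
    exact hz (B.smul_p S (by rw [h3, zero_smul]))
  have hy : y ≠ 0 := by rintro rfl; simp at r3; exact hw r3
  have hwx : w = -(x * b) := by
    have : y * (x * b + w) = 0 := by linear_combination -u2
    linear_combination (mul_eq_zero.1 this).resolve_left hy
  have hx : x ≠ 0 := by rintro rfl; simp at hwx; exact hw hwx
  have hb1 : b = 1 := by
    have : x * y * (b - 1) = 0 := by linear_combination -l2
    have := (mul_eq_zero.1 this).resolve_left (mul_ne_zero hx hy)
    linear_combination this
  subst hb1
  have hyz : y * z = -x := by linear_combination hwx - r3
  exact ⟨rfl, hy, by linear_combination hwx, hyz, by linear_combination -u1 - hyz⟩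

theorem TreeRelations.normalize (H : TreeRelations p q b x y z w) {c : k} (hc : c ≠ 0) :
    TreeRelations p (c • q) b x (c⁻¹ * y) (c * z) w where
  unit := by
    rw [Linear.comp_smul, H.unit, Linear.comp_smul, Linear.comp_smul, smul_comm]
  left := by
    rw [H.left, MonoidalLinear.whiskerLeft_smul, Linear.smul_comp, Linear.comp_smul, smul_smul]
    congr 2
    field_simp
  right := by
    rw [MonoidalLinear.smul_whiskerRight, Linear.smul_comp, H.right,
      MonoidalLinear.whiskerLeft_smul, Linear.smul_comp, Linear.comp_smul]
    module

/-- Rescaling `q` by `y` brings the associativity matrix into the form `(a, 1; -a, -a)`. -/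
theorem FusionBasis.exists_normalized (B : FusionBasis p q i j) (S : SimplePair k X) :
    ∃ (a : k) (q' : X ⊗ X ⟶ 𝟙_ C) (j' : 𝟙_ C ⟶ X ⊗ X), FusionBasis p q' i j' ∧
      TreeRelations p q' 1 a 1 (-a) (-a) ∧ a ^ 2 = a + 1 := by
  obtain ⟨b, x, y, z, w, H⟩ := B.exists_treeRelations S
  obtain ⟨rfl, hy, rfl, hyz, hx⟩ := H.coefficients B S
  refine ⟨x, y • q, y⁻¹ • j, B.scale_unit hy, ?_, hx⟩
  have := H.normalize hy
  rwa [hyz, inv_mul_cancel₀ hy] at this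

/-- The matrix of the associator in the bases of trees is an involution. -/
theorem TreeRelations.inverse {a : k} (H : TreeRelations p q 1 a 1 (-a) (-a))
    (ha : a ^ 2 = a + 1) :
    (α_ X X X).hom ≫ X ◁ p ≫ p = a • (p ▷ X ≫ p) + q ▷ X ≫ (λ_ X).hom ∧
    (α_ X X X).hom ≫ X ◁ q ≫ (ρ_ X).hom =
      (-a) • (p ▷ X ≫ p) + (-a) • (q ▷ X ≫ (λ_ X).hom) := by
  rw [H.left, H.right]
  have h : a * a = a + 1 := by rw [← ha, sq]
  constructor
  · match_scalars <;> first | ring1 | linear_combination h | linear_combination -h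
  · match_scalars <;> first | ring1 | linear_combination h | linear_combination -h

section Braided

variable [BraidedCategory C]

/-- The hexagon equation determines the braiding of `X` with itself from its eigenvalue on `Hom(X ⊗
X, X)`. -/
theorem TreeRelations.hexagon {a r s : k} (H : TreeRelations p q 1 a 1 (-a) (-a))
    (B : FusionBasis p q i j) (S : SimplePair k X) (ha : a ^ 2 = a + 1)
    (hp : (β_ X X).hom ≫ p = r • p) (hq : (β_ X X).hom ≫ q = s • q) :
    s = r ^ 2 ∧ a = r + r⁻¹ ∧ r ≠ 0 := by
  have hr : r ≠ 0 := by
    rintro rfl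
    rw [zero_smul] at hp
    have : p = 0 := by rw [← cancel_epi (β_ X X).hom, hp, comp_zero]
    exact S.obj_ne (by rw [← B.i_p, this, comp_zero])
  have hex {Z : C} (h : X ⊗ X ⊗ X ⟶ Z) := congrArg (· ≫ h) (BraidedCategory.hexagon_forward X X X)
  simp only [Category.assoc] at hex
  -- the hexagon on the tree `X ◁ p ≫ q`
  have hs : s = r ^ 2 := by
    have h := hex (X ◁ p ≫ q)
    have hu := H.unit
    rw [one_smul] at hu
    rw [← hu, ← BraidedCategory.braiding_naturality_right_assoc, hq, ← whiskerLeft_comp_assoc, hp,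
      MonoidalLinear.whiskerLeft_smul, Linear.smul_comp, Linear.comp_smul, Linear.comp_smul,
      Linear.comp_smul, ← hu, Linear.comp_smul, ← comp_whiskerRight_assoc, hp,
      MonoidalLinear.smul_whiskerRight, Linear.smul_comp, hu,
      smul_smul] at h
    replace h : (α_ X X X).hom ≫ (s • (X ◁ p ≫ q)) = (α_ X X X).hom ≫ ((r * r) • (X ◁ p ≫ q)) := by
      rw [Linear.comp_smul, Linear.comp_smul, h]
    rw [cancel_epi] at h
    rw [B.right_tree_unit_independent S h, sq]
  subst hs
  refine ⟨rfl, ?_, hr⟩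
  obtain ⟨i1, i2⟩ := H.inverse ha
  -- the hexagon on the tree `X ◁ p ≫ p`
  have h := hex (X ◁ p ≫ p)
  have h1 : (β_ X (X ⊗ X)).hom ≫ (α_ X X X).hom ≫ X ◁ p ≫ p =
      (a * r) • (X ◁ p ≫ p) + (1 : k) • (X ◁ q ≫ (ρ_ X).hom) := by
    rw [i1, Preadditive.comp_add, Linear.comp_smul,
      ← BraidedCategory.braiding_naturality_right_assoc,
      ← BraidedCategory.braiding_naturality_right_assoc, hp, braiding_leftUnitor, Linear.comp_smul,
      smul_smul, one_smul]
  have h2 : (β_ X X).hom ▷ X ≫ (α_ X X X).hom ≫ X ◁ (β_ X X).hom ≫ X ◁ p ≫ p =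
      (α_ X X X).hom ≫ ((a ^ 2 * r ^ 2 - a * r ^ 3) • (X ◁ p ≫ p) +
        (a * r ^ 2 - a * r ^ 3) • (X ◁ q ≫ (ρ_ X).hom)) := by
    rw [← whiskerLeft_comp_assoc, hp, MonoidalLinear.whiskerLeft_smul, Linear.smul_comp,
      Linear.comp_smul, Linear.comp_smul, i1, Preadditive.comp_add, Linear.comp_smul,
      ← comp_whiskerRight_assoc, ← comp_whiskerRight_assoc, hp, hq,
      MonoidalLinear.smul_whiskerRight, MonoidalLinear.smul_whiskerRight, Linear.smul_comp,
      Linear.smul_comp, H.left, H.right]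
    simp only [Preadditive.comp_add, Linear.comp_smul]
    module
  rw [h1, h2, cancel_epi] at h
  obtain ⟨e1, e2⟩ := B.right_trees_independent S h
  have ha0 : a ≠ 0 := by rintro rfl; simp at ha
  have : (a * r) * (a * r - (r ^ 2 + 1)) = 0 := by linear_combination -e1
  have := (mul_eq_zero.1 this).resolve_left (mul_ne_zero ha0 hr)
  field_simp
  linear_combination this

/-- A normalized basis of `Hom(X ⊗ X, X)` and `Hom(X ⊗ X, 𝟙)`, together with the braiding and the
twist in this basis, which are those of parameter `u`. -/
structure FibonacciBasis (k : Type w) [Field k] [Linear k C] [Balanced C]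
    (p : X ⊗ X ⟶ X) (q : X ⊗ X ⟶ 𝟙_ C) (i : X ⟶ X ⊗ X) (j : 𝟙_ C ⟶ X ⊗ X) (u : k) : Prop where
  basis : FusionBasis p q i j
  trees : TreeRelations p q 1 (u + u⁻¹) 1 (-(u + u⁻¹)) (-(u + u⁻¹))
  braid_p : (β_ X X).hom ≫ p = u • p
  braid_q : (β_ X X).hom ≫ q = u ^ 2 • q
  twist : θ X = (u ^ 2)⁻¹ • 𝟙 X
  cyclotomic : u ^ 4 - u ^ 3 + u ^ 2 - u + 1 = 0

/-- Every balanced braided structure has a parameter: the associator comes from the pentagon, the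
braiding from the hexagon, and naturality of the twist at `p` reads `θ_X = θ_X ^ 2 * u ^ 2`. -/
theorem FusionBasis.exists_fibonacciBasis [Balanced C] (B : FusionBasis p q i j)
    (S : SimplePair k X) :
    ∃ (u : k) (q' : X ⊗ X ⟶ 𝟙_ C) (j' : 𝟙_ C ⟶ X ⊗ X), FibonacciBasis k p q' i j' u := by
  obtain ⟨a, q, j, B, H, ha⟩ := B.exists_normalized S
  obtain ⟨r, hr⟩ := B.exists_smul_p S ((β_ X X).hom ≫ p)
  obtain ⟨s, hs⟩ := B.exists_smul_q S ((β_ X X).hom ≫ q)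
  obtain ⟨rfl, rfl, hr0⟩ := H.hexagon B S ha hr hs
  refine ⟨r, q, j, B, H, hr, hs, ?_, ?_⟩
  · obtain ⟨t, ht⟩ := S.end_obj (θ X)
    have ht0 : t ≠ 0 := by
      rintro rfl
      rw [zero_smul] at ht
      have := (Balanced.twist X).hom_inv_id
      rw [show (Balanced.twist X).hom = 0 from ht, zero_comp] at this
      exact S.obj_ne this.symm
    have nat : p ≫ θ X = θ (X ⊗ X) ≫ p := Balanced.twist_naturality p
    have tens : θ (X ⊗ X) = (θ X ⊗ₘ θ X) ≫ (β_ X X).hom ≫ (β_ X X).hom :=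
      Balanced.twist_tensor X X
    rw [tens, ht, MonoidalCategory.tensorHom_def] at nat
    simp only [MonoidalLinear.smul_whiskerRight, MonoidalLinear.whiskerLeft_smul, Category.assoc,
      Linear.comp_smul, Linear.smul_comp, hr, id_whiskerRight, whiskerLeft_id, Category.id_comp,
      Category.comp_id, smul_smul] at nat
    have e := B.smul_p S nat
    rw [ht]
    congr 1
    have : t * (t * r ^ 2 - 1) = 0 := by linear_combination -e
    have := (mul_eq_zero.1 this).resolve_left ht0
    field_simp
    linear_combination this
  -- clearing denominators in `a ^ 2 = a + 1` for `a = u + u⁻¹`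
  · field_simp at ha
    linear_combination ha

end Braided

end FusionBasis

/-! ### The parameter of a Fibonacci category -/

section SimpleSystem

variable {C : Type u} [Category.{v} C] [Abelian C] [MonoidalCategory C]

theorem IsSimpleSystem.simple_unit {X : C} (h : IsSimpleSystem ![𝟙_ C, X]) : Simple (𝟙_ C) :=
  h.simple 0

theorem IsSimpleSystem.simple_obj {X : C} (h : IsSimpleSystem ![𝟙_ C, X]) : Simple X :=
  h.simple 1

theorem IsSimpleSystem.not_iso {X : C} (h : IsSimpleSystem ![𝟙_ C, X]) (e : X ≅ 𝟙_ C) : False :=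
  absurd (h.injective 1 0 ⟨e⟩) (by decide)

theorem IsSimpleSystem.iso_or {X : C} (h : IsSimpleSystem ![𝟙_ C, X]) (Y : C) [Simple Y] :
    Nonempty (Y ≅ 𝟙_ C) ∨ Nonempty (Y ≅ X) := by
  obtain ⟨i, hi⟩ := h.exhaustive Y inferInstance
  fin_cases i
  · exact Or.inl hi
  · exact Or.inr hi

theorem IsSimpleSystem.iso {X Y : C} (h : IsSimpleSystem ![𝟙_ C, X])
    (h' : IsSimpleSystem ![𝟙_ C, Y]) : Nonempty (X ≅ Y) := by
  have := h.simple_obj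
  refine (h'.iso_or X).resolve_left ?_
  rintro ⟨e⟩
  exact h.not_iso e

variable {k : Type w} [Field k] [IsAlgClosed k] [Linear k C]

/-- Schur's lemma. -/
theorem IsFibonacci.simplePair (hC : IsFibonacci k C) {X : C} (h : IsSimpleSystem ![𝟙_ C, X]) :
    SimplePair k X := by
  have fin := hC.semisimple.finite_hom
  have := h.simple_unit
  have := h.simple_obj
  have end_smul (Y : C) [Simple Y] (f : Y ⟶ Y) : ∃ c : k, f = c • 𝟙 Y := by
    have := fin Y Y
    obtain ⟨c, hc⟩ := endomorphism_simple_eq_smul_id k f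
    exact ⟨c, hc.symm⟩
  refine ⟨end_smul _, end_smul _, fun f => ?_, fun f => ?_, id_nonzero _, id_nonzero _⟩
  · by_contra hf
    have := (isIso_iff_nonzero f).2 hf
    exact h.not_iso (asIso f)
  · by_contra hf
    have := (isIso_iff_nonzero f).2 hf
    exact h.not_iso (asIso f).symm

theorem IsFibonacci.exists_fusionBasis (hC : IsFibonacci k C) {X : C}
    (h : IsSimpleSystem ![𝟙_ C, X]) :
    ∃ (p : X ⊗ X ⟶ X) (q : X ⊗ X ⟶ 𝟙_ C) (i : X ⟶ X ⊗ X) (j : 𝟙_ C ⟶ X ⊗ X),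
      FusionBasis p q i j := by
  obtain ⟨Y, hY, ⟨e⟩⟩ := hC.fusion
  obtain ⟨f⟩ := h.iso hY
  let g : X ⊗ X ≅ 𝟙_ C ⊞ X := (f ⊗ᵢ f) ≪≫ e ≪≫ biprod.mapIso (Iso.refl _) f.symm
  refine ⟨g.hom ≫ biprod.snd, g.hom ≫ biprod.fst, biprod.inr ≫ g.inv, biprod.inl ≫ g.inv,
    ?_, ?_, ?_, ?_, ?_⟩
  · simp
  · simp
  · simp
  · simp
  · rw [Category.assoc, Category.assoc, ← Preadditive.comp_add, ← Category.assoc, ← Category.assoc,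
      ← Preadditive.add_comp, add_comm, biprod.total, Category.id_comp, Iso.hom_inv_id]

variable [MonoidalPreadditive C] [MonoidalLinear k C] [BraidedCategory C] [Balanced C]

theorem IsFibonacci.exists_fibonacciBasis (hC : IsFibonacci k C) {X : C}
    (h : IsSimpleSystem ![𝟙_ C, X]) :
    ∃ (u : k) (p : X ⊗ X ⟶ X) (q : X ⊗ X ⟶ 𝟙_ C) (i : X ⟶ X ⊗ X) (j : 𝟙_ C ⟶ X ⊗ X),
      FibonacciBasis k p q i j u := by
  obtain ⟨p, q, i, j, B⟩ := hC.exists_fusionBasis h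
  obtain ⟨u, q, j, B⟩ := B.exists_fibonacciBasis (hC.simplePair h)
  exact ⟨u, p, q, i, j, B⟩

theorem FibonacciBasis.hasFibonacciConstants {X : C} {p : X ⊗ X ⟶ X} {q : X ⊗ X ⟶ 𝟙_ C}
    {i : X ⟶ X ⊗ X} {j : 𝟙_ C ⟶ X ⊗ X} {u : k} (B : FibonacciBasis k p q i j u)
    (h : IsSimpleSystem ![𝟙_ C, X]) : HasFibonacciConstants k C u := by
  have := h.simple_unit
  have := h.simple_obj
  refine ⟨X, p, q, h, ?_, ?_, ?_, ?_, B.trees.right, B.braid_p, B.braid_q, B.twist⟩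
  · intro h0
    have := B.basis.i_p
    rw [h0, comp_zero] at this
    exact id_nonzero X this.symm
  · intro h0
    have := B.basis.j_q
    rw [h0, comp_zero] at this
    exact id_nonzero (𝟙_ C) this.symm
  · rw [B.trees.unit, one_smul]
  · rw [B.trees.left, one_smul]

theorem IsFibonacci.exists_hasFibonacciConstants (hC : IsFibonacci k C) :
    ∃ u : k, HasFibonacciConstants k C u := by
  obtain ⟨X, h, -⟩ := hC.fusion
  obtain ⟨u, p, q, i, j, B⟩ := hC.exists_fibonacciBasis h
  exact ⟨u, B.hasFibonacciConstants h⟩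

/-- The parameter is the eigenvalue of the braiding on `Hom(Y ⊗ Y, Y)`, for any simple object `Y`
other than the unit. -/
theorem FibonacciBasis.eigenvalue {X : C} {p : X ⊗ X ⟶ X} {q : X ⊗ X ⟶ 𝟙_ C}
    {i : X ⟶ X ⊗ X} {j : 𝟙_ C ⟶ X ⊗ X} {u : k} (B : FibonacciBasis k p q i j u)
    (S : SimplePair k X) {Y : C} (e : Y ≅ X) {r : k} {f : Y ⊗ Y ⟶ Y} (hf : f ≠ 0)
    (hr : (β_ Y Y).hom ≫ f = r • f) : r = u := by
  obtain ⟨c, hc⟩ := B.basis.exists_smul_p S ((e.inv ⊗ₘ e.inv) ≫ f ≫ e.hom)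
  have hf' : f = c • ((e.hom ⊗ₘ e.hom) ≫ p ≫ e.inv) := by
    rw [← Linear.comp_smul, ← Linear.smul_comp, ← hc]
    simp
  have hc0 : c ≠ 0 := by
    rintro rfl
    exact hf (by rw [hf', zero_smul])
  have h1 : (β_ X X).hom ≫ (c • p) = r • c • p := by
    rw [← hc, ← BraidedCategory.braiding_naturality_assoc, reassoc_of% hr, Linear.smul_comp,
      Linear.comp_smul]
  rw [Linear.comp_smul, B.braid_p, smul_smul, smul_smul] at h1
  have := B.basis.smul_p S h1
  exact mul_left_cancel₀ hc0 (by rw [this, mul_comm])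

/-- A parameter that is realized by one choice of the simple object and of `p`, `q` is realized for
every simple object `X` other than the unit. -/
theorem IsFibonacci.fibonacciBasis (hC : IsFibonacci k C) {u : k}
    (hu : HasFibonacciConstants k C u) {X : C} (h : IsSimpleSystem ![𝟙_ C, X]) :
    ∃ (p : X ⊗ X ⟶ X) (q : X ⊗ X ⟶ 𝟙_ C) (i : X ⟶ X ⊗ X) (j : 𝟙_ C ⟶ X ⊗ X),
      FibonacciBasis k p q i j u := by
  obtain ⟨u', p, q, i, j, B⟩ := hC.exists_fibonacciBasis h
  obtain ⟨Y, f, g, hY, hf, -, -, -, -, hr, -⟩ := hu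
  obtain ⟨e⟩ := hY.iso h
  obtain rfl := B.eigenvalue (hC.simplePair h) e hf hr
  exact ⟨p, q, i, j, B⟩

theorem IsFibonacci.cyclotomic (hC : IsFibonacci k C) {u : k}
    (hu : HasFibonacciConstants k C u) : u ^ 4 - u ^ 3 + u ^ 2 - u + 1 = 0 := by
  obtain ⟨X, h, -⟩ := hC.fusion
  obtain ⟨p, q, i, j, B⟩ := hC.fibonacciBasis hu h
  exact B.cyclotomic

/-- The parameter is invariant under braided equivalence. -/
theorem IsFibonacci.eq_of_braided (hC : IsFibonacci k C) {u : k}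
    (hu : HasFibonacciConstants k C u) {D : Type u'} [Category.{v'} D] [Abelian D]
    [MonoidalCategory D] [Linear k D] [BraidedCategory D] (F : D ⥤ C) [F.Additive] [F.Linear k]
    [F.IsEquivalence] [F.Braided] [Balanced D] {u' : k} (hu' : HasFibonacciConstants k D u') :
    u' = u := by
  obtain ⟨X, h, -⟩ := hC.fusion
  obtain ⟨p, q, i, j, B⟩ := hC.fibonacciBasis hu h
  obtain ⟨Y, f, g, hY, hf, -, -, -, -, hr, -⟩ := hu'
  have := hY.simple_obj
  have : Simple (F.obj Y) := CategoryTheory.simple_obj F Y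
  have e : Nonempty (F.obj Y ≅ X) := by
    refine (h.iso_or (F.obj Y)).resolve_left ?_
    rintro ⟨e⟩
    exact hY.not_iso (F.preimageIso (e ≪≫ Functor.Monoidal.εIso F))
  obtain ⟨e⟩ := e
  refine B.eigenvalue (hC.simplePair h) e (f := Functor.LaxMonoidal.μ F Y Y ≫ F.map f) ?_ ?_
  · intro h0
    rw [← comp_zero (f := Functor.LaxMonoidal.μ F Y Y), cancel_epi, F.map_eq_zero_iff] at h0
    exact hf h0
  · rw [← Functor.LaxBraided.braided_assoc, ← F.map_comp, hr, F.map_smul, Linear.comp_smul]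

end SimpleSystem

/-! ### Primitive tenth roots of unity -/

section RootsOfUnity

variable {k : Type w} [Field k] [CharZero k]

theorem isPrimitiveRoot_ten_iff (u : k) :
    IsPrimitiveRoot u 10 ↔ u ^ 4 - u ^ 3 + u ^ 2 - u + 1 = 0 := by
  constructor
  · intro h
    have h10 := h.pow_eq_one
    have h5 : u ^ 5 ≠ 1 := h.pow_ne_one_of_pos_of_lt (by norm_num) (by norm_num)
    have h2 : u ^ 2 ≠ 1 := h.pow_ne_one_of_pos_of_lt (by norm_num) (by norm_num)
    -- `t ^ 10 - 1` factors as `(t ^ 5 - 1) (t + 1) Φ₁₀(t)`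
    have : (u ^ 5 - 1) * (u + 1) * (u ^ 4 - u ^ 3 + u ^ 2 - u + 1) = 0 := by
      linear_combination h10
    refine (mul_eq_zero.1 this).resolve_left (mul_ne_zero (sub_ne_zero.2 h5) fun h0 => h2 ?_)
    linear_combination (u - 1) * h0
  · intro h
    have h5 : u ^ 5 = -1 := by linear_combination (u + 1) * h
    have h10 : u ^ 10 = 1 := by linear_combination (u ^ 5 - 1) * h5
    have h1 : u ≠ -1 := by rintro rfl; norm_num at h
    refine (IsPrimitiveRoot.iff_orderOf).2 ?_
    refine orderOf_eq_of_pow_and_pow_div_prime (by norm_num) h10 fun p hp hd => ?_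
    have : p = 2 ∨ p = 5 := by
      have := (Nat.Prime.dvd_mul hp (m := 2) (n := 5)).1 hd
      rcases this with h | h
      · exact Or.inl ((Nat.prime_dvd_prime_iff_eq hp Nat.prime_two).1 h)
      · exact Or.inr ((Nat.prime_dvd_prime_iff_eq hp Nat.prime_five).1 h)
    rcases this with rfl | rfl
    · rw [show 10 / 2 = 5 by norm_num, h5]
      norm_num
    · rw [show 10 / 5 = 2 by norm_num]
      intro h2
      exact h1 (by linear_combination h5 - (u ^ 3 + u) * h2)

theorem ncard_primitiveRoots_ten [IsAlgClosed k] : {u : k | IsPrimitiveRoot u 10}.ncard = 4 := by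
  have h : {u : k | IsPrimitiveRoot u 10} = (primitiveRoots 10 k : Set k) := by
    ext u
    simp
  have : NeZero ((10 : ℕ) : k) := ⟨by norm_num⟩
  obtain ⟨ζ, hζ⟩ := HasEnoughRootsOfUnity.exists_primitiveRoot k 10
  rw [h, Set.ncard_coe_finset, hζ.card_primitiveRoots]
  decide

end RootsOfUnity

/-! ### Realization of the matrix model in a Fibonacci category -/

section Realization

open ZeroObject

attribute [local instance] Abelian.hasFiniteBiproducts

variable {k : Type w} [Field k] {u : k} {C : Type u} [Category.{v} C] [Abelian C] [Linear k C]
  [MonoidalCategory C] (X : C)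

/-- The object of `C` that realizes a label. -/
def label : Option Bool → C
  | none => 0
  | some false => 𝟙_ C
  | some true => X

/-- The canonical morphism between the realizations of two labels. -/
def labelHom (x y : Option Bool) : label X x ⟶ label X y :=
  if h : x = y then eqToHom (by rw [h]) else 0

theorem labelHom_of_ne {x y : Option Bool} (h : x ≠ y) : labelHom X x y = 0 := by
  simp [labelHom, h]

variable {X} in
theorem SimplePair.id_label_ne (H : SimplePair k X) (c : Bool) : 𝟙 (label X (some c)) ≠ 0 := by
  cases c
  · exact H.unit_ne
  · exact H.obj_ne

variable {X} in
theorem SimplePair.end_label (H : SimplePair k X) (c : Bool)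
    (f : label X (some c) ⟶ label X (some c)) : ∃ a : k, f = a • 𝟙 _ := by
  cases c
  · exact H.end_unit f
  · exact H.end_obj f

variable {X} in
theorem SimplePair.hom_label_of_ne (H : SimplePair k X) {c d : Bool} (h : c ≠ d)
    (f : label X (some c) ⟶ label X (some d)) : f = 0 := by
  cases c <;> cases d
  · exact absurd rfl h
  · exact H.of_unit f
  · exact H.to_unit f
  · exact absurd rfl h

namespace FibObj

/-- The object `⨁ s, label X (S.color s)`. -/
abbrev realizeObj (S : FibObj k u) : C := ⨁ fun s => label X (S.color s)

/-- The inclusion of the summand `s`, if this summand has colour `c`, and `0` otherwise. -/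
def inj (S : FibObj k u) (s : S.ι) (c : Bool) : label X (some c) ⟶ realizeObj X S :=
  labelHom X (some c) (S.color s) ≫ biproduct.ι (fun s => label X (S.color s)) s

/-- The projection onto the summand `s`, if this summand has colour `c`, and `0` otherwise. -/
def prj (S : FibObj k u) (s : S.ι) (c : Bool) : realizeObj X S ⟶ label X (some c) :=
  biproduct.π (fun s => label X (S.color s)) s ≫ labelHom X (S.color s) (some c)

theorem inj_eq_zero {S : FibObj k u} {s : S.ι} {c : Bool} (h : S.color s ≠ some c) :
    inj X S s c = 0 := by
  rw [inj, labelHom_of_ne X h.symm, zero_comp]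

theorem inj_prj_self {S : FibObj k u} {s : S.ι} {c : Bool} (h : S.color s = some c) :
    inj X S s c ≫ prj X S s c = 𝟙 _ := by
  simp [inj, prj, labelHom, h]

theorem inj_prj_of_ne (S : FibObj k u) {s s' : S.ι} {c c' : Bool} (h : s ≠ s' ∨ c ≠ c') :
    inj X S s c ≫ prj X S s' c' = 0 := by
  by_cases hs : s = s'
  · subst hs
    have hc : c ≠ c' := by simpa using h
    by_cases h1 : S.color s = some c
    · have : S.color s ≠ some c' := fun h2 => hc (by simpa [h1] using h2)
      rw [prj, labelHom_of_ne X this, comp_zero, comp_zero]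
    · rw [inj_eq_zero X h1, zero_comp]
  · rw [inj, prj, Category.assoc, biproduct.ι_π_assoc, dif_neg hs, zero_comp, comp_zero]

theorem prj_inj_sum (S : FibObj k u) :
    ∑ x : S.ι × Bool, prj X S x.1 x.2 ≫ inj X S x.1 x.2 = 𝟙 (realizeObj X S) := by
  rw [Fintype.sum_prod_type]
  refine Eq.trans ?_ (IsBilimit.total (biproduct.isBilimit fun s => label X (S.color s)))
  refine Finset.sum_congr rfl fun s _ => ?_
  have key (x : Option Bool) : ∑ c, labelHom X x (some c) ≫ labelHom X (some c) x = 𝟙 (label X x) := by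
    rcases x with _ | _ | _
    · exact (isZero_zero C).eq_of_src _ _
    · simp [labelHom]
    · simp [labelHom]
  change _ = biproduct.π _ s ≫ biproduct.ι _ s
  rw [← Category.id_comp (biproduct.ι _ s), ← key, Preadditive.sum_comp, Preadditive.comp_sum]
  simp [prj, inj]

/-- The morphism `realizeObj X S ⟶ realizeObj X T` with the same matrix as `f`. -/
def realizeMap {S T : FibObj k u} (f : S ⟶ T) : realizeObj X S ⟶ realizeObj X T :=
  ∑ x : S.ι × Bool, prj X S x.1 x.2 ≫ ∑ t, ent f x.1 t • inj X T t x.2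

theorem inj_realizeMap {S T : FibObj k u} (f : S ⟶ T) (s : S.ι) (c : Bool) :
    inj X S s c ≫ realizeMap X f = ∑ t, ent f s t • inj X T t c := by
  rw [realizeMap, Preadditive.comp_sum, Finset.sum_eq_single (s, c)]
  · rw [← Category.assoc]
    by_cases h : S.color s = some c
    · rw [inj_prj_self X h, Category.id_comp]
    · rw [inj_eq_zero X h, zero_comp, zero_comp]
      symm
      refine Finset.sum_eq_zero fun t _ => ?_
      by_cases ht : T.color t = some c
      · rw [ent_eq_zero f (fun hl => h (hl.1.trans ht)), zero_smul]
      · rw [inj_eq_zero X ht, smul_zero]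
  · rintro ⟨s', c'⟩ - hne
    rw [← Category.assoc, inj_prj_of_ne, zero_comp]
    by_contra! h
    exact hne (by rw [h.1, h.2])
  · simp

/-- Reads off a realized morphism from the action of its matrix on vectors. -/
theorem inj_realizeMap_of_act {S T : FibObj k u} (f : S ⟶ T) (s : S.ι) (c : Bool) {J : Type*}
    [Fintype J] (a : J → k) (g : J → T.ι) (h : ∀ v, act f v s = ∑ j, a j * v (g j)) :
    inj X S s c ≫ realizeMap X f = ∑ j, a j • inj X T (g j) c := by
  have e (t : T.ι) : ent f s t = ∑ j, if g j = t then a j else 0 := by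
    rw [ent_eq_act, h]
    exact Finset.sum_congr rfl fun j _ => by simp [Pi.single_apply]
  rw [inj_realizeMap]
  simp only [e, Finset.sum_smul]
  rw [Finset.sum_comm]
  refine Finset.sum_congr rfl fun j _ => ?_
  simp [ite_smul]

theorem realize_hom_ext {S : FibObj k u} {Y : C} {f g : realizeObj X S ⟶ Y}
    (h : ∀ s c, S.color s = some c → inj X S s c ≫ f = inj X S s c ≫ g) : f = g := by
  rw [← Category.id_comp f, ← Category.id_comp g, ← prj_inj_sum, Preadditive.sum_comp,
    Preadditive.sum_comp]
  refine Finset.sum_congr rfl fun x _ => ?_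
  rw [Category.assoc, Category.assoc]
  by_cases hx : S.color x.1 = some x.2
  · rw [h _ _ hx]
  · rw [inj_eq_zero X hx, zero_comp, zero_comp]

/-- The functor that sends a coloured family to the direct sum of the objects named by its colours.
-/
abbrev realize : FibObj k u ⥤ C where
  obj := realizeObj X
  map f := realizeMap X f
  map_id S := by
    refine realize_hom_ext X fun s c h => ?_
    rw [inj_realizeMap, Finset.sum_eq_single s]
    · simp [h, Live]
    · intro t _ ht
      simp [ht.symm]
    · simp
  map_comp f g := by
    refine realize_hom_ext X fun s c h => ?_
    rw [← Category.assoc, inj_realizeMap, inj_realizeMap, Preadditive.sum_comp]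
    simp only [Linear.smul_comp, inj_realizeMap, ent_comp, Finset.smul_sum, smul_smul,
      Finset.sum_smul]
    exact Finset.sum_comm

instance : (realize X : FibObj k u ⥤ C).Additive where
  map_add {S T f g} := by
    refine realize_hom_ext X fun s c h => ?_
    simp only [Preadditive.comp_add, inj_realizeMap, ent_add, add_smul, Finset.sum_add_distrib]

instance : (realize X : FibObj k u ⥤ C).Linear k where
  map_smul {S T} f a := by
    refine realize_hom_ext X fun s c h => ?_
    simp only [Linear.comp_smul, inj_realizeMap, ent_smul, mul_smul, Finset.smul_sum]

section Equivalence

variable {X}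

theorem realize_faithful (H : SimplePair k X) : (realize X : FibObj k u ⥤ C).Faithful where
  map_injective {S T} f g h := by
    refine hom_ext_live fun s t hl => ?_
    obtain ⟨c, hc⟩ := Option.ne_none_iff_exists'.1 hl.2
    have key (f : S ⟶ T) : inj X S s c ≫ realizeMap X f ≫ prj X T t c = ent f s t • 𝟙 _ := by
      rw [← Category.assoc, inj_realizeMap, Preadditive.sum_comp, Finset.sum_eq_single t]
      · rw [Linear.smul_comp, inj_prj_self X (hl.1 ▸ hc)]
      · intro t' _ ht
        rw [Linear.smul_comp, inj_prj_of_ne X T (Or.inl ht), smul_zero]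
      · simp
    have e : ent f s t • 𝟙 (label X (some c)) = ent g s t • 𝟙 _ := by
      rw [← key, ← key, show realizeMap X f = realizeMap X g from h]
    exact smul_left_injective k (H.id_label_ne c) e

theorem realize_full (H : SimplePair k X) : (realize X : FibObj k u ⥤ C).Full where
  map_surjective {S T} h := by
    choose a ha using fun s t c => H.end_label c (inj X S s c ≫ h ≫ prj X T t c)
    refine ⟨hom fun s t => match S.color s with
      | none => 0
      | some c => a s t c, realize_hom_ext X fun s c hc => ?_⟩
    rw [inj_realizeMap, ← Category.comp_id (inj X S s c ≫ h), ← prj_inj_sum,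
      Preadditive.comp_sum, Fintype.sum_prod_type]
    refine Finset.sum_congr rfl fun t _ => ?_
    rw [Finset.sum_eq_single c]
    · simp only [← Category.assoc]
      rw [Category.assoc (inj X S s c), ha, ent_hom, hc, Linear.smul_comp, Category.id_comp]
      by_cases ht : T.color t = some c
      · simp [Live, ht]
      · rw [inj_eq_zero X ht, smul_zero, smul_zero]
    · intro d _ hd
      simp only [← Category.assoc]
      rw [Category.assoc (inj X S s c), H.hom_label_of_ne hd.symm (inj X S s c ≫ _), zero_comp]
    · simp

/-- By semisimplicity every object is a direct sum of copies of `𝟙` and `X`. -/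
theorem realize_essSurj (hC : IsFinitelySemisimple k C) (h : IsSimpleSystem ![𝟙_ C, X]) :
    (realize X : FibObj k u ⥤ C).EssSurj where
  mem_essImage Y := by
    obtain ⟨n, S, hS, ⟨e⟩⟩ := hC.sum_of_simples Y
    have key (i : Fin n) : ∃ c : Bool, Nonempty (label X (some c) ≅ S i) := by
      have := hS i
      rcases h.iso_or (S i) with ⟨⟨f⟩⟩ | ⟨⟨f⟩⟩
      · exact ⟨false, ⟨f.symm⟩⟩
      · exact ⟨true, ⟨f.symm⟩⟩
    choose c f using key
    let A : FibObj k u := { ι := ULift.{w} (Fin n), color := fun i => some (c i.down) }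
    refine ⟨A, ⟨?_⟩⟩
    exact biproduct.whiskerEquiv (Equiv.ulift) (fun i => (f i.down).some.symm) ≪≫ e.symm

end Equivalence

end FibObj

end Realization

/-! ### Trees on labels -/

section Trees

variable {C : Type u} [Category.{v} C] [Abelian C] [MonoidalCategory C]

theorem unit_left_tree {Y Z W : C} (T : Y ⊗ Z ⟶ W) :
    (α_ (𝟙_ C) Y Z).hom ≫ 𝟙_ C ◁ T ≫ (λ_ W).hom = (λ_ Y).hom ▷ Z ≫ T := by
  simp

theorem unit_middle_tree {Y Z W : C} (T : Y ⊗ Z ⟶ W) :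
    (α_ Y (𝟙_ C) Z).hom ≫ Y ◁ (λ_ Z).hom ≫ T = (ρ_ Y).hom ▷ Z ≫ T :=
  triangle_assoc _ _ _

theorem unit_right_tree {Y Z W : C} (T : Y ⊗ Z ⟶ W) :
    (α_ Y Z (𝟙_ C)).hom ≫ Y ◁ (ρ_ Z).hom ≫ T = T ▷ 𝟙_ C ≫ (ρ_ W).hom := by
  simp

theorem eq_zero_comp_add {Y Z W : C} (f : Y ⟶ W) (g : Z ⟶ W) : f = (0 : Y ⟶ Z) ≫ g + f := by
  simp

theorem eq_add_zero_comp {Y Z W : C} (f : Y ⟶ W) (g : Z ⟶ W) : f = f + (0 : Y ⟶ Z) ≫ g := by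
  simp

variable {X : C}

/-- The basis element of `Hom(c ⊗ d, e)`, for labels `c`, `d`, `e`; it is `0` if `e` does not occur
in `c ⊗ d`. -/
def tree (p : X ⊗ X ⟶ X) (q : X ⊗ X ⟶ 𝟙_ C) :
    ∀ c d e : Bool, label X (some c) ⊗ label X (some d) ⟶ label X (some e)
  | false, false, false => (λ_ (𝟙_ C)).hom
  | false, true, true => (λ_ X).hom
  | true, false, true => (ρ_ X).hom
  | true, true, true => p
  | true, true, false => q
  | false, false, true => 0
  | false, true, false => 0
  | true, false, false => 0

/-- The basis of `Hom(e, c ⊗ d)` dual to `tree`. -/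
def cotree (i : X ⟶ X ⊗ X) (j : 𝟙_ C ⟶ X ⊗ X) :
    ∀ c d e : Bool, label X (some e) ⟶ label X (some c) ⊗ label X (some d)
  | false, false, false => (λ_ (𝟙_ C)).inv
  | false, true, true => (λ_ X).inv
  | true, false, true => (ρ_ X).inv
  | true, true, true => i
  | true, true, false => j
  | false, false, true => 0
  | false, true, false => 0
  | true, false, false => 0

variable {p : X ⊗ X ⟶ X} {q : X ⊗ X ⟶ 𝟙_ C} {i : X ⟶ X ⊗ X} {j : 𝟙_ C ⟶ X ⊗ X}

theorem tree_eq_zero {c d e : Bool} (h : fuse (some c) (some d) e = none) :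
    tree p q c d e = 0 := by
  cases c <;> cases d <;> cases e <;> first | rfl | simp [fuse] at h

theorem tree_unit_left (c : Bool) : tree p q false c c = (λ_ (label X (some c))).hom := by
  cases c <;> rfl

theorem tree_unit_right (c : Bool) : tree p q c false c = (ρ_ (label X (some c))).hom := by
  cases c
  · exact unitors_equal
  · rfl

namespace FusionBasis

theorem cotree_tree (B : FusionBasis p q i j) {c d e : Bool}
    (h : fuse (some c) (some d) e ≠ none) : cotree i j c d e ≫ tree p q c d e = 𝟙 _ := by
  cases c <;> cases d <;> cases e <;> try simp [fuse] at h
  · exact (λ_ (𝟙_ C)).inv_hom_id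
  · exact (λ_ X).inv_hom_id
  · exact (ρ_ X).inv_hom_id
  · exact B.j_q
  · exact B.i_p

theorem cotree_tree_of_ne (B : FusionBasis p q i j) (c d : Bool) {e e' : Bool} (h : e ≠ e') :
    cotree i j c d e ≫ tree p q c d e' = 0 := by
  cases c <;> cases d <;> cases e <;> cases e' <;>
    first
    | exact absurd rfl h
    | exact comp_zero
    | exact zero_comp
    | exact B.i_q
    | exact B.j_p

theorem tree_total (B : FusionBasis p q i j) (c d : Bool) :
    ∑ e, tree p q c d e ≫ cotree i j c d e = 𝟙 _ := by
  rw [Fintype.sum_bool]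
  cases c <;> cases d <;> simp only [tree, cotree, comp_zero, zero_add, add_zero]
  · exact (λ_ (𝟙_ C)).hom_inv_id
  · exact (λ_ X).hom_inv_id
  · exact (ρ_ X).hom_inv_id
  · exact B.total

end FusionBasis

variable {k : Type w} [Field k] {u : k} [Linear k C] [MonoidalPreadditive C] [MonoidalLinear k C]
  [BraidedCategory C] [Balanced C]

theorem FibonacciBasis.add_inv (B : FibonacciBasis k p q i j u) : u + u⁻¹ = u - u ^ 4 :=
  FibObj.add_inv_eq B.cyclotomic

/-- The associator in the bases of trees, for all labels at once; it agrees with that of the model.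
-/
theorem FibonacciBasis.tree_assoc (B : FibonacciBasis k p q i j u) (x y z : Bool) {f d : Bool}
    (h : fuse (some x) (fuse (some y) (some z) f) d ≠ none) :
    (α_ _ _ _).hom ≫ label X (some x) ◁ tree p q y z f ≫ tree p q x f d =
      ∑ e, FibObj.sixj (u - u ^ 4) (some x) (some y) (some z) d e f •
        (tree p q x y e ▷ label X (some z) ≫ tree p q e z d) := by
  have ha : (u + u⁻¹) ^ 2 = u + u⁻¹ + 1 := by rw [B.add_inv, FibObj.golden B.cyclotomic]
  obtain ⟨h1, h2⟩ := B.trees.inverse ha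
  have h3 := B.trees.unit
  rw [one_smul] at h3
  rw [B.add_inv] at h1 h2
  rw [Fintype.sum_bool]
  cases x <;> cases y <;> cases z <;> cases f <;> cases d <;> try simp [fuse] at h
  all_goals simp only [tree, FibObj.sixj, FibObj.sixjCore, Option.some.injEq, and_self, and_true,
    and_false, if_true, if_false, one_smul, Bool.false_eq_true,
    MonoidalPreadditive.zero_whiskerRight, comp_zero, smul_zero, zero_add, add_zero]
  all_goals first
    | exact unit_left_tree _
    | exact unit_middle_tree _
    | exact unit_right_tree _
    | exact h1
    | exact h2
    | exact h3.symm
    | exact (unit_left_tree _).trans (eq_zero_comp_add _ _)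
    | exact (unit_left_tree _).trans (eq_add_zero_comp _ _)
    | exact (unit_middle_tree _).trans (eq_add_zero_comp _ _)
    | exact (unit_right_tree _).trans (congrArg (_ ≫ ·) unitors_equal.symm)

/-- The braiding in the bases of trees, for all labels at once; it agrees with that of the model. -/
theorem FibonacciBasis.tree_braid (B : FibonacciBasis k p q i j u) (c d e : Bool) :
    (β_ _ _).hom ≫ tree p q d c e = FibObj.braid u (some c) (some d) e • tree p q c d e := by
  cases c <;> cases d <;> cases e <;>
    simp only [tree, FibObj.braid, Option.some.injEq, and_self, and_true, and_false, if_true,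
      if_false, Bool.false_eq_true, comp_zero, smul_zero]
  · exact (braiding_leftUnitor (𝟙_ C)).trans (unitors_equal.symm.trans (one_smul k _).symm)
  · exact (braiding_rightUnitor X).trans (one_smul k _).symm
  · exact (braiding_leftUnitor X).trans (one_smul k _).symm
  · exact B.braid_q
  · exact B.braid_p

end Trees

/-! ### The tensorator of the realization -/

section Cover

variable {C : Type u} [Category.{v} C] [Preadditive C]

/-- A finite family of morphisms into `Y` through which the identity of `Y` factors. -/
def IsCover {I : Type*} [Fintype I] {A : I → C} {Y : C} (j : ∀ i, A i ⟶ Y) : Prop :=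
  ∃ r : ∀ i, Y ⟶ A i, ∑ i, r i ≫ j i = 𝟙 Y

theorem IsCover.hom_ext {I : Type*} [Fintype I] {A : I → C} {Y Z : C} {j : ∀ i, A i ⟶ Y}
    (h : IsCover j) {f g : Y ⟶ Z} (hfg : ∀ i, j i ≫ f = j i ≫ g) : f = g := by
  obtain ⟨r, hr⟩ := h
  rw [← Category.id_comp f, ← Category.id_comp g, ← hr, Preadditive.sum_comp, Preadditive.sum_comp]
  exact Finset.sum_congr rfl fun i _ => by rw [Category.assoc, Category.assoc, hfg]

variable [MonoidalCategory C] [MonoidalPreadditive C]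

theorem IsCover.tensor {I I' : Type*} [Fintype I] [Fintype I'] {A : I → C} {A' : I' → C}
    {Y Y' : C} {j : ∀ i, A i ⟶ Y} {j' : ∀ i, A' i ⟶ Y'} (h : IsCover j) (h' : IsCover j') :
    IsCover (A := fun x : I × I' => A x.1 ⊗ A' x.2) fun x => j x.1 ⊗ₘ j' x.2 := by
  obtain ⟨r, hr⟩ := h
  obtain ⟨r', hr'⟩ := h'
  refine ⟨fun x => r x.1 ⊗ₘ r' x.2, ?_⟩
  rw [Fintype.sum_prod_type, ← id_tensorHom_id, ← hr, ← hr', sum_tensor]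
  simp only [tensor_sum, tensorHom_comp_tensorHom]

theorem isCover_id (Y : C) : IsCover (I := Unit) (A := fun _ => Y) fun _ => 𝟙 Y :=
  ⟨fun _ => 𝟙 Y, by simp⟩

end Cover

namespace FibObj

attribute [local instance] Abelian.hasFiniteBiproducts

variable {k : Type w} [Field k] {u : k} {C : Type u} [Category.{v} C] [Abelian C] [Linear k C]
  [MonoidalCategory C] {X : C}

variable (X) in
theorem isCover_inj (S : FibObj k u) :
    IsCover (I := S.ι × Bool) (A := fun x => label X (some x.2)) fun x => inj X S x.1 x.2 :=
  ⟨fun x => prj X S x.1 x.2, prj_inj_sum X S⟩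

section Ext

variable [MonoidalPreadditive C] {S T R : FibObj k u} {Z : C}

/-- Morphisms out of a tensor product of realizations are determined by their restrictions to the
products of simple summands. -/
theorem realize_tensor_ext {f g : realizeObj X S ⊗ realizeObj X T ⟶ Z}
    (h : ∀ s t c d, S.color s = some c → T.color t = some d →
      (inj X S s c ⊗ₘ inj X T t d) ≫ f = (inj X S s c ⊗ₘ inj X T t d) ≫ g) : f = g := by
  refine ((isCover_inj X S).tensor (isCover_inj X T)).hom_ext fun x => ?_
  by_cases h1 : S.color x.1.1 = some x.1.2
  · by_cases h2 : T.color x.2.1 = some x.2.2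
    · exact h _ _ _ _ h1 h2
    · simp only [inj_eq_zero X h2, MonoidalPreadditive.tensor_zero, zero_comp]
  · simp only [inj_eq_zero X h1, MonoidalPreadditive.zero_tensor, zero_comp]

theorem realize_tensor_ext₃ {f g : (realizeObj X S ⊗ realizeObj X T) ⊗ realizeObj X R ⟶ Z}
    (h : ∀ s t r c d e, S.color s = some c → T.color t = some d → R.color r = some e →
      ((inj X S s c ⊗ₘ inj X T t d) ⊗ₘ inj X R r e) ≫ f =
        ((inj X S s c ⊗ₘ inj X T t d) ⊗ₘ inj X R r e) ≫ g) : f = g := by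
  refine (((isCover_inj X S).tensor (isCover_inj X T)).tensor (isCover_inj X R)).hom_ext
    fun x => ?_
  by_cases h1 : S.color x.1.1.1 = some x.1.1.2
  · by_cases h2 : T.color x.1.2.1 = some x.1.2.2
    · by_cases h3 : R.color x.2.1 = some x.2.2
      · exact h _ _ _ _ _ _ h1 h2 h3
      · simp only [inj_eq_zero X h3, MonoidalPreadditive.tensor_zero, zero_comp]
    · simp only [inj_eq_zero X h2, MonoidalPreadditive.tensor_zero,
        MonoidalPreadditive.zero_tensor, zero_comp]
  · simp only [inj_eq_zero X h1, MonoidalPreadditive.zero_tensor, zero_comp]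

end Ext

variable (p : X ⊗ X ⟶ X) (q : X ⊗ X ⟶ 𝟙_ C) (i : X ⟶ X ⊗ X) (j : 𝟙_ C ⟶ X ⊗ X)

/-- The tensorator of the realization: the product of the summands `s` and `t` is sent to the
summands of the tensor product by the trees. -/
def tensorator (S T : FibObj k u) :
    realizeObj X S ⊗ realizeObj X T ⟶ realizeObj X (tensorObj S T) :=
  ∑ x : (S.ι × Bool) × (T.ι × Bool), (prj X S x.1.1 x.1.2 ⊗ₘ prj X T x.2.1 x.2.2) ≫
    ∑ e, tree p q x.1.2 x.2.2 e ≫ inj X (tensorObj S T) (pt x.1.1 x.2.1 e) e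

/-- The inverse of the tensorator, built from the dual trees. -/
def cotensorator (S T : FibObj k u) :
    realizeObj X (tensorObj S T) ⟶ realizeObj X S ⊗ realizeObj X T :=
  ∑ x : (S.ι × Bool) × (T.ι × Bool) × Bool,
    prj X (tensorObj S T) (pt x.1.1 x.2.1.1 x.2.2) x.2.2 ≫ cotree i j x.1.2 x.2.1.2 x.2.2 ≫
      (inj X S x.1.1 x.1.2 ⊗ₘ inj X T x.2.1.1 x.2.1.2)

variable {S T R : FibObj k u}

theorem inj_tensorator [MonoidalPreadditive C] {s : S.ι} {t : T.ι} {c d : Bool}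
    (hs : S.color s = some c) (ht : T.color t = some d) :
    (inj X S s c ⊗ₘ inj X T t d) ≫ tensorator p q S T =
      ∑ e, tree p q c d e ≫ inj X (tensorObj S T) (pt s t e) e := by
  rw [tensorator, Preadditive.comp_sum, Finset.sum_eq_single ((s, c), (t, d))]
  · simp only [tensorHom_comp_tensorHom_assoc, inj_prj_self X hs, inj_prj_self X ht,
      id_tensorHom_id, Category.id_comp]
  · rintro ⟨⟨s', c'⟩, t', d'⟩ - hne
    rw [tensorHom_comp_tensorHom_assoc]
    by_cases h1 : s = s' ∧ c = c'
    · obtain ⟨rfl, rfl⟩ := h1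
      rw [inj_prj_of_ne X T (s := t) (c := d), MonoidalPreadditive.tensor_zero, zero_comp]
      by_contra! h
      exact hne (by rw [h.1, h.2])
    · rw [inj_prj_of_ne X S (s := s) (c := c) (by tauto), MonoidalPreadditive.zero_tensor,
        zero_comp]
  · simp

theorem inj_cotensorator [MonoidalPreadditive C] {s : S.ι} {t : T.ι} {c d : Bool} (e : Bool)
    (hs : S.color s = some c) (ht : T.color t = some d)
    (he : (tensorObj S T).color (pt s t e) = some e) :
    inj X (tensorObj S T) (pt s t e) e ≫ cotensorator i j S T =
      cotree i j c d e ≫ (inj X S s c ⊗ₘ inj X T t d) := by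
  rw [cotensorator, Preadditive.comp_sum, Finset.sum_eq_single ((s, c), (t, d), e)]
  · rw [← Category.assoc, inj_prj_self X he, Category.id_comp]
  · rintro ⟨⟨s', c'⟩, ⟨t', d'⟩, e'⟩ - hne
    by_cases h1 : s = s' ∧ t = t' ∧ e = e'
    · obtain ⟨rfl, rfl, rfl⟩ := h1
      by_cases h2 : c = c'
      · subst h2
        have : T.color t ≠ some d' := fun h => hne (by rw [ht] at h; simp_all)
        simp only [inj_eq_zero X this, MonoidalPreadditive.tensor_zero, comp_zero]
      · have : S.color s ≠ some c' := fun h => h2 (by rw [hs] at h; simpa using h)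
        simp only [inj_eq_zero X this, MonoidalPreadditive.zero_tensor, comp_zero]
    · rw [← Category.assoc, inj_prj_of_ne, zero_comp]
      by_cases he : e = e'
      · refine Or.inl fun h => h1 ⟨congrArg (fun x => x.1) h, congrArg (fun x => x.2.1) h, he⟩
      · exact Or.inr he
  · simp

theorem color_of_live {x y : Option Bool} {e c : Bool} (h : fuse x y e = some c) :
    c = e ∧ (∃ a, x = some a) ∧ ∃ b, y = some b := by
  revert x y e c; decide

theorem tensorator_cotensorator [MonoidalPreadditive C] {p : X ⊗ X ⟶ X} {q : X ⊗ X ⟶ 𝟙_ C}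
    {i : X ⟶ X ⊗ X} {j : 𝟙_ C ⟶ X ⊗ X} (B : FusionBasis p q i j) (S T : FibObj k u) :
    tensorator p q S T ≫ cotensorator i j S T = 𝟙 _ := by
  refine realize_tensor_ext fun s t c d hs ht => ?_
  rw [← Category.assoc, inj_tensorator p q hs ht, Preadditive.sum_comp, Category.comp_id]
  rw [← Category.id_comp (inj X S s c ⊗ₘ inj X T t d), ← B.tree_total, Preadditive.sum_comp]
  refine Finset.sum_congr rfl fun e _ => ?_
  by_cases he : fuse (some c) (some d) e = none
  · simp only [tree_eq_zero he, zero_comp]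
  · rw [Category.assoc, inj_cotensorator i j e hs ht, Category.assoc]
    rw [color_pt, hs, ht, fuse_live he]

theorem cotensorator_tensorator [MonoidalPreadditive C] {p : X ⊗ X ⟶ X} {q : X ⊗ X ⟶ 𝟙_ C}
    {i : X ⟶ X ⊗ X} {j : 𝟙_ C ⟶ X ⊗ X} (B : FusionBasis p q i j) (S T : FibObj k u) :
    cotensorator i j S T ≫ tensorator p q S T = 𝟙 _ := by
  refine realize_hom_ext X fun x e hx => ?_
  obtain ⟨s, t, e', rfl⟩ := exists_pt x
  rw [color_pt] at hx
  obtain ⟨rfl, ⟨c, hs⟩, d, ht⟩ := color_of_live hx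
  have hl : fuse (some c) (some d) e ≠ none := by
    rw [← hs, ← ht]
    exact fun h => by simp [h] at hx
  rw [← Category.assoc, inj_cotensorator i j e hs ht hx, Category.assoc, inj_tensorator p q hs ht,
    Preadditive.comp_sum, Category.comp_id, Finset.sum_eq_single e]
  · rw [← Category.assoc, B.cotree_tree hl, Category.id_comp]
  · intro e' _ he
    rw [← Category.assoc, B.cotree_tree_of_ne c d he.symm, zero_comp]
  · simp

theorem tensorator_natural [MonoidalPreadditive C] [MonoidalLinear k C] {S' T' : FibObj k u}
    (f : S ⟶ S') (g : T ⟶ T') :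
    (realizeMap X f ⊗ₘ realizeMap X g) ≫ tensorator p q S' T' =
      tensorator p q S T ≫ realizeMap X (tensorMap f g) := by
  refine realize_tensor_ext fun s t c d hs ht => ?_
  rw [tensorHom_comp_tensorHom_assoc, inj_realizeMap, inj_realizeMap, ← Category.assoc,
    inj_tensorator p q hs ht, sum_tensor, Preadditive.sum_comp]
  have left (s' : S'.ι) (t' : T'.ι) :
      (ent f s s' • inj X S' s' c ⊗ₘ ent g t t' • inj X T' t' d) ≫ tensorator p q S' T' =
      ∑ e, (ent f s s' * ent g t t') • (tree p q c d e ≫ inj X (tensorObj S' T') (pt s' t' e) e) := by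
    by_cases h1 : Live (S.color s) (S'.color s')
    · by_cases h2 : Live (T.color t) (T'.color t')
      · rw [← Finset.smul_sum, ← inj_tensorator p q (h1.1 ▸ hs) (h2.1 ▸ ht), ← Linear.smul_comp]
        congr 1
        rw [MonoidalCategory.tensorHom_def, MonoidalCategory.tensorHom_def,
          MonoidalLinear.smul_whiskerRight,
          MonoidalLinear.whiskerLeft_smul, Linear.smul_comp, Linear.comp_smul, smul_smul]
      · simp [ent_eq_zero g h2]
    · simp [ent_eq_zero f h1]
  have right (e : Bool) : (tree p q c d e ≫ inj X (tensorObj S T) (pt s t e) e) ≫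
      realizeMap X (tensorMap f g) = ∑ s', ∑ t', (ent f s s' * ent g t t') •
        (tree p q c d e ≫ inj X (tensorObj S' T') (pt s' t' e) e) := by
    by_cases he : fuse (some c) (some d) e = none
    · simp [tree_eq_zero he]
    · rw [Category.assoc, inj_realizeMap_of_act X (tensorMap f g) (pt s t e) e
        (J := S'.ι × T'.ι) (fun y => ent f s y.1 * ent g t y.2) (fun y => pt y.1 y.2 e)]
      · rw [Fintype.sum_prod_type]
        simp only [Preadditive.comp_sum, Linear.comp_smul]
      · intro v
        rw [act_tensorMap, hs, ht, if_neg he, Fintype.sum_prod_type]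
        simp only [act, Finset.mul_sum, mul_assoc]
  simp only [tensor_sum, Preadditive.sum_comp, left, right]
  rw [Finset.sum_comm (s := (Finset.univ : Finset Bool))]
  exact Finset.sum_congr rfl fun s' _ => Finset.sum_comm

end FibObj

/-! ### The realization is braided monoidal -/

namespace FibObj

attribute [local instance] Abelian.hasFiniteBiproducts

variable {k : Type w} [Field k] {u : k} {C : Type u} [Category.{v} C] [Abelian C] [Linear k C]
  [MonoidalCategory C] [MonoidalPreadditive C] [MonoidalLinear k C] {X : C}

section

variable (p : X ⊗ X ⟶ X) (q : X ⊗ X ⟶ 𝟙_ C) {S T R : FibObj k u} {s : S.ι} {t : T.ι} {r : R.ι}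
  {c d e : Bool}

theorem inj_tensorator_left (hs : S.color s = some c) (ht : T.color t = some d)
    (hr : R.color r = some e) :
    ((inj X S s c ⊗ₘ inj X T t d) ⊗ₘ inj X R r e) ≫ tensorator p q S T ▷ realizeObj X R ≫
      tensorator p q (tensorObj S T) R =
    ∑ g, ∑ f, (tree p q c d f ▷ label X (some e) ≫ tree p q f e g) ≫
      inj X (tensorObj (tensorObj S T) R) (pt (pt s t f) r g) g := by
  rw [← tensorHom_id, tensorHom_comp_tensorHom_assoc, inj_tensorator p q hs ht, Category.comp_id,
    sum_tensor, Preadditive.sum_comp, Finset.sum_comm]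
  refine Finset.sum_congr rfl fun f _ => ?_
  by_cases hf : fuse (some c) (some d) f = none
  · simp [tree_eq_zero hf]
  · have hf' : (tensorObj S T).color (pt s t f) = some f := by
      rw [color_pt, hs, ht, fuse_live hf]
    rw [← Category.id_comp (inj X R r e), ← tensorHom_comp_tensorHom_assoc,
      inj_tensorator p q hf' hr, tensorHom_id, Preadditive.comp_sum]
    simp only [Category.assoc]

theorem inj_tensorator_right (hs : S.color s = some c) (ht : T.color t = some d)
    (hr : R.color r = some e) :
    (inj X S s c ⊗ₘ (inj X T t d ⊗ₘ inj X R r e)) ≫ realizeObj X S ◁ tensorator p q T R ≫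
      tensorator p q S (tensorObj T R) =
    ∑ g, ∑ f, (label X (some c) ◁ tree p q d e f ≫ tree p q c f g) ≫
      inj X (tensorObj S (tensorObj T R)) (pt s (pt t r f) g) g := by
  rw [← id_tensorHom, tensorHom_comp_tensorHom_assoc, inj_tensorator p q ht hr, Category.comp_id,
    tensor_sum, Preadditive.sum_comp, Finset.sum_comm]
  refine Finset.sum_congr rfl fun f _ => ?_
  by_cases hf : fuse (some d) (some e) f = none
  · simp [tree_eq_zero hf]
  · have hf' : (tensorObj T R).color (pt t r f) = some f := by
      rw [color_pt, ht, hr, fuse_live hf]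
    rw [← Category.id_comp (inj X S s c), ← tensorHom_comp_tensorHom_assoc,
      inj_tensorator p q hs hf', id_tensorHom, Preadditive.comp_sum]
    simp only [Category.assoc]

end

theorem tree_tree_eq_zero {p : X ⊗ X ⟶ X} {q : X ⊗ X ⟶ 𝟙_ C} {c d e f g : Bool}
    (h : fuse (fuse (some c) (some d) f) (some e) g = none) :
    tree p q c d f ▷ label X (some e) ≫ tree p q f e g = 0 := by
  by_cases hf : fuse (some c) (some d) f = none
  · simp [tree_eq_zero hf]
  · rw [fuse_live hf] at h
    simp [tree_eq_zero h]

theorem tree_tree_eq_zero' {p : X ⊗ X ⟶ X} {q : X ⊗ X ⟶ 𝟙_ C} {c d e f g : Bool}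
    (h : fuse (some c) (fuse (some d) (some e) f) g = none) :
    label X (some c) ◁ tree p q d e f ≫ tree p q c f g = 0 := by
  by_cases hf : fuse (some d) (some e) f = none
  · simp [tree_eq_zero hf]
  · rw [fuse_live hf] at h
    simp [tree_eq_zero h]

variable [BraidedCategory C] [Balanced C] {p : X ⊗ X ⟶ X} {q : X ⊗ X ⟶ 𝟙_ C} {i : X ⟶ X ⊗ X}
  {j : 𝟙_ C ⟶ X ⊗ X}

/-- The tensorator is compatible with the associators: on simple summands this is `tree_assoc`. -/
theorem tensorator_assoc (B : FibonacciBasis k p q i j u) (S T R : FibObj k u) :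
    tensorator p q S T ▷ realizeObj X R ≫ tensorator p q (tensorObj S T) R ≫
        realizeMap X (assocHom S T R) =
      (α_ _ _ _).hom ≫ realizeObj X S ◁ tensorator p q T R ≫
        tensorator p q S (tensorObj T R) := by
  refine realize_tensor_ext₃ fun s t r c d e hs ht hr => ?_
  rw [associator_naturality_assoc, inj_tensorator_right p q hs ht hr]
  have left := inj_tensorator_left p q hs ht hr
  simp only [← Category.assoc] at left ⊢
  rw [left, Preadditive.sum_comp, Preadditive.comp_sum]
  refine Finset.sum_congr rfl fun g _ => ?_
  have step (f : Bool) : ((tree p q c d f ▷ label X (some e) ≫ tree p q f e g) ≫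
      inj X (tensorObj (tensorObj S T) R) (pt (pt s t f) r g) g) ≫
        realizeMap X (assocHom S T R) = ∑ h, if fuse (some c) (fuse (some d) (some e) h) g = none
      then 0 else (sixj (u - u ^ 4) (some c) (some d) (some e) g f h •
        (tree p q c d f ▷ label X (some e) ≫ tree p q f e g)) ≫
          inj X (tensorObj S (tensorObj T R)) (pt s (pt t r h) g) g := by
    by_cases hl : fuse (fuse (some c) (some d) f) (some e) g = none
    · simp [tree_tree_eq_zero hl]
    · rw [Category.assoc, inj_realizeMap_of_act X (assocHom S T R) (pt (pt s t f) r g) g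
        (fun h => if fuse (some c) (fuse (some d) (some e) h) g = none then 0 else
          sixj (u - u ^ 4) (some c) (some d) (some e) g f h) (fun h => pt s (pt t r h) g),
        Preadditive.comp_sum]
      · refine Finset.sum_congr rfl fun h _ => ?_
        split_ifs
        · simp
        · rw [Linear.comp_smul, Linear.smul_comp]
      · intro v
        rw [act_assocHom, hs, ht, hr, if_neg hl]
        exact Finset.sum_congr rfl fun h _ => by split_ifs <;> simp
  rw [Preadditive.sum_comp, Preadditive.comp_sum]
  simp only [step]
  rw [Finset.sum_comm]
  refine Finset.sum_congr rfl fun h _ => ?_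
  by_cases hl : fuse (some c) (fuse (some d) (some e) h) g = none
  · simp [hl, tree_tree_eq_zero' hl]
  · simp only [if_neg hl]
    rw [← Preadditive.sum_comp, ← B.tree_assoc c d e hl]
    simp only [Category.assoc]

/-- The tensorator is compatible with the braidings: on simple summands this is `tree_braid`. -/
theorem tensorator_braid (B : FibonacciBasis k p q i j u) (S T : FibObj k u) :
    tensorator p q S T ≫ realizeMap X (braidHom S T) =
      (β_ _ _).hom ≫ tensorator p q T S := by
  refine realize_tensor_ext fun s t c d hs ht => ?_
  rw [← Category.assoc, inj_tensorator p q hs ht, BraidedCategory.braiding_naturality_assoc,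
    inj_tensorator p q ht hs, Preadditive.sum_comp, Preadditive.comp_sum]
  refine Finset.sum_congr rfl fun e _ => ?_
  by_cases he : fuse (some c) (some d) e = none
  · rw [tree_eq_zero he, tree_eq_zero (by rwa [fuse_comm])]
    simp
  · rw [Category.assoc, inj_realizeMap_of_act X (braidHom S T) (pt s t e) e (J := Unit)
      (fun _ => braid u (some c) (some d) e) (fun _ => pt t s e)]
    · simp only [Finset.univ_unique, Finset.sum_const, Finset.card_singleton, one_smul]
      rw [← Category.assoc, B.tree_braid, Linear.comp_smul, Linear.smul_comp]
    · intro v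
      rw [act_braidHom, hs, ht, if_neg he]
      simp

variable (X) in
/-- The inclusion of the unit object into its realization. -/
def unitInj : 𝟙_ C ⟶ realizeObj X (unitObj : FibObj k u) := inj X unitObj star false

variable (p q) in
theorem unitInj_tensorator_left {S : FibObj k u} {s : S.ι} {c : Bool} (hs : S.color s = some c) :
    (unitInj X ⊗ₘ inj X S s c) ≫ tensorator p q unitObj S =
      (λ_ (label X (some c))).hom ≫ inj X (tensorObj unitObj S) (pt star s c) c := by
  have e := inj_tensorator p q (S := (unitObj : FibObj k u)) (s := star) (c := false) rfl hs
  rw [Finset.sum_eq_single c, tree_unit_left] at e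
  · exact e
  · intro c' _ hc
    rw [tree_eq_zero, zero_comp]
    revert hc
    clear e hs
    revert c c'
    decide
  · simp

variable (p q) in
theorem unitInj_tensorator_right {S : FibObj k u} {s : S.ι} {c : Bool} (hs : S.color s = some c) :
    (inj X S s c ⊗ₘ unitInj X) ≫ tensorator p q S unitObj =
      (ρ_ (label X (some c))).hom ≫ inj X (tensorObj S unitObj) (pt s star c) c := by
  have e := inj_tensorator p q (T := (unitObj : FibObj k u)) (t := star) (d := false) hs rfl
  rw [Finset.sum_eq_single c, tree_unit_right] at e
  · exact e
  · intro c' _ hc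
    rw [tree_eq_zero, zero_comp]
    revert hc
    clear e hs
    revert c c'
    decide
  · simp

variable (p q) in
theorem tensorator_left_unit (S : FibObj k u) : (λ_ (realizeObj X S)).hom =
    unitInj X ▷ realizeObj X S ≫ tensorator p q unitObj S ≫ realizeMap X (leftUnitorHom S) := by
  refine ((isCover_id (𝟙_ C)).tensor (isCover_inj X S)).hom_ext fun x => ?_
  obtain ⟨⟨⟩, s, c⟩ := x
  dsimp only
  by_cases hs : S.color s = some c
  · have e : inj X (tensorObj unitObj S) (pt star s c) c ≫ realizeMap X (leftUnitorHom S) =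
        inj X S s c := by
      rw [inj_realizeMap_of_act X (leftUnitorHom S) (pt star s c) c (J := Unit) (fun _ => 1)
        (fun _ => s)]
      · simp
      · intro v
        rw [act_leftUnitorHom, if_pos hs]
        simp
    rw [← tensorHom_id, tensorHom_comp_tensorHom_assoc, Category.comp_id, Category.id_comp,
      reassoc_of% (unitInj_tensorator_left p q hs), e, id_tensorHom,
      MonoidalCategory.leftUnitor_naturality]
  · rw [inj_eq_zero X hs]
    simp only [MonoidalPreadditive.tensor_zero, zero_comp]

variable (p q) in
theorem tensorator_right_unit (S : FibObj k u) : (ρ_ (realizeObj X S)).hom =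
    realizeObj X S ◁ unitInj X ≫ tensorator p q S unitObj ≫ realizeMap X (rightUnitorHom S) := by
  refine ((isCover_inj X S).tensor (isCover_id (𝟙_ C))).hom_ext fun x => ?_
  obtain ⟨⟨s, c⟩, ⟨⟩⟩ := x
  dsimp only
  by_cases hs : S.color s = some c
  · have e : inj X (tensorObj S unitObj) (pt s star c) c ≫ realizeMap X (rightUnitorHom S) =
        inj X S s c := by
      rw [inj_realizeMap_of_act X (rightUnitorHom S) (pt s star c) c (J := Unit) (fun _ => 1)
        (fun _ => s)]
      · simp
      · intro v
        rw [act_rightUnitorHom, if_pos hs]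
        simp
    rw [← id_tensorHom, tensorHom_comp_tensorHom_assoc, Category.comp_id, Category.id_comp,
      reassoc_of% (unitInj_tensorator_right p q hs), e, tensorHom_id,
      MonoidalCategory.rightUnitor_naturality]
  · rw [inj_eq_zero X hs]
    simp only [MonoidalPreadditive.zero_tensor, zero_comp]

variable (X) in
/-- The realization of the unit object is the unit object. -/
def unitIso : 𝟙_ C ≅ realizeObj X (unitObj : FibObj k u) where
  hom := unitInj X
  inv := prj X unitObj star false
  hom_inv_id := inj_prj_self X (S := (unitObj : FibObj k u)) rfl
  inv_hom_id := by
    refine realize_hom_ext X fun s c hs => ?_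
    obtain rfl : false = c := Option.some.inj hs
    rw [Category.comp_id]
    change inj X (unitObj : FibObj k u) star false ≫ prj X unitObj star false ≫
      inj X unitObj star false = _
    rw [← Category.assoc, inj_prj_self X (S := (unitObj : FibObj k u)) (s := star) rfl]
    exact Category.id_comp _

theorem realize_twist (B : FibonacciBasis k p q i j u) (S : FibObj k u) :
    realizeMap X (scalarHom S (twist u)) = θ (realizeObj X S) := by
  refine realize_hom_ext X fun s c hs => ?_
  have nat : inj X S s c ≫ θ (realizeObj X S) = θ (label X (some c)) ≫ inj X S s c :=
    Balanced.twist_naturality _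
  have val : θ (label X (some c)) = twist u (some c) • 𝟙 _ := by
    cases c
    · exact twist_unit.trans (one_smul k _).symm
    · exact B.twist
  rw [nat, val, inj_realizeMap_of_act X (scalarHom S (twist u)) s c (J := Unit)
    (fun _ => twist u (some c)) (fun _ => s)]
  · simp
  · intro v
    rw [act_scalarHom, hs]
    simp

section Functor

variable [hu : Fact (u ^ 4 - u ^ 3 + u ^ 2 - u + 1 = 0)]

/-- The braided monoidal structure of the realization functor. -/
def realizeCore (B : FibonacciBasis k p q i j u) :
    (realize X : FibObj k u ⥤ C).CoreMonoidal where
  εIso := unitIso X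
  μIso S T := ⟨tensorator p q S T, cotensorator i j S T, tensorator_cotensorator B.basis S T,
    cotensorator_tensorator B.basis S T⟩
  μIso_hom_natural_left {S T} f R := by
    have h := tensorator_natural p q f (𝟙 R)
    rw [show realizeMap X (𝟙 R) = 𝟙 _ from (realize X).map_id R, tensorHom_id] at h
    exact h
  μIso_hom_natural_right {S T} R f := by
    have h := tensorator_natural p q (𝟙 R) f
    rw [show realizeMap X (𝟙 R) = 𝟙 _ from (realize X).map_id R, id_tensorHom] at h
    exact h
  associativity S T R := tensorator_assoc B S T R
  left_unitality S := tensorator_left_unit p q S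
  right_unitality S := tensorator_right_unit p q S

theorem realize_braided (B : FibonacciBasis k p q i j u) :
    Nonempty (realize X : FibObj k u ⥤ C).Braided := by
  let _ := (realizeCore B).toMonoidal
  exact ⟨{ braided := fun S T => tensorator_braid B S T }⟩

end Functor

end FibObj

/-! ### Equivalence with the matrix model -/

section Inverse

variable {C : Type u} [Category.{v} C] [MonoidalCategory C] [BraidedCategory C]
  {D : Type u'} [Category.{v'} D] [MonoidalCategory D] [BraidedCategory D]

open Functor.LaxMonoidal Functor.OplaxMonoidal in
/-- The inverse of a braided equivalence is braided: its tensorator is the mate of the inverse of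
that of the functor, and the braiding is natural. -/
theorem inverse_braided (e : C ≌ D) [e.functor.Braided] : Nonempty e.inverse.Braided := by
  let _ := e.inverseMonoidal
  refine ⟨{ braided := fun X Y => ?_ }⟩
  have h (X Y : D) : μ e.inverse X Y =
      e.toAdjunction.homEquiv _ _ (δ e.functor _ _ ≫
        (e.counit.app X ⊗ₘ e.counit.app Y)) := rfl
  have hb (A B : C) : e.functor.map (β_ A B).hom ≫ δ e.functor B A =
      δ e.functor A B ≫ (β_ _ _).hom := by
    simp
  rw [h, h, ← Adjunction.homEquiv_naturality_right, ← Adjunction.homEquiv_naturality_left]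
  congr 1
  rw [reassoc_of% hb, Category.assoc]
  exact congrArg (δ e.functor _ _ ≫ ·)
    (BraidedCategory.braiding_naturality (e.counit.app X) (e.counit.app Y))

theorem balancedEquivalent_symm {k : Type w} [Field k] [Preadditive C] [Linear k C]
    [Preadditive D] [Linear k D] [Balanced C] [Balanced D] (h : BalancedEquivalent k C D) :
    BalancedEquivalent k D C := by
  obtain ⟨F, hF, hl, he, ⟨hb⟩, hθ⟩ := h
  let e := F.asEquivalence
  have : e.functor.Additive := hF
  have : e.functor.Linear k := hl
  let _ : e.functor.Braided := hb
  refine ⟨e.inverse, inferInstance, e.inverseLinear k, inferInstance, inverse_braided e,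
    fun Y => e.functor.map_injective ?_⟩
  have h1 : e.functor.map (θ (e.inverse.obj Y)) = θ (e.functor.obj (e.inverse.obj Y)) := hθ _
  have h2 := e.counit_naturality (θ Y)
  have h3 : e.counit.app Y ≫ θ Y = θ (e.functor.obj (e.inverse.obj Y)) ≫ e.counit.app Y :=
    Balanced.twist_naturality _
  rw [h1, ← cancel_mono (e.counit.app Y), h2, h3]

end Inverse

section Model

variable {k : Type w} [Field k] [IsAlgClosed k] {C : Type u} [Category.{v} C] [Abelian C]
  [Linear k C] [MonoidalCategory C] [MonoidalPreadditive C] [MonoidalLinear k C]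
  [BraidedCategory C] [Balanced C]

/-- A Fibonacci category with parameter `u` is equivalent to the matrix model. -/
theorem IsFibonacci.balancedEquivalent_model (hC : IsFibonacci k C) {u : k}
    (hu : HasFibonacciConstants k C u) [Fact (u ^ 4 - u ^ 3 + u ^ 2 - u + 1 = 0)] :
    BalancedEquivalent k (FibObj k u) C := by
  obtain ⟨X, h, -⟩ := hC.fusion
  obtain ⟨p, q, i, j, B⟩ := hC.fibonacciBasis hu h
  have S := hC.simplePair h
  have := FibObj.realize_faithful (u := u) S
  have := FibObj.realize_full (u := u) S
  have := FibObj.realize_essSurj (u := u) hC.semisimple h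
  exact ⟨FibObj.realize X, inferInstance, inferInstance, { }, FibObj.realize_braided B,
    FibObj.realize_twist B⟩

/-- Duals are transported from the matrix model. -/
theorem IsFibonacci.rigid (hC : IsFibonacci k C) : Nonempty (RigidCategory C) := by
  obtain ⟨u, hu⟩ := hC.exists_hasFibonacciConstants
  have : Fact (u ^ 4 - u ^ 3 + u ^ 2 - u + 1 = 0) := ⟨hC.cyclotomic hu⟩
  obtain ⟨F, -, -, he, ⟨hb⟩, -⟩ := balancedEquivalent_symm (hC.balancedEquivalent_model hu)
  let _ : F.Monoidal := hb.toMonoidal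
  exact ⟨rigidCategoryOfEquivalence (F := F) F.asEquivalence.toAdjunction⟩

end Model

/-! ### Traces and the ribbon identity -/

section Trace

variable {C : Type u} [Category.{v} C] [MonoidalCategory C] [BraidedCategory C] [Balanced C]

/-- The trace of an endomorphism, with respect to a chosen right dual; `qtrace` is the case of the
dual given by `RigidCategory`. The dual is kept variable so that a convenient one can be used. -/
def dualTrace {Y : C} [HasRightDual Y] (f : Y ⟶ Y) : 𝟙_ C ⟶ 𝟙_ C :=
  η_ Y Yᘁ ≫ ((f ≫ θ Y) ▷ Yᘁ) ≫ (β_ Y Yᘁ).hom ≫ ε_ Y Yᘁ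

theorem dualTrace_comm {Y Z : C} [HasRightDual Y] [HasRightDual Z] (f : Y ⟶ Z) (g : Z ⟶ Y) :
    dualTrace (f ≫ g) = dualTrace (g ≫ f) := by
  rw [dualTrace, dualTrace, Category.assoc, comp_whiskerRight_assoc,
    ← reassoc_of% coevaluation_comp_rightAdjointMate f, whisker_exchange_assoc,
    BraidedCategory.braiding_naturality_right_assoc, rightAdjointMate_comp_evaluation,
    ← BraidedCategory.braiding_naturality_left_assoc, ← comp_whiskerRight_assoc, Category.assoc,
    Category.assoc, ← θ_naturality]

/-- The trace does not depend on the choice of the right dual. -/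
theorem dualTrace_eq {Y : C} (h h' : HasRightDual Y) (f : Y ⟶ Y) :
    @dualTrace C _ _ _ _ Y h f = @dualTrace C _ _ _ _ Y h' f := by
  have := @dualTrace_comm C _ _ _ _ Y Y h h' f (𝟙 Y)
  rwa [Category.id_comp, Category.comp_id] at this

theorem dualTrace_id_iso {Y Z : C} [HasRightDual Y] [HasRightDual Z] (e : Y ≅ Z) :
    dualTrace (𝟙 Y) = dualTrace (𝟙 Z) := by
  rw [← e.hom_inv_id, dualTrace_comm, e.inv_hom_id]

theorem dualTrace_braid_iso {Y Y' Z Z' : C} [HasRightDual (Y ⊗ Z)] [HasRightDual (Y' ⊗ Z')]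
    (e : Y ≅ Y') (f : Z ≅ Z') : dualTrace ((β_ Y Z).hom ≫ (β_ Z Y).hom) =
      dualTrace ((β_ Y' Z').hom ≫ (β_ Z' Y').hom) := by
  have h : (β_ Y Z).hom ≫ (β_ Z Y).hom =
      (e.hom ⊗ₘ f.hom) ≫ ((β_ Y' Z').hom ≫ (β_ Z' Y').hom) ≫ (e.inv ⊗ₘ f.inv) := by
    rw [Category.assoc, ← BraidedCategory.braiding_naturality,
      BraidedCategory.braiding_naturality_assoc, ← BraidedCategory.braiding_naturality_assoc]
    simp
  rw [h, dualTrace_comm, Category.assoc, tensorHom_comp_tensorHom, e.inv_hom_id, f.inv_hom_id,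
    id_tensorHom_id, Category.comp_id]

theorem dualTrace_unit [HasRightDual (𝟙_ C)] : dualTrace (𝟙 (𝟙_ C)) = 𝟙 (𝟙_ C) := by
  rw [dualTrace_eq _ ⟨𝟙_ C⟩]
  change (ρ_ (𝟙_ C)).inv ≫ ((𝟙 _ ≫ θ (𝟙_ C)) ▷ 𝟙_ C) ≫ (β_ (𝟙_ C) (𝟙_ C)).hom ≫
    (ρ_ (𝟙_ C)).hom = _
  rw [twist_unit, ← unitors_equal]
  simp

variable [Preadditive C] [MonoidalPreadditive C] {k : Type w} [Field k] [Linear k C]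
  [MonoidalLinear k C]

theorem dualTrace_add {Y : C} [HasRightDual Y] (f g : Y ⟶ Y) :
    dualTrace (f + g) = dualTrace f + dualTrace g := by
  simp [dualTrace]

theorem dualTrace_smul {Y : C} [HasRightDual Y] (c : k) (f : Y ⟶ Y) :
    dualTrace (c • f) = c • dualTrace f := by
  simp [dualTrace]

/-- The ribbon identity holds for `Y` if the identity of `Y` factors through objects on which the
twist is the same scalar as on their duals. -/
theorem ribbon_of_sum {Y : C} [HasRightDual Y] {n : ℕ} {S : Fin n → C}
    [∀ m, HasRightDual (S m)] (r : ∀ m, Y ⟶ S m) (s : ∀ m, S m ⟶ Y)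
    (h : ∑ m, r m ≫ s m = 𝟙 Y) (t : Fin n → k) (ht : ∀ m, θ (S m) = t m • 𝟙 (S m))
    (ht' : ∀ m, θ (S m)ᘁ = t m • 𝟙 (S m)ᘁ) :
    η_ Y Yᘁ ≫ (θ Y ▷ Yᘁ) = η_ Y Yᘁ ≫ (Y ◁ θ Yᘁ) := by
  have key {f g : 𝟙_ C ⟶ Y ⊗ Yᘁ} (hfg : ∀ m, f ≫ r m ▷ Yᘁ = g ≫ r m ▷ Yᘁ) : f = g := by
    have e : 𝟙 (Y ⊗ Yᘁ) = ∑ m, r m ▷ Yᘁ ≫ s m ▷ Yᘁ := by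
      simp only [← comp_whiskerRight, ← sum_whiskerRight, h, id_whiskerRight]
    rw [← Category.comp_id f, ← Category.comp_id g, e, Preadditive.comp_sum, Preadditive.comp_sum]
    refine Finset.sum_congr rfl fun m _ => ?_
    rw [← Category.assoc, hfg, Category.assoc]
  refine key fun m => ?_
  rw [Category.assoc, Category.assoc, ← comp_whiskerRight, ← θ_naturality, ht,
    whisker_exchange, ← reassoc_of% coevaluation_comp_rightAdjointMate (r m), ← whiskerLeft_comp,
    θ_naturality, ht']
  simp only [Linear.comp_smul, Linear.smul_comp, MonoidalLinear.smul_whiskerRight,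
    MonoidalLinear.whiskerLeft_smul, Category.comp_id, Category.id_comp]
  rw [coevaluation_comp_rightAdjointMate]

end Trace

/-! ### Traces of the object `X` -/

section SelfDual

variable {C : Type u} [Category.{v} C] [MonoidalCategory C] [BraidedCategory C] [Balanced C]
  [Preadditive C] [MonoidalPreadditive C] {k : Type w} [Field k] [Linear k C] [MonoidalLinear k C]
  {X : C} {p : X ⊗ X ⟶ X} {q : X ⊗ X ⟶ 𝟙_ C} {i : X ⟶ X ⊗ X} {j : 𝟙_ C ⟶ X ⊗ X} {u : k}

theorem FibonacciBasis.golden (B : FibonacciBasis k p q i j u) :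
    (u + u⁻¹) ^ 2 = u + u⁻¹ + 1 := by
  rw [FibObj.add_inv_eq B.cyclotomic, FibObj.golden B.cyclotomic]

/-- The entry `-a` of the associativity matrix has inverse `1 - a`. -/
theorem FibonacciBasis.coev_mul (B : FibonacciBasis k p q i j u) :
    (1 - (u + u⁻¹)) * -(u + u⁻¹) = 1 := by
  linear_combination B.golden

/-- The object `X` is dual to itself, with evaluation `q`. The zigzag identities pick out the entry
`-a` of the associativity matrix, whose inverse `1 - a` is the factor in the coevaluation. -/
abbrev FibonacciBasis.exactPairing (B : FibonacciBasis k p q i j u) : ExactPairing X X where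
  evaluation' := q
  coevaluation' := (1 - (u + u⁻¹)) • j
  coevaluation_evaluation' := by
    have h := B.trees.right
    have h1 : (α_ X X X).inv ≫ q ▷ X = ((-(u + u⁻¹)) • (X ◁ p ≫ p) +
        (-(u + u⁻¹)) • (X ◁ q ≫ (ρ_ X).hom)) ≫ (λ_ X).inv := by
      rw [Iso.inv_comp_eq, ← Category.assoc, Iso.eq_comp_inv, h]
      simp
    rw [h1]
    simp only [MonoidalLinear.whiskerLeft_smul, Preadditive.add_comp, Linear.smul_comp,
      Preadditive.comp_add, Linear.comp_smul, Category.assoc, B.basis.whiskerLeft_j_p,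
      B.basis.whiskerLeft_j_q, smul_zero, zero_add, smul_smul]
    rw [mul_comm, B.coev_mul, one_smul]
  evaluation_coevaluation' := by
    have h := (B.trees.inverse B.golden).2
    have h1 : (α_ X X X).hom ≫ X ◁ q = ((-(u + u⁻¹)) • (p ▷ X ≫ p) +
        (-(u + u⁻¹)) • (q ▷ X ≫ (λ_ X).hom)) ≫ (ρ_ X).inv := by
      rw [Iso.eq_comp_inv, Category.assoc, h]
    have hp {Z : C} (f : X ⊗ X ⟶ Z) : j ▷ X ≫ p ▷ X ≫ f = 0 := by
      rw [← comp_whiskerRight_assoc, B.basis.j_p, MonoidalPreadditive.zero_whiskerRight, zero_comp]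
    have hq {Z : C} (f : 𝟙_ C ⊗ X ⟶ Z) : j ▷ X ≫ q ▷ X ≫ f = f := by
      rw [← comp_whiskerRight_assoc, B.basis.j_q, id_whiskerRight, Category.id_comp]
    rw [h1]
    simp only [MonoidalLinear.smul_whiskerRight, Preadditive.add_comp, Linear.smul_comp,
      Preadditive.comp_add, Linear.comp_smul, Category.assoc, hp, hq, smul_zero, zero_add,
      smul_smul]
    rw [mul_comm, B.coev_mul, one_smul]

theorem FibonacciBasis.ne_zero (B : FibonacciBasis k p q i j u) : u ≠ 0 :=
  FibObj.ne_zero_of_cyclotomic B.cyclotomic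

theorem FibonacciBasis.dualTrace_id (B : FibonacciBasis k p q i j u) [HasRightDual X] :
    dualTrace (𝟙 X) = (1 - (u + u⁻¹)) • 𝟙 (𝟙_ C) := by
  rw [dualTrace_eq _ (@HasRightDual.mk C _ _ X X B.exactPairing)]
  change ((1 - (u + u⁻¹)) • j) ≫ ((𝟙 X ≫ θ X) ▷ X) ≫ (β_ X X).hom ≫ q = _
  rw [Category.id_comp, B.twist, B.braid_q]
  simp only [MonoidalLinear.smul_whiskerRight, Linear.smul_comp, Linear.comp_smul, id_whiskerRight,
    Category.id_comp, B.basis.j_q, smul_smul]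
  rw [mul_inv_cancel₀ (pow_ne_zero 2 B.ne_zero), one_mul]

/-- The trace is computed from the eigenvalues `u ^ 2` and `u ^ 4` of the double braiding on the
summands `X` and `𝟙` of `X ⊗ X`. -/
theorem FibonacciBasis.dualTrace_braid (B : FibonacciBasis k p q i j u) [HasRightDual X]
    [HasRightDual (X ⊗ X)] :
    dualTrace ((β_ X X).hom ≫ (β_ X X).hom) = (-1 : k) • 𝟙 (𝟙_ C) := by
  let _ : HasRightDual (𝟙_ C) := ⟨𝟙_ C⟩
  have h : (β_ X X).hom ≫ (β_ X X).hom = (u ^ 2) • (p ≫ i) + (u ^ 4) • (q ≫ j) := by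
    rw [← Category.comp_id ((β_ X X).hom ≫ (β_ X X).hom), ← B.basis.total]
    simp only [Category.assoc, Preadditive.comp_add, reassoc_of% B.braid_p, reassoc_of% B.braid_q,
      Linear.smul_comp, Linear.comp_smul, smul_smul]
    congr 2 <;> ring
  rw [h, dualTrace_add, dualTrace_smul, dualTrace_smul, dualTrace_comm p i, dualTrace_comm q j,
    B.basis.i_p, B.basis.j_q, B.dualTrace_id, dualTrace_unit, smul_smul, ← add_smul,
    FibObj.add_inv_eq B.cyclotomic]
  congr 1
  linear_combination (u ^ 2 + u + 1) * B.cyclotomic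

end SelfDual

section Ribbon

variable {C : Type u} [Category.{v} C] [MonoidalCategory C] [BraidedCategory C] [Balanced C]
  [Preadditive C] [MonoidalPreadditive C] {k : Type w} [Field k] [Linear k C] [MonoidalLinear k C]

theorem twist_of_iso {Y Z : C} (e : Y ≅ Z) {t : k} (h : θ Z = t • 𝟙 Z) : θ Y = t • 𝟙 Y := by
  rw [← cancel_mono e.hom, ← θ_naturality, h, Linear.comp_smul, Linear.smul_comp, Category.comp_id,
    Category.id_comp]

/-- A self-dual object and its dual have the same twist. -/
theorem twist_dual_of_iso {Y Z : C} [HasRightDual Y] (hZ : ExactPairing Z Z) (e : Y ≅ Z) {t : k}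
    (h : θ Z = t • 𝟙 Z) : θ Y = t • 𝟙 Y ∧ θ Yᘁ = t • 𝟙 Yᘁ := by
  refine ⟨twist_of_iso e h, ?_⟩
  exact twist_of_iso (rightDualIso (exactPairingCongrLeft e.symm) hZ) h

end Ribbon

/-! ### Modular data -/

section ModularData

variable {k : Type w} [Field k] {C : Type u} [Category.{v} C] [Abelian C] [Linear k C]
  [MonoidalCategory C] [MonoidalPreadditive C] [MonoidalLinear k C]
  [BraidedCategory C] [Balanced C]

attribute [local instance] Abelian.hasFiniteBiproducts

theorem scalar_smul_id {Y : C} (h : 𝟙 Y ≠ 0) (c : k) : scalar k (c • 𝟙 Y) = c := by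
  have := Classical.epsilon_spec (p := fun s : k => c • 𝟙 Y = s • 𝟙 Y) ⟨c, rfl⟩
  exact (smul_left_injective k h this).symm

theorem IsFibonacci.isRibbon [IsAlgClosed k] (hC : IsFibonacci k C) [RigidCategory C] :
    IsRibbon C := by
  obtain ⟨X, h, -⟩ := hC.fusion
  obtain ⟨u, p, q, i, j, B⟩ := hC.exists_fibonacciBasis h
  have key (S : C) [Simple S] : ∃ t : k, θ S = t • 𝟙 S ∧ θ Sᘁ = t • 𝟙 Sᘁ := by
    rcases h.iso_or S with ⟨⟨e⟩⟩ | ⟨⟨e⟩⟩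
    · exact ⟨1, twist_dual_of_iso exactPairingUnit e (twist_unit.trans (one_smul k _).symm)⟩
    · exact ⟨_, twist_dual_of_iso B.exactPairing e B.twist⟩
  intro Y
  obtain ⟨n, S, hS, ⟨e⟩⟩ := hC.semisimple.sum_of_simples Y
  choose t ht using fun m => have := hS m; key (S m)
  refine ribbon_of_sum (fun m => e.hom ≫ biproduct.π S m) (fun m => biproduct.ι S m ≫ e.inv) ?_ t
    (fun m => (ht m).1) fun m => (ht m).2
  have h1 : ∑ m, biproduct.π S m ≫ biproduct.ι S m = 𝟙 (⨁ S) := biproduct.total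
  calc ∑ m, (e.hom ≫ biproduct.π S m) ≫ biproduct.ι S m ≫ e.inv
      = e.hom ≫ (∑ m, biproduct.π S m ≫ biproduct.ι S m) ≫ e.inv := by
        simp only [Preadditive.comp_sum, Preadditive.sum_comp, Category.assoc]
    _ = 𝟙 Y := by rw [h1, Category.id_comp, e.hom_inv_id]

theorem sTilde_eq_of_iso [RigidCategory C] {ι ι' : Type*} {R : ι → C} {R' : ι' → C} {m n : ι}
    {m' n' : ι'} (e : R m ≅ R' m') (f : R n ≅ R' n') :
    sTilde k R m n = sTilde k R' m' n' :=
  congrArg (scalar k) (dualTrace_braid_iso f e)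

theorem qtrace_id_unit [RigidCategory C] : qtrace (𝟙 (𝟙_ C)) = 𝟙 (𝟙_ C) :=
  @dualTrace_unit C _ _ _ _ (RightRigidCategory.rightDual (𝟙_ C))

theorem qtrace_braid_unit_left [RigidCategory C] (Y : C) :
    qtrace ((β_ (𝟙_ C) Y).hom ≫ (β_ Y (𝟙_ C)).hom) = qtrace (𝟙 Y) := by
  rw [braiding_tensorUnit_left, braiding_tensorUnit_right, Category.assoc, Iso.inv_hom_id_assoc,
    Iso.hom_inv_id]
  exact dualTrace_id_iso (λ_ Y)

theorem qtrace_braid_unit_right [RigidCategory C] (Y : C) :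
    qtrace ((β_ Y (𝟙_ C)).hom ≫ (β_ (𝟙_ C) Y).hom) = qtrace (𝟙 Y) := by
  rw [braiding_tensorUnit_left, braiding_tensorUnit_right, Category.assoc, Iso.inv_hom_id_assoc,
    Iso.hom_inv_id]
  exact dualTrace_id_iso (ρ_ Y)

variable {X : C} {p : X ⊗ X ⟶ X} {q : X ⊗ X ⟶ 𝟙_ C} {i : X ⟶ X ⊗ X} {j : 𝟙_ C ⟶ X ⊗ X} {u : k}

theorem FibonacciBasis.sTilde_eq [RigidCategory C] (B : FibonacciBasis k p q i j u)
    (S : SimplePair k X) :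
    sTilde k ![𝟙_ C, X] = !![1, 1 - (u + u⁻¹); 1 - (u + u⁻¹), -1] := by
  ext m n
  fin_cases m <;> fin_cases n
  · refine Eq.trans (congrArg (scalar k) ?_) (scalar_smul_id S.unit_ne (1 : k))
    exact (qtrace_braid_unit_left _).trans (qtrace_id_unit.trans (one_smul k _).symm)
  · refine Eq.trans (congrArg (scalar k) ?_) (scalar_smul_id S.unit_ne (1 - (u + u⁻¹)))
    exact (qtrace_braid_unit_right _).trans B.dualTrace_id
  · refine Eq.trans (congrArg (scalar k) ?_) (scalar_smul_id S.unit_ne (1 - (u + u⁻¹)))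
    exact (qtrace_braid_unit_left _).trans B.dualTrace_id
  · refine Eq.trans (congrArg (scalar k) ?_) (scalar_smul_id S.unit_ne (-1 : k))
    exact B.dualTrace_braid

theorem FibonacciBasis.qdim_obj [RigidCategory C] (B : FibonacciBasis k p q i j u)
    (S : SimplePair k X) : qdim k X = 1 - (u + u⁻¹) :=
  (congrArg (scalar k) B.dualTrace_id).trans (scalar_smul_id S.unit_ne _)

theorem SimplePair.qdim_unit [RigidCategory C] (S : SimplePair k X) : qdim k (𝟙_ C) = 1 :=
  (congrArg (scalar k) (qtrace_id_unit.trans (one_smul k _).symm)).trans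
    (scalar_smul_id S.unit_ne _)

theorem FibonacciBasis.globalDim_eq [RigidCategory C] (B : FibonacciBasis k p q i j u)
    (S : SimplePair k X) : globalDim k ![𝟙_ C, X] = 3 - (u + u⁻¹) := by
  rw [globalDim, Fin.sum_univ_two]
  change qdim k (𝟙_ C) ^ 2 + qdim k X ^ 2 = _
  rw [B.qdim_obj S, S.qdim_unit]
  linear_combination B.golden

/-- If `a = 3` then `a ^ 2 = a + 1` reads `9 = 4`. -/
theorem FibonacciBasis.three_sub_ne_zero [CharZero k] (B : FibonacciBasis k p q i j u) :
    3 - (u + u⁻¹) ≠ 0 := by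
  intro h
  have h3 : u + u⁻¹ = 3 := by linear_combination -h
  have := B.golden
  rw [h3] at this
  norm_num at this

theorem scalar_twist_unit (S : SimplePair k X) : scalar k (θ (𝟙_ C)) = 1 :=
  (congrArg (scalar k) (twist_unit.trans (one_smul k _).symm)).trans (scalar_smul_id S.unit_ne _)

theorem FibonacciBasis.scalar_twist (B : FibonacciBasis k p q i j u) (S : SimplePair k X) :
    scalar k (θ X) = (u ^ 2)⁻¹ := by
  rw [B.twist, scalar_smul_id S.obj_ne]

theorem FibonacciBasis.centralCharge_sq [CharZero k] [RigidCategory C]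
    (B : FibonacciBasis k p q i j u) (S : SimplePair k X) {s : k}
    (hs : s ^ 2 = globalDim k ![𝟙_ C, X]) : centralCharge k ![𝟙_ C, X] s ^ 2 = u⁻¹ := by
  have hu := B.cyclotomic
  have hi : u⁻¹ = -u ^ 4 := by linear_combination FibObj.add_inv_eq hu
  have h2 : (u ^ 2)⁻¹ = -u ^ 3 := by
    rw [← inv_pow, hi]
    linear_combination (u ^ 4 + u ^ 3) * hu
  have hne := B.three_sub_ne_zero
  rw [B.globalDim_eq S] at hs
  rw [← hs] at hne
  rw [centralCharge, Fin.sum_univ_two]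
  change (s⁻¹ * (scalar k (θ (𝟙_ C)) * qdim k (𝟙_ C) ^ 2 + scalar k (θ X) * qdim k X ^ 2)) ^ 2 = _
  rw [B.qdim_obj S, S.qdim_unit, scalar_twist_unit S, B.scalar_twist S, h2, mul_pow, inv_pow,
    inv_mul_eq_iff_eq_mul₀ hne, hs, hi]
  -- the sum over the simple objects is `u - u ^ 3`
  have e : 1 * 1 ^ 2 + -u ^ 3 * (1 - (u + -u ^ 4)) ^ 2 = u - u ^ 3 := by
    linear_combination (-u ^ 7 - u ^ 6 + 2 * u ^ 4 - u ^ 2 + 1) * hu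
  rw [e]
  linear_combination (u ^ 4 + u ^ 3 + u ^ 2) * hu

/-- The `S`-matrix of any system of simple objects is obtained from the one of `![𝟙_ C, X]` by
reindexing. -/
theorem IsSimpleSystem.exists_equiv_sTilde [RigidCategory C] {ι ι' : Type*} {R : ι → C}
    {R' : ι' → C} (h : IsSimpleSystem R) (h' : IsSimpleSystem R') :
    ∃ e : ι ≃ ι', sTilde k R = (sTilde k R').submatrix e e := by
  choose f hf using fun m => h'.exhaustive (R m) (h.simple m)
  have bij : Function.Bijective f := by
    refine ⟨fun m n hmn => ?_, fun m' => ?_⟩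
    · obtain ⟨a⟩ := hf m
      obtain ⟨b⟩ := hf n
      exact h.injective m n ⟨a ≪≫ eqToIso (congrArg R' hmn) ≪≫ b.symm⟩
    · obtain ⟨m, ⟨a⟩⟩ := h.exhaustive (R' m') (h'.simple m')
      obtain ⟨b⟩ := hf m
      exact ⟨m, h'.injective _ _ ⟨b.symm ≪≫ a.symm⟩⟩
  refine ⟨Equiv.ofBijective f bij, ?_⟩
  ext m n
  obtain ⟨a⟩ := hf m
  obtain ⟨b⟩ := hf n
  exact sTilde_eq_of_iso a b

theorem IsFibonacci.isModular [IsAlgClosed k] [CharZero k] (hC : IsFibonacci k C) :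
    IsModular k C := by
  obtain ⟨X, h, -⟩ := hC.fusion
  obtain ⟨u, p, q, i, j, B⟩ := hC.exists_fibonacciBasis h
  refine ⟨hC.semisimple, inferInstance, inferInstance, h.simple_unit, hC.rigid, hC.isRibbon,
    fun n R hR => ?_⟩
  obtain ⟨e, he⟩ := hR.exists_equiv_sTilde (k := k) h
  rw [he, Matrix.det_submatrix_equiv_self, B.sTilde_eq (hC.simplePair h), Matrix.det_fin_two_of]
  intro h0
  refine B.three_sub_ne_zero ?_
  linear_combination -h0 - B.golden

end ModularData

end FibCat

end

theorem mainTheorem4 (k : Type w) [Field k] [IsAlgClosed k] [CharZero k] :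
    -- every braided balanced structure on a Fibonacci category is modular
    (∀ C : FibCat.BalancedFibonacci.{w, v, u} k, FibCat.IsModular k C.carrier) ∧
    -- there are four primitive tenth roots of unity, and one Fibonacci category for each of them
    {u : k | IsPrimitiveRoot u 10}.ncard = 4 ∧
    (∃ Fib : {u : k // IsPrimitiveRoot u 10} → FibCat.BalancedFibonacci.{w, w, w + 1} k,
      (∀ u, FibCat.IsModular k (Fib u).carrier) ∧
      (∀ u, FibCat.HasFibonacciConstants k (Fib u).carrier u.1) ∧
      (∀ u u', FibCat.BraidedEquivalent k (Fib u).carrier (Fib u').carrier → u = u') ∧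
      (∀ C : FibCat.BalancedFibonacci.{w, v, u} k,
        ∃! u, FibCat.BalancedEquivalent k C.carrier (Fib u).carrier) ∧
      (∀ (C : FibCat.BalancedFibonacci.{w, v, u} k) (u : {u : k // IsPrimitiveRoot u 10}),
        FibCat.BalancedEquivalent k C.carrier (Fib u).carrier ↔
          FibCat.HasFibonacciConstants k C.carrier u.1)) ∧
    -- the twist, the dimensions and the modular data of the category with parameter `u`
    (∀ (C : FibCat.BalancedFibonacci.{w, v, u} k) [RigidCategory C.carrier] (u : k),
      FibCat.HasFibonacciConstants k C.carrier u →
      ∀ X : C.carrier, FibCat.IsSimpleSystem ![𝟙_ C.carrier, X] →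
        FibCat.θ (𝟙_ C.carrier) = 𝟙 (𝟙_ C.carrier) ∧
        FibCat.θ X = (u ^ 2)⁻¹ • 𝟙 X ∧
        FibCat.qtrace (𝟙 X) = (1 - (u + u⁻¹)) • 𝟙 (𝟙_ C.carrier) ∧
        FibCat.globalDim k ![𝟙_ C.carrier, X] = 3 - (u + u⁻¹) ∧
        FibCat.sTilde k ![𝟙_ C.carrier, X] =
          !![1, 1 - (u + u⁻¹); 1 - (u + u⁻¹), -1] ∧
        ∀ s : k, s ^ 2 = FibCat.globalDim k ![𝟙_ C.carrier, X] →
          FibCat.sMatrix k ![𝟙_ C.carrier, X] s =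
            s⁻¹ • !![1, 1 - (u + u⁻¹); 1 - (u + u⁻¹), -1] ∧
          (FibCat.centralCharge k ![𝟙_ C.carrier, X] s) ^ 2 = u⁻¹ ∧
          ∀ z : k, z ^ 3 = (FibCat.centralCharge k ![𝟙_ C.carrier, X] s)⁻¹ →
            z ^ 6 = u ∧
            FibCat.tMatrix k ![𝟙_ C.carrier, X] z = z • !![1, 0; 0, (u ^ 2)⁻¹]) := by
  have hFact (u : {u : k // IsPrimitiveRoot u 10}) :
      Fact (u.1 ^ 4 - u.1 ^ 3 + u.1 ^ 2 - u.1 + 1 = 0) :=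
    ⟨(FibCat.isPrimitiveRoot_ten_iff u.1).1 u.2⟩
  have fib_constants (u : {u : k // IsPrimitiveRoot u 10}) :
      FibCat.HasFibonacciConstants k (FibCat.fibCategory k u.1).carrier u.1 :=
    FibCat.FibObj.hasFibonacciConstants
  -- the parameter is an invariant of the braided equivalence class
  have parameter_eq (C : FibCat.BalancedFibonacci.{w, v, u} k) {u : k}
      (hu : FibCat.HasFibonacciConstants k C.carrier u) (u' : {u : k // IsPrimitiveRoot u 10})
      (e : FibCat.BalancedEquivalent k C.carrier (FibCat.fibCategory k u'.1).carrier) :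
      u = u'.1 := by
    obtain ⟨F, _, _, _, ⟨_⟩, -⟩ := e
    exact (FibCat.fibCategory k u'.1).isFibonacci.eq_of_braided (fib_constants u') F hu
  have equiv_of_constants (C : FibCat.BalancedFibonacci.{w, v, u} k)
      (u : {u : k // IsPrimitiveRoot u 10}) (hu : FibCat.HasFibonacciConstants k C.carrier u.1) :
      FibCat.BalancedEquivalent k C.carrier (FibCat.fibCategory k u.1).carrier :=
    FibCat.balancedEquivalent_symm (C.isFibonacci.balancedEquivalent_model hu)
  refine ⟨fun C => C.isFibonacci.isModular, FibCat.ncard_primitiveRoots_ten,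
    ⟨fun u => FibCat.fibCategory k u.1, fun u => (FibCat.fibCategory k u.1).isFibonacci.isModular,
      fib_constants, ?_, ?_, ?_⟩, ?_⟩
  · rintro u u' ⟨F, _, _, _, ⟨_⟩⟩
    exact Subtype.ext ((FibCat.fibCategory k u'.1).isFibonacci.eq_of_braided
      (fib_constants u') F (fib_constants u))
  · intro C
    obtain ⟨u, hu⟩ := C.isFibonacci.exists_hasFibonacciConstants
    refine ⟨⟨u, (FibCat.isPrimitiveRoot_ten_iff u).2 (C.isFibonacci.cyclotomic hu)⟩,
      equiv_of_constants C _ hu, fun u' e => Subtype.ext (parameter_eq C hu u' e).symm⟩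
  · refine fun C u => ⟨fun e => ?_, equiv_of_constants C u⟩
    obtain ⟨u', hu'⟩ := C.isFibonacci.exists_hasFibonacciConstants
    rwa [← parameter_eq C hu' u e]
  · intro C _ u hu X hX
    obtain ⟨p, q, i, j, B⟩ := C.isFibonacci.fibonacciBasis hu hX
    have S := C.isFibonacci.simplePair hX
    refine ⟨FibCat.twist_unit, B.twist, B.dualTrace_id, B.globalDim_eq S, B.sTilde_eq S,
      fun s hs => ⟨by rw [FibCat.sMatrix, B.sTilde_eq S], B.centralCharge_sq S hs,
        fun z hz => ⟨?_, ?_⟩⟩⟩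
    · rw [show z ^ 6 = (z ^ 3) ^ 2 by ring, hz, inv_pow, B.centralCharge_sq S hs, inv_inv]
    · rw [FibCat.tMatrix]
      congr 1
      ext m n
      fin_cases m <;> fin_cases n
      · exact FibCat.scalar_twist_unit S
      · rfl
      · rfl
      · exact B.scalar_twist S
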